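/- Let $p$ be an odd prime, $\Delta\in\mathbb Z_p^\times$ a nonsquare, $\mathbb Z_{p^2}=\mathbb Z_p[\delta]$ with $\delta^2=\Delta$, $\mathbb Q_{p^2}=\mathbb Q_p(\delta)$, and $\sigma$ the nontrivial automorphism of $\mathbb Q_{p^2}/\mathbb Q_p$. Let $U$ be a $2$-dimensional $\mathbb Q_{p^2}$-vector space with a nondegenerate alternating $\mathbb Q_{p^2}$-bilinear form $\langle\ ,\ \rangle$, and let $$V''=\{\beta:U\to U\ \ \sigma\text{-linear}\ :\ \langle\beta x,y\rangle=\langle x,\beta y\rangle^{\sigma}\ \text{for all}\ x,y\in U\}$$ be the $4$-dimensional $\mathbb Q_p$-space of special endomorphisms of $U$, with the quadratic form $Q''$ given by $\beta^2=Q''(\beta)\cdot 1_U$. For a tuple $\boldsymbol\beta=(\beta_1,\dots,\beta_n)$ in $V''$ put $Q''(\boldsymbol\beta)=\tfrac12\big(Q''(\beta_i+\beta_j)-Q''(\beta_i)-Q''(\beta_j)\big)_{i,j}$, a symmetric matrix with diagonal entries $Q''(\beta_i)$. Let $\mathcal B$ be the Bruhat–Tits tree of $PGL(U)$ (geometric realization,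 edges of length $1$), whose vertices are the homothety classes of $\mathbb Z_{p^2}$-lattices in $U$, and let $d$ be its distance. An element $\beta\in V''$ with $Q''(\beta)\ne0$ acts on $\mathcal B$; let $\mathcal B^{\beta}$ be its fixed point set and $$\mathcal T(\beta)=\{x\in\mathcal B\ :\ d(x,\mathcal B^\beta)\le\tfrac12\,\mathrm{ord}_p\,Q''(\beta)\}.$$ For $\boldsymbol\beta=(\beta_1,\beta_2,\beta_3)\in(V'')^3$ with all $Q''(\beta_i)\neq 0$ let $\mathcal T(\boldsymbol\beta)=\mathcal T(\beta_1)\cap\mathcal T(\beta_2)\cap\mathcal T(\beta_3)$, and let $\mathcal T(\boldsymbol\beta)_0$ be the set of vertices of $\mathcal B$ lying in it. If some $Q''(\beta_i)$ vanishes, $\mathcal T(\boldsymbol\beta)_0$ means $\mathcal T(\boldsymbol\beta')_0$ for a $\mathbb Z_p$-basis $\boldsymbol\beta'$ of the $\mathbb Z_p$-span of $\boldsymbol\beta$ with all $Q''(\beta'_i)\ne0$. For a $\mathbb Z_{p^2}$-lattice $\Lambda_0\subset U$ let $N_0=\{\beta\in V'':\beta(\Lambda_0)\subset\Lambda_0\}$,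 and let $S$ be the matrix of $Q''$ on $N_0$ with respect to a $\mathbb Z_p$-basis. For $T'\in\mathrm{Sym}_3(\mathbb Z_p)$ let $$\alpha_p(S,T')=\lim_{t\to\infty}p^{t(6-12)}\,\#\{X\in M_{4,3}(\mathbb Z/p^t)\ :\ {}^tX S X\equiv T' \bmod p^t\}.$$ **Theorem.** Let $T\in p\,\mathrm{Sym}_3(\mathbb Z_p)$ with $\det T\ne0$, and let $\boldsymbol\beta\in(V'')^3$ with $T=p\,Q''(\boldsymbol\beta)$. For every $\Lambda_0$, the lattice $N_0$ has a $\mathbb Z_p$-basis, which can be chosen so that $S=\mathrm{diag}(1,1,1,\Delta)$; for any choice of $\Lambda_0$ and of the basis, $S$ is integral, the limit defining $\alpha_p(S,p^{-1}T)$ exists, and its value is independent of the choice. A basis $\boldsymbol\beta'$ as above exists, the set $\mathcal T(\boldsymbol\beta)_0$ is finite, its cardinality does not depend on the choice of $\boldsymbol\beta'$, and $$|\mathcal T(\boldsymbol\beta)_0|=(1-p^{-4})^{-1}\cdot\alpha_p(S,p^{-1}T).$$ -/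

import Mathlib

open scoped Matrix

noncomputable section

namespace SpecialTree

/-- The field `ℚ_{p²} = ℚ_p(δ)` with `δ² = Δ`; here `p` is odd and `Δ` is a nonsquare unit
of `ℤ_p`. -/
abbrev Qp2 (p : ℕ) [Fact p.Prime] (Δ : ℤ_[p]ˣ) : Type :=
  QuadraticAlgebra ℚ_[p] ((Δ : ℤ_[p]) : ℚ_[p]) 0

/-- The absolute value of `ℚ_{p²}` extending that of `ℚ_p`: `|a| = |N(a)|^{1/2}`. -/
def absK {p : ℕ} [Fact p.Prime] {Δ : ℤ_[p]ˣ} (a : Qp2 p Δ) : ℝ :=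
  Real.sqrt ‖QuadraticAlgebra.norm a‖

/-- The ring `ℤ_{p²} = ℤ_p[δ]`. -/
def Zp2 (p : ℕ) [Fact p.Prime] (Δ : ℤ_[p]ˣ) : Subring (Qp2 p Δ) where
  carrier := {a | ‖a.re‖ ≤ 1 ∧ ‖a.im‖ ≤ 1}
  mul_mem' := by
    rintro a b ⟨ha, ha'⟩ ⟨hb, hb'⟩
    have hΔ : ‖((Δ : ℤ_[p]) : ℚ_[p])‖ ≤ 1 := PadicInt.norm_le_one _
    have hm : ∀ x y : ℚ_[p], ‖x‖ ≤ 1 → ‖y‖ ≤ 1 → ‖x * y‖ ≤ 1 := fun x y hx hy => by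
      rw [norm_mul]; exact mul_le_one₀ hx (norm_nonneg _) hy
    constructor
    · rw [QuadraticAlgebra.re_mul]
      exact (Padic.nonarchimedean _ _).trans
        (max_le (hm _ _ ha hb) (hm _ _ (hm _ _ hΔ ha') hb'))
    · rw [QuadraticAlgebra.im_mul, zero_mul, zero_mul, add_zero]
      exact (Padic.nonarchimedean _ _).trans (max_le (hm _ _ ha hb') (hm _ _ ha' hb))
  one_mem' := by
    constructor
    · change ‖(1 : ℚ_[p])‖ ≤ 1
      simp
    · change ‖(0 : ℚ_[p])‖ ≤ 1
      simp
  add_mem' := by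
    rintro a b ⟨ha, ha'⟩ ⟨hb, hb'⟩
    exact ⟨(Padic.nonarchimedean _ _).trans (max_le ha hb),
      (Padic.nonarchimedean _ _).trans (max_le ha' hb')⟩
  zero_mem' := by
    constructor
    · change ‖(0 : ℚ_[p])‖ ≤ 1
      simp
    · change ‖(0 : ℚ_[p])‖ ≤ 1
      simp
  neg_mem' := by
    rintro a ⟨ha, ha'⟩
    constructor
    · simpa using ha
    · simpa using ha'

section Building

variable {p : ℕ} [Fact p.Prime] (Δ : ℤ_[p]ˣ) (U : Type*) [AddCommGroup U] [Module (Qp2 p Δ) U]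

/-- An ultrametric norm on the `ℚ_{p²}`-vector space `U`. -/
structure UNorm where
  toFun : U → ℝ
  nonneg : ∀ x, 0 ≤ toFun x
  eq_zero_iff : ∀ x, toFun x = 0 ↔ x = 0
  map_smul : ∀ (a : Qp2 p Δ) (x : U), toFun (a • x) = absK a * toFun x
  map_add_le : ∀ x y, toFun (x + y) ≤ max (toFun x) (toFun y)

instance : CoeFun (UNorm Δ U) (fun _ => U → ℝ) := ⟨UNorm.toFun⟩

/-- Two norms are homothetic if they differ by a positive real factor. -/
def homothety : Setoid (UNorm Δ U) where
  r α α' := ∃ c : ℝ, 0 < c ∧ ∀ x, α' x = c * α x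
  iseqv :=
    { refl := fun α => ⟨1, one_pos, fun x => (one_mul _).symm⟩
      symm := by
        rintro α α' ⟨c, hc, h⟩
        exact ⟨c⁻¹, inv_pos.2 hc, fun x => by rw [h, inv_mul_cancel_left₀ hc.ne']⟩
      trans := by
        rintro α α' α'' ⟨c, hc, h⟩ ⟨d, hd, h'⟩
        exact ⟨d * c, mul_pos hd hc, fun x => by rw [h', h, mul_assoc]⟩ }

/-- The points of the (geometric realization of the) Bruhat–Tits building of `PGL(U)`:
homothety classes of ultrametric norms on `U` (Goldman–Iwahori). For `dim U = 2` this is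
a tree. -/
def Building : Type _ := Quotient (homothety Δ U)

variable {Δ U}

/-- The distance of two norms: `sup_x log_p (α(x)/α'(x)) - inf_y log_p (α(y)/α'(y))`. If, for
some basis, `α` is the norm `max(|x|, |y|)` and `α'` the norm `max(p^s |x|, p^t |y|)`, then it
is `|s - t|`; in particular edges of the tree have length `1`. -/
def UNorm.dist (α α' : UNorm Δ U) : ℝ :=
  sSup {r : ℝ | ∃ x y : U, x ≠ 0 ∧ y ≠ 0 ∧
    r = Real.logb p ((α x * α' y) / (α' x * α y))}

/-- The distance of the building. -/
def Building.dist : Building Δ U → Building Δ U → ℝ :=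
  Quotient.lift₂ UNorm.dist (by
    rintro α α' β β' ⟨c, hc, h⟩ ⟨d, hd, h'⟩
    have : ∀ x y : U, (β x * β' y) / (β' x * β y) = (α x * α' y) / (α' x * α y) := by
      intro x y
      rw [h, h, h', h', show c * α x * (d * α' y) = (c * d) * (α x * α' y) by ring,
        show d * α' x * (c * α y) = (c * d) * (α' x * α y) by ring,
        mul_div_mul_left _ _ (mul_pos hc hd).ne']
    simp only [UNorm.dist, this])

/-- `α` is the norm of the lattice `Λ`: `α(x) = inf {|a| : x ∈ aΛ}`. -/
def UNorm.IsNormOf (α : UNorm Δ U) (Λ : Submodule (Zp2 p Δ) U) : Prop :=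
  ∀ x : U, α x = sInf {r : ℝ | ∃ (a : Qp2 p Δ) (y : U), y ∈ Λ ∧ x = a • y ∧ r = absK a}

/-- The vertices of the building: the classes of the norms of `ℤ_{p²}`-lattices in `U`
(homothetic lattices give the same vertex). -/
def Building.IsVertex (b : Building Δ U) : Prop :=
  ∃ (Λ : Submodule (Zp2 p Δ) U) (α : UNorm Δ U),
    Λ.IsLattice (Qp2 p Δ) ∧ α.IsNormOf Λ ∧ Quotient.mk (homothety Δ U) α = b

end Building

section SpecialEndomorphisms

variable {p : ℕ} [Fact p.Prime] {Δ : ℤ_[p]ˣ} {U : Type*} [AddCommGroup U]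
  [Module (Qp2 p Δ) U] [Module ℚ_[p] U] [IsScalarTower ℚ_[p] (Qp2 p Δ) U]

/-- The `ℚ_p`-space `V''` of special endomorphisms of `(U, ⟨ , ⟩)`: the `σ`-linear `β` with
`β = β*`, where `⟨βx, y⟩ = ⟨x, β*y⟩^σ`. Here `σ` is the conjugation `δ ↦ -δ` of `ℚ_{p²}`. -/
def SpecialEnd (B : LinearMap.BilinForm (Qp2 p Δ) U) :
    Submodule ℚ_[p] (U →ₛₗ[starRingEnd (Qp2 p Δ)] U) where
  carrier := {β | ∀ x y, B (β x) y = starRingEnd (Qp2 p Δ) (B x (β y))}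
  add_mem' := by
    intro β γ hβ hγ x y
    have h1 := hβ x y
    have h2 := hγ x y
    simp only [LinearMap.add_apply, map_add] at *
    rw [h1, h2]
  zero_mem' := by
    intro x y
    simp
  smul_mem' := by
    intro c β hβ x y
    have h := hβ x y
    have hc : ∀ z : U, c • z = algebraMap ℚ_[p] (Qp2 p Δ) c • z := fun z =>
      algebra_compatible_smul (Qp2 p Δ) c z
    have hs : starRingEnd (Qp2 p Δ) (algebraMap ℚ_[p] (Qp2 p Δ) c)
        = algebraMap ℚ_[p] (Qp2 p Δ) c := by
      rw [starRingEnd_apply, QuadraticAlgebra.algebraMap_eq, QuadraticAlgebra.star_mk]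
      simp
    simp only [LinearMap.smul_apply, hc, map_smul, smul_eq_mul, map_mul, hs]
    rw [h]

variable {B : LinearMap.BilinForm (Qp2 p Δ) U}

/-- For a nondegenerate alternating form on a plane, the square of a special endomorphism is
a scalar in `ℚ_p`. -/
theorem exists_sq_eq (hΔ : ¬ IsSquare (Δ : ℤ_[p]))
    (hU : Module.finrank (Qp2 p Δ) U = 2) (hB : B.IsAlt) (hnd : B.Nondegenerate)
    (β : SpecialEnd B) : ∃ q : ℚ_[p], ∀ x, β.1 (β.1 x) = q • x := by
  have : Fact (∀ r : ℚ_[p], r ^ 2 ≠ ((Δ : ℤ_[p]) : ℚ_[p]) + 0 * r) := ⟨by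
    intro r hr
    rw [zero_mul, add_zero] at hr
    have hr1 : ‖r‖ ≤ 1 := by
      have h1 : ‖r‖ ^ 2 ≤ 1 := by
        rw [← norm_pow, hr]
        exact PadicInt.norm_le_one _
      exact (sq_le_one_iff₀ (norm_nonneg r)).1 h1
    refine hΔ ⟨⟨r, hr1⟩, Subtype.ext ?_⟩
    change ((Δ : ℤ_[p]) : ℚ_[p]) = r * r
    rw [← hr, sq]⟩
  have : Module.Finite (Qp2 p Δ) U := Module.finite_of_finrank_eq_succ hU
  have : Nontrivial U := Module.nontrivial_of_finrank_pos (R := Qp2 p Δ) (by omega)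
  let f : U →ₗ[Qp2 p Δ] U := β.1.comp β.1
  have hf : ∀ x, f x = β.1 (β.1 x) := fun _ => rfl
  have hBf : ∀ x, B x (f x) = 0 := fun x => by
    have h := β.2 (β.1 x) x
    rw [hB, map_zero] at h
    have h2 := LinearMap.IsAlt.neg hB (β.1 (β.1 x)) x
    rw [hf, ← h2, h, neg_zero]
  have key : ∃ a : Qp2 p Δ, ∀ x, f x = a • x := by
    obtain ⟨a, ha⟩ := f.exists_eq_smul_id_of_forall_notLinearIndependent (by
      intro x hx
      have hspan : Submodule.span (Qp2 p Δ) (Set.range ![x, f x]) = ⊤ :=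
        hx.span_eq_top_of_card_eq_finrank' (by simp [hU])
      have hle : (⊤ : Submodule (Qp2 p Δ) U) ≤ LinearMap.ker (B x) := by
        rw [← hspan, Submodule.span_le]
        rintro _ ⟨i, rfl⟩
        fin_cases i
        · exact hB x
        · exact hBf x
      have hx0 : x = 0 := hnd.1 x fun y => hle (Submodule.mem_top (x := y))
      exact hx.ne_zero 0 hx0)
    exact ⟨a, fun x => by rw [ha]; rfl⟩
  obtain ⟨a, ha⟩ := key
  have hstar : star a = a := by
    obtain ⟨x, hx⟩ := exists_ne (0 : U)
    by_cases h0 : β.1 x = 0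
    · have h1 := ha x
      rw [hf, h0, map_zero] at h1
      have : a = 0 := (smul_eq_zero.1 h1.symm).resolve_right hx
      rw [this, star_zero]
    · have h1 : β.1 (f x) = starRingEnd (Qp2 p Δ) a • β.1 x := by
        rw [ha, LinearMap.map_smulₛₗ]
      have h2 : β.1 (f x) = a • β.1 x := ha (β.1 x)
      rw [h2] at h1
      exact (smul_left_injective _ h0 h1).symm
  have him : a.im = 0 := by
    have h := congrArg QuadraticAlgebra.im hstar
    rw [QuadraticAlgebra.im_star] at h
    linear_combination (-1 / 2 : ℚ_[p]) * h
  refine ⟨a.re, fun x => ?_⟩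
  rw [← hf, ha, algebra_compatible_smul (Qp2 p Δ) a.re x]
  congr 1
  rw [QuadraticAlgebra.algebraMap_eq]
  exact QuadraticAlgebra.ext rfl him

/-- The quadratic form `Q''` on `V''`, defined by `β² = Q''(β) · 1_U`. -/
def Qpp (β : SpecialEnd B) : ℚ_[p] :=
  open Classical in
  if h : ∃ q : ℚ_[p], ∀ x, β.1 (β.1 x) = q • x then h.choose else 0

/-- The Gram matrix `Q''(β) = (½ (β_i, β_j))` of a tuple, where
`(β, γ) = Q''(β + γ) - Q''(β) - Q''(γ)`; its diagonal entries are the `Q''(β_i)`. -/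
def gram {ι : Type*} (β : ι → SpecialEnd B) : Matrix ι ι ℚ_[p] :=
  Matrix.of fun i j => (Qpp (β i + β j) - Qpp (β i) - Qpp (β j)) / 2

/-- The fixed point set of `β` (with `β` bijective) in the building. The action is
`[α] ↦ [α ∘ β⁻¹]`, so that `[α]` is fixed if and only if `α ∘ β` is homothetic to `α`. -/
def fixedPoints (β : SpecialEnd B) : Set (Building Δ U) :=
  {b | ∃ α : UNorm Δ U, Quotient.mk (homothety Δ U) α = b ∧
    ∃ c : ℝ, 0 < c ∧ ∀ x, α (β.1 x) = c * α x}

/-- The closed tube of radius `½ ord_p Q''(β)` around the fixed point set of a special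
endomorphism `β` with `Q''(β) ≠ 0`. -/
def tube (β : SpecialEnd B) : Set (Building Δ U) :=
  {b | sInf (Building.dist b '' fixedPoints β) ≤ (1 / 2 : ℝ) * ((Qpp β).valuation : ℝ)}

/-- `𝒯(β)₀`, the vertices lying in the intersection of the tubes of the components of `β`. -/
def tubeVertices {ι : Type*} (β : ι → SpecialEnd B) : Set (Building Δ U) :=
  {b | b.IsVertex ∧ ∀ i, b ∈ tube (β i)}

/-- The tuple `gβ`, with `(gβ)_i = ∑_j g_ij β_j`, for `g ∈ GL(ℤ_p)`: another `ℤ_p`-basis of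
the `ℤ_p`-span of a linearly independent tuple `β`. -/
def changeBasis {ι : Type*} [Fintype ι] [DecidableEq ι] (g : GL ι ℤ_[p])
    (β : ι → SpecialEnd B) : ι → SpecialEnd B :=
  fun i => ∑ j, (((g : Matrix ι ι ℤ_[p]) i j : ℤ_[p]) : ℚ_[p]) • β j

/-- `e` is a `ℤ_p`-basis of the lattice `N₀ = {β ∈ V'' : β(Λ₀) ⊆ Λ₀}` in `V''`. -/
def IsBasisOfN₀ {ι : Type*} [Fintype ι] (Λ₀ : Submodule (Zp2 p Δ) U)
    (e : ι → SpecialEnd B) : Prop :=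
  LinearIndependent ℚ_[p] e ∧
    ∀ β : SpecialEnd B, (∀ x ∈ Λ₀, β.1 x ∈ Λ₀) ↔
      ∃ c : ι → ℤ_[p], β = ∑ i, ((c i : ℤ_[p]) : ℚ_[p]) • e i

end SpecialEndomorphisms

/-- `α` is the classical representation density `α_p(S, T)` of `T ∈ Sym_n(ℤ_p)` by
`S ∈ Sym_m(ℤ_p)`:
`lim_{t → ∞} p^{t (n(n+1)/2 - mn)} #{X ∈ M_{m,n}(ℤ/p^t) : ᵗX S X ≡ T mod p^t}`. -/
def HasRepresentationDensity {p : ℕ} [Fact p.Prime] {m n : ℕ}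
    (S : Matrix (Fin m) (Fin m) ℤ_[p]) (T : Matrix (Fin n) (Fin n) ℤ_[p]) (α : ℝ) : Prop :=
  Filter.Tendsto
    (fun t : ℕ => (p : ℝ) ^ ((t : ℤ) * (((n * (n + 1) / 2 : ℕ) : ℤ) - (m : ℤ) * (n : ℤ))) *
      (Nat.card {X : Matrix (Fin m) (Fin n) (ZMod (p ^ t)) //
        Xᵀ * S.map (PadicInt.toZModPow t) * X = T.map (PadicInt.toZModPow t)} : ℝ))
    Filter.atTop (nhds α)

end SpecialTree

end

/-! A vertex is the class of the norm `α` of a lattice `Λ`. It lies in the tube of `β` exactly when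
`α(βx) ≤ α(x)` for all `x`, that is, when `βΛ ⊂ Λ` (`mem_tube_iff'`): the norm `max(α, c⁻¹ α∘β)`
with `c² = |Q''(β)|` is fixed by `β` and close enough to `α`. So the left side counts the classes of
lattices stable under the `ℤ_p`-span of `β`, whatever its basis. The special endomorphisms
preserving a lattice form the quadratic lattice `x² - Δy² + 2bc`, for every `Λ`
(`exists_modelEquiv`), and this is `diag(1,1,1,Δ)` in another basis (`exists_modelMatrix_equiv`);
hence the density does not depend on `Λ₀` or the basis.

Let `T' = p⁻¹T = Q''(β)`, and take `n` with `pⁿ ∤ det T'`. Both sides are sorted by imprimitivity. A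
vertex `b` determines the module `D ⊂ ℤ_p³` of all `c` with `∑ c_i β_i` in `pⁿ N_b`, where `N_b` is
the stabilizer lattice of `b`; a solution `X` modulo `p^t` determines the module of all `c` with `Xc
≡ 0 mod pⁿ`. If `(k, a)` is the Smith form of `D`, the vertices over `D` are the primitive vertices
of the tuple `p^{-a} kᵗ β` (`vertexKernel_eq_iff`), and the solutions over `D` come from the
primitive representations of `p^{-a} kᵗ T' k p^{-a}` (`card_repKernel_eq`). Hensel's lemma brings
the latter down to `𝔽_p` (`card_primRep_modPow`).

There remains a primitive identity: the number of primitive vertices times `p²(p⁴ - 1)` is the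
number of primitive representations over `𝔽_p` (`ncard_primitiveVertices`). Diagonalize the Gram
matrix as `diag(t₀,t₁,t₂)` with `t₀ ∣ t₁ ∣ t₂`. If `t₁` is not a unit both numbers vanish, because
the form over `𝔽_p` has no totally isotropic plane. If `t₀, t₁` are units, `j = β₀β₁` satisfies `j²
= -t₀t₁`, and stable norms split along the eigenlines of `j`. If `-t₀t₁` is a square in `ℤ_p`, then
`β₀` exchanges the lines and leaves one candidate vertex, primitive exactly when `t₂` is a unit.
Otherwise the vertices stable under `β₀, β₁` form an apartment, `β₂` cuts out a segment of length
`ord t₂`, and only its ends are primitive. The resulting numbers are the factors found over `𝔽_p` in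
`card_primRep_diagonal`.

Summing over `D`, the number of solutions modulo `p^t` for `t > 2n` is `p^{6(t-1)} p² (p⁴ - 1)`
times the number of vertices, so the density is `1 - p⁻⁴` times that number. -/

noncomputable section

set_option linter.unusedSectionVars false

namespace SpecialTree

/-! ### Arithmetic of the unramified quadratic extension of `ℚ_p`. -/

section Arithmetic

variable {p : ℕ} [Fact p.Prime]

theorem norm_two_eq_one [hp : Fact (p ≠ 2)] : ‖(2 : ℤ_[p])‖ = 1 := by
  have h : ¬ ‖((2 : ℕ) : ℤ_[p])‖ < 1 := by
    rw [PadicInt.norm_natCast_lt_one_iff]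
    intro h
    exact hp.out ((Nat.prime_dvd_prime_iff_eq Fact.out Nat.prime_two).1 h)
  exact le_antisymm (PadicInt.norm_le_one _) (not_lt.1 h)

theorem isUnit_two [Fact (p ≠ 2)] : IsUnit (2 : ℤ_[p]) :=
  PadicInt.isUnit_iff.2 norm_two_eq_one

/-- Hensel's lemma for square roots of units. -/
theorem isSquare_of_norm_sub_lt_one [Fact (p ≠ 2)] {u w : ℤ_[p]} (hw : IsUnit w)
    (h : ‖u ^ 2 - w‖ < 1) : IsSquare w := by
  have hu : ‖u‖ = 1 := by
    refine le_antisymm (PadicInt.norm_le_one _) (not_lt.1 fun hu => ?_)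
    have h1 : ‖u ^ 2‖ < 1 := by
      rw [norm_pow]; exact pow_lt_one₀ (norm_nonneg _) hu two_ne_zero
    have h2 : ‖w‖ < 1 := by
      have : w = u ^ 2 + -(u ^ 2 - w) := by ring
      rw [this]
      refine (PadicInt.nonarchimedean _ _).trans_lt (max_lt h1 ?_)
      rwa [norm_neg]
    rw [PadicInt.isUnit_iff.1 hw] at h2
    exact lt_irrefl _ h2
  obtain ⟨z, hz, -⟩ := hensels_lemma (p := p) (R := ℤ_[p])
    (F := (Polynomial.X ^ 2 - Polynomial.C w : Polynomial ℤ_[p])) (a := u) (by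
      simp only [map_sub, map_pow, Polynomial.aeval_X, Polynomial.aeval_C,
        Polynomial.derivative_X_pow, Polynomial.derivative_C, sub_zero, map_mul]
      simpa [norm_two_eq_one, hu] using h)
  refine ⟨z, ?_⟩
  simp only [map_sub, map_pow, Polynomial.aeval_X, Polynomial.aeval_C] at hz
  have : z ^ 2 = w := by simpa [sub_eq_zero] using hz
  rw [← this, sq]

/-- By Hensel's lemma a smaller value would make `Δ` a square. This is the anisotropy modulo `p` of
the norm form. -/
theorem norm_sq_sub_eq_one [Fact (p ≠ 2)] {Δ : ℤ_[p]ˣ} [hΔ : Fact (¬ IsSquare (Δ : ℤ_[p]))]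
    (u : ℤ_[p]) : ‖u ^ 2 - Δ‖ = 1 :=
  le_antisymm (PadicInt.norm_le_one _)
    (not_lt.1 fun h => hΔ.out (isSquare_of_norm_sub_lt_one Δ.isUnit h))

variable {Δ : ℤ_[p]ˣ}

instance fact_forall_sq_ne [hΔ : Fact (¬ IsSquare (Δ : ℤ_[p]))] :
    Fact (∀ r : ℚ_[p], r ^ 2 ≠ ((Δ : ℤ_[p]) : ℚ_[p]) + 0 * r) := ⟨by
  intro r hr
  rw [zero_mul, add_zero] at hr
  have hr1 : ‖r‖ ≤ 1 := by
    have h1 : ‖r‖ ^ 2 ≤ 1 := by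
      rw [← norm_pow, hr]
      exact PadicInt.norm_le_one _
    exact (sq_le_one_iff₀ (norm_nonneg r)).1 h1
  refine hΔ.out ⟨⟨r, hr1⟩, Subtype.ext ?_⟩
  change ((Δ : ℤ_[p]) : ℚ_[p]) = r * r
  rw [← hr, sq]⟩

theorem norm_unit_coe (Δ : ℤ_[p]ˣ) : ‖((Δ : ℤ_[p]) : ℚ_[p])‖ = 1 :=
  PadicInt.isUnit_iff.1 Δ.isUnit

variable [Fact (p ≠ 2)] [Fact (¬ IsSquare (Δ : ℤ_[p]))]

/-- For `‖y‖ < ‖x‖` the first term dominates; otherwise division by `y` reduces to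
`norm_sq_sub_eq_one`. Hence the absolute value is the maximum norm in the basis `1, δ`. -/
theorem norm_sq_sub (x y : ℚ_[p]) :
    ‖x ^ 2 - ((Δ : ℤ_[p]) : ℚ_[p]) * y ^ 2‖ = max ‖x‖ ‖y‖ ^ 2 := by
  have hΔ1 := norm_unit_coe Δ
  rcases lt_or_ge ‖y‖ ‖x‖ with h | h
  · rw [max_eq_left h.le, sub_eq_add_neg, Padic.add_eq_max_of_ne, norm_neg, norm_mul, hΔ1, one_mul,
      norm_pow, norm_pow, max_eq_left]
    · gcongr
    · rw [norm_neg, norm_mul, hΔ1, one_mul, norm_pow, norm_pow]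
      exact (pow_lt_pow_left₀ h (norm_nonneg _) two_ne_zero).ne'
  · rw [max_eq_right h]
    by_cases hy : y = 0
    · subst hy
      have : x = 0 := by simpa using h
      simp [this]
    have hu : ‖x / y‖ ≤ 1 := by
      rw [norm_div]; exact div_le_one_of_le₀ h (norm_nonneg _)
    have h1 := norm_sq_sub_eq_one (Δ := Δ) (⟨x / y, hu⟩ : ℤ_[p])
    have h2 : ‖(x / y) ^ 2 - ((Δ : ℤ_[p]) : ℚ_[p])‖ = 1 := by
      exact h1
    have h3 : x ^ 2 - ((Δ : ℤ_[p]) : ℚ_[p]) * y ^ 2 =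
        ((x / y) ^ 2 - ((Δ : ℤ_[p]) : ℚ_[p])) * y ^ 2 := by field_simp
    rw [h3, norm_mul, h2, one_mul, norm_pow]

theorem absK_eq_max (a : Qp2 p Δ) : absK a = max ‖a.re‖ ‖a.im‖ := by
  have : QuadraticAlgebra.norm a = a.re ^ 2 - ((Δ : ℤ_[p]) : ℚ_[p]) * a.im ^ 2 := by
    rw [QuadraticAlgebra.norm_def]; ring
  rw [absK, this, norm_sq_sub, Real.sqrt_sq (le_max_of_le_left (norm_nonneg _))]

omit [Fact (p ≠ 2)] [Fact (¬ IsSquare (Δ : ℤ_[p]))] in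
theorem absK_nonneg (a : Qp2 p Δ) : 0 ≤ absK a := Real.sqrt_nonneg _

omit [Fact (p ≠ 2)] [Fact (¬ IsSquare (Δ : ℤ_[p]))] in
theorem absK_mul (a b : Qp2 p Δ) : absK (a * b) = absK a * absK b := by
  rw [absK, map_mul, norm_mul, Real.sqrt_mul (norm_nonneg _), absK, absK]

omit [Fact (p ≠ 2)] in
theorem absK_eq_zero {a : Qp2 p Δ} : absK a = 0 ↔ a = 0 := by
  rw [absK, Real.sqrt_eq_zero (norm_nonneg _), norm_eq_zero, QuadraticAlgebra.norm_eq_zero_iff_eq_zero]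

omit [Fact (p ≠ 2)] [Fact (¬ IsSquare (Δ : ℤ_[p]))] in
@[simp] theorem absK_zero : absK (0 : Qp2 p Δ) = 0 := by simp [absK]

omit [Fact (p ≠ 2)] [Fact (¬ IsSquare (Δ : ℤ_[p]))] in
@[simp] theorem absK_one : absK (1 : Qp2 p Δ) = 1 := by simp [absK]

omit [Fact (p ≠ 2)] in
theorem absK_inv (a : Qp2 p Δ) : absK a⁻¹ = (absK a)⁻¹ := by
  by_cases ha : a = 0
  · simp [ha]
  · have : absK a⁻¹ * absK a = 1 := by rw [← absK_mul, inv_mul_cancel₀ ha, absK_one]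
    exact eq_inv_of_mul_eq_one_left this

omit [Fact (p ≠ 2)] in
theorem absK_div (a b : Qp2 p Δ) : absK (a / b) = absK a / absK b := by
  rw [div_eq_mul_inv, absK_mul, absK_inv, div_eq_mul_inv]

omit [Fact (p ≠ 2)] [Fact (¬ IsSquare (Δ : ℤ_[p]))] in
@[simp] theorem absK_star (a : Qp2 p Δ) : absK (starRingEnd _ a) = absK a := by
  rw [absK, absK, starRingEnd_apply, QuadraticAlgebra.norm_star]

omit [Fact (p ≠ 2)] [Fact (¬ IsSquare (Δ : ℤ_[p]))] in
@[simp] theorem absK_neg (a : Qp2 p Δ) : absK (-a) = absK a := by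
  rw [absK, absK, QuadraticAlgebra.norm_neg]

omit [Fact (p ≠ 2)] [Fact (¬ IsSquare (Δ : ℤ_[p]))] in
@[simp] theorem absK_algebraMap (a : ℚ_[p]) : absK (algebraMap ℚ_[p] (Qp2 p Δ) a) = ‖a‖ := by
  rw [absK, QuadraticAlgebra.norm_algebraMap, norm_pow, Real.sqrt_sq (norm_nonneg _)]

theorem absK_add_le (a b : Qp2 p Δ) : absK (a + b) ≤ max (absK a) (absK b) := by
  simp only [absK_eq_max, QuadraticAlgebra.re_add, QuadraticAlgebra.im_add]
  refine max_le ((Padic.nonarchimedean _ _).trans ?_) ((Padic.nonarchimedean _ _).trans ?_)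
  · exact max_le_max (le_max_left _ _) (le_max_left _ _)
  · exact max_le_max (le_max_right _ _) (le_max_right _ _)

theorem mem_Zp2_iff {a : Qp2 p Δ} : a ∈ Zp2 p Δ ↔ absK a ≤ 1 := by
  rw [absK_eq_max, max_le_iff]; rfl

/-- The extension is unramified: its value group is that of `ℚ_p`. -/
theorem exists_absK_eq_zpow {a : Qp2 p Δ} (ha : a ≠ 0) : ∃ n : ℤ, absK a = (p : ℝ) ^ n := by
  rw [absK_eq_max]
  have h0 : a.re ≠ 0 ∨ a.im ≠ 0 := by
    by_contra! h
    exact ha (QuadraticAlgebra.ext h.1 h.2)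
  rcases max_choice ‖a.re‖ ‖a.im‖ with h | h
  · rw [h]
    by_cases hr : a.re = 0
    · rw [hr, norm_zero] at h
      have : a.im = 0 := by
        have := le_max_right (0 : ℝ) ‖a.im‖
        rw [h] at this; simpa using this
      exact absurd hr (h0.resolve_right (by simpa using this))
    · exact ⟨_, Padic.norm_eq_zpow_neg_valuation hr⟩
  · rw [h]
    by_cases hr : a.im = 0
    · rw [hr, norm_zero] at h
      have : a.re = 0 := by
        have := le_max_left ‖a.re‖ (0 : ℝ)
        rw [h] at this; simpa using this
      exact absurd hr (h0.resolve_left (by simpa using this))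
    · exact ⟨_, Padic.norm_eq_zpow_neg_valuation hr⟩

omit [Fact (p ≠ 2)] in
theorem one_lt_p : (1 : ℝ) < p := by exact_mod_cast (Fact.out : p.Prime).one_lt

omit [Fact (p ≠ 2)] in
theorem p_pos : (0 : ℝ) < p := by exact_mod_cast (Fact.out : p.Prime).pos

/-- The valuation ring of `ℚ_{p²}`. -/
def valSubring (p : ℕ) [Fact p.Prime] (Δ : ℤ_[p]ˣ) [Fact (p ≠ 2)]
    [Fact (¬ IsSquare (Δ : ℤ_[p]))] : ValuationSubring (Qp2 p Δ) where
  toSubring := Zp2 p Δ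
  mem_or_inv_mem' := fun a => by
    change a ∈ Zp2 p Δ ∨ a⁻¹ ∈ Zp2 p Δ
    rw [mem_Zp2_iff, mem_Zp2_iff, absK_inv]
    rcases le_total (absK a) 1 with h | h
    · exact Or.inl h
    · exact Or.inr (inv_le_one_of_one_le₀ h)

instance : IsFractionRing (Zp2 p Δ) (Qp2 p Δ) :=
  inferInstanceAs (IsFractionRing (valSubring p Δ) (Qp2 p Δ))

/-- The values are discrete, so a nonzero ideal has an element of largest absolute value, and this
element generates it. -/
instance : IsPrincipalIdealRing (Zp2 p Δ) := ⟨fun I => by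
  by_cases hI : I = ⊥
  · rw [hI]; exact bot_isPrincipal
  obtain ⟨b, hb, hb0⟩ := Submodule.exists_mem_ne_zero_of_ne_bot hI
  have hex : ∃ n : ℕ, ∃ a ∈ I, absK (a : Qp2 p Δ) = (p : ℝ) ^ (-(n : ℤ)) := by
    obtain ⟨n, hn⟩ := exists_absK_eq_zpow (a := (b : Qp2 p Δ)) (by simpa using hb0)
    have : n ≤ 0 := by
      have h1 : (p : ℝ) ^ n ≤ 1 := hn ▸ mem_Zp2_iff.1 b.2
      by_contra! h
      exact absurd h1 (not_le.2 (one_lt_zpow₀ one_lt_p h))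
    obtain ⟨m, rfl⟩ := Int.exists_eq_neg_ofNat this
    exact ⟨m, b, hb, hn⟩
  classical
  obtain ⟨a, ha, hav⟩ := Nat.find_spec hex
  have hmin := fun m (h : m < Nat.find hex) => Nat.find_min hex h
  have ha0 : (a : Qp2 p Δ) ≠ 0 := by
    intro h
    rw [h, absK_zero] at hav
    exact (zpow_pos p_pos _).ne hav
  refine ⟨a, le_antisymm (fun c hc => ?_) ?_⟩
  · rw [Ideal.submodule_span_eq, Ideal.mem_span_singleton']
    by_cases hc0 : c = 0
    · exact ⟨0, by rw [hc0, zero_mul]⟩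
    have hc0' : (c : Qp2 p Δ) ≠ 0 := by simpa using hc0
    have hle : absK (c : Qp2 p Δ) ≤ absK (a : Qp2 p Δ) := by
      obtain ⟨n, hn⟩ := exists_absK_eq_zpow hc0'
      have : n ≤ 0 := by
        have h1 : (p : ℝ) ^ n ≤ 1 := hn ▸ mem_Zp2_iff.1 c.2
        by_contra! h
        exact absurd h1 (not_le.2 (one_lt_zpow₀ one_lt_p h))
      obtain ⟨m, rfl⟩ := Int.exists_eq_neg_ofNat this
      rw [hav, hn]
      refine zpow_le_zpow_right₀ one_lt_p.le (neg_le_neg ?_)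
      by_contra! h
      exact hmin m (by exact_mod_cast h) ⟨c, hc, hn⟩
    refine ⟨⟨(c : Qp2 p Δ) / a, mem_Zp2_iff.2 ?_⟩, Subtype.ext ?_⟩
    · rw [absK_div]; exact div_le_one_of_le₀ hle (absK_nonneg _)
    · exact div_mul_cancel₀ _ ha0
  · rw [Ideal.submodule_span_eq, Ideal.span_singleton_le_iff_mem]; exact ha⟩

end Arithmetic

/-! ### Equivalence of norms and the distance of the building. -/

section Norms

variable {p : ℕ} [Fact p.Prime] {Δ : ℤ_[p]ˣ} {U : Type*} [AddCommGroup U] [Module (Qp2 p Δ) U]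

namespace UNorm

theorem map_zero (α : UNorm Δ U) : α 0 = 0 := (α.eq_zero_iff 0).2 rfl

theorem pos (α : UNorm Δ U) {x : U} (hx : x ≠ 0) : 0 < α x :=
  lt_of_le_of_ne (α.nonneg x) fun h => hx ((α.eq_zero_iff x).1 h.symm)

theorem map_neg (α : UNorm Δ U) (x : U) : α (-x) = α x := by
  have h := α.map_smul (-1) x
  rwa [neg_one_smul, absK_neg, absK_one, one_mul] at h

theorem map_sub_le (α : UNorm Δ U) (x y : U) : α (x - y) ≤ max (α x) (α y) := by
  rw [sub_eq_add_neg, ← α.map_neg y]; exact α.map_add_le _ _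

variable [Module ℚ_[p] U] [IsScalarTower ℚ_[p] (Qp2 p Δ) U]

theorem map_smul_padic (α : UNorm Δ U) (c : ℚ_[p]) (x : U) : α (c • x) = ‖c‖ * α x := by
  rw [algebra_compatible_smul (Qp2 p Δ) c x, α.map_smul, absK_algebraMap]

omit [Module ℚ_[p] U] [IsScalarTower ℚ_[p] (Qp2 p Δ) U] in
theorem map_sum_le (α : UNorm Δ U) {ι : Type*} (s : Finset ι) (f : ι → U) {C : ℝ} (hC : 0 ≤ C)
    (h : ∀ i ∈ s, α (f i) ≤ C) : α (∑ i ∈ s, f i) ≤ C := by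
  classical
  induction s using Finset.induction_on with
  | empty => simpa [α.map_zero] using hC
  | insert a s ha ih =>
    rw [Finset.sum_insert ha]
    exact (α.map_add_le _ _).trans (max_le (h a (Finset.mem_insert_self _ _))
      (ih fun i hi => h i (Finset.mem_insert_of_mem hi)))

/-- In coordinates over `ℚ_p` a norm is Lipschitz for the maximum norm, and it has a positive
minimum on the unit sphere, which is compact. Homogeneity extends the lower bound to all vectors. -/
theorem exists_bounds (α : UNorm Δ U) {n : ℕ} (b : Module.Basis (Fin n) ℚ_[p] U) :
    ∃ c C : ℝ, 0 < c ∧ 0 < C ∧ ∀ v : Fin n → ℚ_[p],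
      c * ‖v‖ ≤ α (∑ i, v i • b i) ∧ α (∑ i, v i • b i) ≤ C * ‖v‖ := by
  obtain ⟨C, hC0, hC⟩ : ∃ C : ℝ, 0 < C ∧ ∀ i, α (b i) ≤ C := by
    refine ⟨∑ i, α (b i) + 1, ?_, fun i => ?_⟩
    · have := Finset.sum_nonneg (s := Finset.univ) fun i _ => α.nonneg (b i)
      linarith
    · have := Finset.single_le_sum (s := Finset.univ) (f := fun i => α (b i))
        (fun i _ => α.nonneg (b i)) (Finset.mem_univ i)
      linarith
  set g : (Fin n → ℚ_[p]) → ℝ := fun v => α (∑ i, v i • b i) with hg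
  have hub : ∀ v, g v ≤ C * ‖v‖ := fun v => by
    refine α.map_sum_le _ _ (by positivity) fun i _ => ?_
    rw [α.map_smul_padic, mul_comm]
    exact mul_le_mul (hC i) (norm_le_pi_norm v i) (norm_nonneg _) hC0.le
  have hsub : ∀ v w, g v ≤ g w + C * ‖v - w‖ := fun v w => by
    have h1 : g v ≤ max (g (v - w)) (g w) := by
      have : ∑ i, v i • b i = ∑ i, (v - w) i • b i + ∑ i, w i • b i := by
        rw [← Finset.sum_add_distrib]
        exact Finset.sum_congr rfl fun i _ => by rw [← add_smul, Pi.sub_apply, sub_add_cancel]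
      simp only [hg]; rw [this]; exact α.map_add_le _ _
    refine h1.trans (max_le ((hub _).trans ?_) ?_)
    · have := α.nonneg (∑ i, w i • b i)
      simp only [hg]; linarith
    · have : 0 ≤ C * ‖v - w‖ := by positivity
      linarith
  have hcont : Continuous g := by
    refine (LipschitzWith.of_dist_le_mul (K := ⟨C, hC0.le⟩) fun v w => ?_).continuous
    rw [Real.dist_eq, dist_eq_norm, abs_le]
    have h1 := hsub v w
    have h2 := hsub w v
    rw [norm_sub_rev] at h2
    change -(C * ‖v - w‖) ≤ g v - g w ∧ g v - g w ≤ C * ‖v - w‖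
    constructor <;> linarith
  have hhom : ∀ (c : ℚ_[p]) v, g (c • v) = ‖c‖ * g v := fun c v => by
    simp only [hg, ← α.map_smul_padic, Finset.smul_sum, smul_smul, Pi.smul_apply, smul_eq_mul]
  have hpos : ∀ v, v ≠ 0 → 0 < g v := fun v hv => α.pos fun h => hv <| by
    have h1 := Fintype.linearIndependent_iff.1 b.linearIndependent v h
    exact funext h1
  obtain ⟨c, hc0, hc⟩ : ∃ c : ℝ, 0 < c ∧ ∀ v, ‖v‖ = 1 → c ≤ g v := by
    by_cases hne : (Metric.sphere (0 : Fin n → ℚ_[p]) 1).Nonempty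
    · obtain ⟨w, hw, hmin⟩ := (isCompact_sphere (0 : Fin n → ℚ_[p]) 1).exists_isMinOn hne
        hcont.continuousOn
      refine ⟨g w, hpos w ?_, fun v hv => hmin (by simpa using hv)⟩
      rintro rfl
      simp at hw
    · exact ⟨1, one_pos, fun v hv => absurd ⟨v, by simpa using hv⟩ hne⟩
  refine ⟨c, C, hc0, hC0, fun v => ⟨?_, hub v⟩⟩
  change c * ‖v‖ ≤ g v
  by_cases hv : v = 0
  · rw [hv, norm_zero, mul_zero]; exact α.nonneg _
  obtain ⟨i, hi⟩ : ∃ i, ‖v‖ = ‖v i‖ := by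
    have : Nonempty (Fin n) := by
      by_contra h
      rw [not_nonempty_iff] at h
      exact hv (Subsingleton.elim _ _)
    obtain ⟨i, hi⟩ := Finite.exists_max fun i => ‖v i‖
    exact ⟨i, le_antisymm ((pi_norm_le_iff_of_nonneg (norm_nonneg _)).2 hi) (norm_le_pi_norm v i)⟩
  have hvi : v i ≠ 0 := by
    rw [← norm_ne_zero_iff, ← hi, norm_ne_zero_iff]; exact hv
  have h1 := hc ((v i)⁻¹ • v) (by
    rw [norm_smul, norm_inv, hi, inv_mul_cancel₀ (norm_ne_zero_iff.2 hvi)])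
  rw [hhom, norm_inv, ← hi, inv_mul_eq_div, le_div_iff₀ (norm_pos_iff.2 hv)] at h1
  exact h1

theorem exists_le_mul [Module.Finite ℚ_[p] U] (α α' : UNorm Δ U) :
    ∃ C : ℝ, 0 < C ∧ ∀ x, α x ≤ C * α' x := by
  let b := Module.finBasis ℚ_[p] U
  obtain ⟨_, C, _, hC, h⟩ := α.exists_bounds b
  obtain ⟨c, _, hc, _, h'⟩ := α'.exists_bounds b
  refine ⟨C / c, by positivity, fun x => ?_⟩
  have h1 := (h (b.repr x)).2
  have h2 := (h' (b.repr x)).1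
  rw [b.sum_repr] at h1 h2
  refine h1.trans ?_
  rw [div_mul_eq_mul_div, le_div_iff₀ hc]
  calc _ = C * (c * ‖(b.repr x : Fin _ → ℚ_[p])‖) := by ring
    _ ≤ _ := by gcongr

/-- Equivalence of norms bounds the set whose supremum defines the distance; for an unbounded set
`sSup` would take its default value `0` and the estimate would be lost. -/
theorem mul_le_rpow_dist [Module.Finite ℚ_[p] U] (α α' : UNorm Δ U) (x y : U) :
    α x * α' y ≤ (p : ℝ) ^ (UNorm.dist α α') * (α' x * α y) := by
  by_cases hx : x = 0
  · simp [hx, map_zero]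
  by_cases hy : y = 0
  · simp [hy, map_zero]
  obtain ⟨C, hC, h⟩ := exists_le_mul α α'
  obtain ⟨C', hC', h'⟩ := exists_le_mul α' α
  have hp := p_pos (p := p)
  have hp1 := one_lt_p (p := p)
  have hbdd : BddAbove {r : ℝ | ∃ x y : U, x ≠ 0 ∧ y ≠ 0 ∧
      r = Real.logb p ((α x * α' y) / (α' x * α y))} := by
    refine ⟨Real.logb p (C * C'), ?_⟩
    rintro _ ⟨x, y, hx, hy, rfl⟩
    have h1 := α.pos hx
    have h2 := α.pos hy
    have h3 := α'.pos hx
    have h4 := α'.pos hy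
    refine Real.logb_le_logb_of_le hp1 (by positivity) ?_
    rw [div_le_iff₀ (by positivity)]
    calc α x * α' y ≤ (C * α' x) * (C' * α y) := by
          gcongr
          · exact h x
          · exact h' y
      _ = _ := by ring
  have h1 := α.pos hx
  have h2 := α.pos hy
  have h3 := α'.pos hx
  have h4 := α'.pos hy
  have := le_csSup hbdd ⟨x, y, hx, hy, rfl⟩
  rw [Real.logb_le_iff_le_rpow hp1 (by positivity), div_le_iff₀ (by positivity)] at this
  exact this

omit [Module ℚ_[p] U] [IsScalarTower ℚ_[p] (Qp2 p Δ) U] in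
theorem dist_le [Nontrivial U] {α α' : UNorm Δ U} {s : ℝ} (h : ∀ x, α x ≤ α' x)
    (h' : ∀ x, α' x ≤ (p : ℝ) ^ s * α x) : UNorm.dist α α' ≤ s := by
  obtain ⟨x, hx⟩ := exists_ne (0 : U)
  refine csSup_le ⟨_, x, x, hx, hx, rfl⟩ ?_
  rintro _ ⟨x, y, hx, hy, rfl⟩
  have h1 := α.pos hx
  have h2 := α.pos hy
  have h3 := α'.pos hx
  have h4 := α'.pos hy
  rw [Real.logb_le_iff_le_rpow one_lt_p (by positivity), div_le_iff₀ (by positivity)]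
  calc α x * α' y ≤ α' x * ((p : ℝ) ^ s * α y) := by
        gcongr
        · exact h x
        · exact h' y
    _ = _ := by ring

omit [Module ℚ_[p] U] [IsScalarTower ℚ_[p] (Qp2 p Δ) U] in
theorem dist_nonneg [Nontrivial U] (α α' : UNorm Δ U) : 0 ≤ UNorm.dist α α' := by
  obtain ⟨x, hx⟩ := exists_ne (0 : U)
  refine Real.sSup_nonneg' ⟨0, ⟨x, x, hx, hx, ?_⟩, le_rfl⟩
  have h1 := α.pos hx
  have h3 := α'.pos hx
  rw [mul_comm (α x), div_self (by positivity), Real.logb_one]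

end UNorm

theorem finite_padic [Fact (¬ IsSquare (Δ : ℤ_[p]))] [Module ℚ_[p] U] [IsScalarTower ℚ_[p] (Qp2 p Δ) U]
    (hU : Module.finrank (Qp2 p Δ) U = 2) : Module.Finite ℚ_[p] U := by
  have : Module.Finite (Qp2 p Δ) U := Module.finite_of_finrank_eq_succ hU
  exact Module.Finite.trans (Qp2 p Δ) U

end Norms

/-! ### Tubes around fixed point sets and stability of norms. -/

section Tube

variable {p : ℕ} [Fact p.Prime] {Δ : ℤ_[p]ˣ} {U : Type*} [AddCommGroup U]
  [Module (Qp2 p Δ) U] [Module ℚ_[p] U] [IsScalarTower ℚ_[p] (Qp2 p Δ) U]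
  {B : LinearMap.BilinForm (Qp2 p Δ) U}

theorem norm_le_one_of_stable [Nontrivial U] {β : SpecialEnd B} {q : ℚ_[p]}
    (hq : ∀ x, β.1 (β.1 x) = q • x) {α : UNorm Δ U} (h : ∀ x, α (β.1 x) ≤ α x) : ‖q‖ ≤ 1 := by
  obtain ⟨x, hx⟩ := exists_ne (0 : U)
  have h1 := (h (β.1 x)).trans (h x)
  rw [hq, α.map_smul_padic] at h1
  exact le_of_mul_le_mul_right (by simpa using h1) (α.pos hx)

/-- If `α` is a norm, then `max(α, c⁻¹ α ∘ β)` is a fixed norm, where `c² = |β²|`. -/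
def fixedNorm (β : SpecialEnd B) (α : UNorm Δ U) (c : ℝ) (hc : 0 < c) : UNorm Δ U where
  toFun x := max (α x) (c⁻¹ * α (β.1 x))
  nonneg x := le_max_of_le_left (α.nonneg x)
  eq_zero_iff x := by
    constructor
    · intro h
      refine (α.eq_zero_iff x).1 (le_antisymm ?_ (α.nonneg x))
      rw [← h]; exact le_max_left _ _
    · rintro rfl
      simp [UNorm.map_zero]
  map_smul a x := by
    rw [LinearMap.map_smulₛₗ, α.map_smul, α.map_smul, absK_star, mul_max_of_nonneg _ _ (absK_nonneg a)]
    congr 1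
    ring
  map_add_le x y := by
    have hc' : 0 ≤ c⁻¹ := (inv_pos.2 hc).le
    refine max_le ((α.map_add_le _ _).trans ?_) ?_
    · exact max_le_max (le_max_left _ _) (le_max_left _ _)
    · rw [map_add]
      refine (mul_le_mul_of_nonneg_left (α.map_add_le _ _) hc').trans ?_
      rw [mul_max_of_nonneg _ _ hc']
      exact max_le_max (le_max_right _ _) (le_max_right _ _)

theorem fixedNorm_apply {β : SpecialEnd B} {q : ℚ_[p]}
    (hq : ∀ x, β.1 (β.1 x) = q • x) (α : UNorm Δ U) (c : ℝ) (hc : 0 < c) (hcq : c ^ 2 = ‖q‖)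
    (x : U) : fixedNorm β α c hc (β.1 x) = c * fixedNorm β α c hc x := by
  change max (α (β.1 x)) (c⁻¹ * α (β.1 (β.1 x))) = c * max (α x) (c⁻¹ * α (β.1 x))
  rw [hq, α.map_smul_padic, ← hcq, mul_max_of_nonneg _ _ hc.le, max_comm]
  congr 1 <;> field_simp

/-- If `β` does not increase `α`, the fixed norm `max(α, c⁻¹ α∘β)` lies between `α` and `c⁻¹ α`,
hence at distance at most `½ ord Q''(β)`. Conversely a fixed norm is multiplied by exactly `c` under
`β`, and a norm at distance `½ ord Q''(β) + ε` from it is multiplied by at most `p^ε`. -/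
theorem mem_tube_iff' [Nontrivial U] [Module.Finite ℚ_[p] U] {β : SpecialEnd B}
    (hq : ∀ x, β.1 (β.1 x) = Qpp β • x) (hq0 : Qpp β ≠ 0) (α : UNorm Δ U) :
    (Quotient.mk (homothety Δ U) α : Building Δ U) ∈ tube β ↔ ∀ x, α (β.1 x) ≤ α x := by
  have hp := p_pos (p := p)
  have hp1 := one_lt_p (p := p)
  set r : ℝ := ((Qpp β).valuation : ℝ) with hr
  set c : ℝ := (p : ℝ) ^ (-(1 / 2 * r)) with hc
  have hc0 : 0 < c := Real.rpow_pos_of_pos hp _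
  have hcq : c ^ 2 = ‖Qpp β‖ := by
    rw [Padic.norm_eq_zpow_neg_valuation hq0, hc, ← Real.rpow_natCast, ← Real.rpow_mul hp.le,
      ← Real.rpow_intCast]
    congr 1
    push_cast
    ring
  have hfix : (Quotient.mk (homothety Δ U) (fixedNorm β α c hc0) : Building Δ U) ∈ fixedPoints β :=
    ⟨_, rfl, c, hc0, fixedNorm_apply hq α c hc0 hcq⟩
  have hbdd : BddBelow (Building.dist (Quotient.mk (homothety Δ U) α) '' fixedPoints β) := by
    refine ⟨0, ?_⟩
    rintro _ ⟨b, -, rfl⟩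
    induction b using Quotient.inductionOn with
    | h α' => exact UNorm.dist_nonneg α α'
  constructor
  · intro h x
    -- The infimum over the fixed points is not known to be attained, so stability is first obtained
    -- up to a factor `p^ε`.
    have key : ∀ ε : ℝ, 0 < ε → α (β.1 x) ≤ (p : ℝ) ^ ε * α x := fun ε hε => by
      have hlt : sInf (Building.dist (Quotient.mk (homothety Δ U) α) '' fixedPoints β) <
          1 / 2 * r + ε := lt_of_le_of_lt h (by linarith)
      obtain ⟨_, ⟨b, ⟨α', rfl, d, hd, hα'⟩, rfl⟩, hlt⟩ := exists_lt_of_csInf_lt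
        (Set.Nonempty.image _ ⟨_, hfix⟩) hlt
      change UNorm.dist α α' < _ at hlt
      by_cases hx : x = 0
      · simp [hx, UNorm.map_zero]
      have hx' := α'.pos hx
      -- Since `β² = Q''(β)`, the scaling factor of every fixed norm is the same `c`.
      have hdc : d = c := by
        have h1 := hα' (β.1 x)
        rw [hα' x, hq, α'.map_smul_padic, ← hcq] at h1
        have h2 : d ^ 2 = c ^ 2 := by
          have : c ^ 2 * α' x = d ^ 2 * α' x := by rw [h1]; ring
          exact (mul_right_cancel₀ hx'.ne' this).symm
        exact (pow_left_inj₀ hd.le hc0.le two_ne_zero).1 h2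
      have h1 := UNorm.mul_le_rpow_dist α α' (β.1 x) x
      rw [hα', hdc] at h1
      have h2 : α (β.1 x) ≤ (p : ℝ) ^ (UNorm.dist α α') * c * α x := by
        refine le_of_mul_le_mul_right (h1.trans_eq ?_) hx'
        ring
      refine h2.trans (mul_le_mul_of_nonneg_right ?_ (α.nonneg x))
      rw [hc, ← Real.rpow_add hp]
      exact Real.rpow_le_rpow_of_exponent_le hp1.le (by linarith)
    have hlim : Filter.Tendsto (fun ε : ℝ => (p : ℝ) ^ ε * α x) (nhdsWithin 0 (Set.Ioi 0))
        (nhds (α x)) := by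
      have : ContinuousAt (fun ε : ℝ => (p : ℝ) ^ ε * α x) 0 :=
        ((Real.continuous_const_rpow hp.ne').continuousAt).mul continuousAt_const
      have h1 := this.tendsto
      simp only [Real.rpow_zero, one_mul] at h1
      exact h1.mono_left nhdsWithin_le_nhds
    exact ge_of_tendsto hlim (Filter.eventually_of_mem self_mem_nhdsWithin fun ε hε => key ε hε)
  · intro h
    -- Stability forces `Q''(β)` to be integral, so the radius of the tube is nonnegative.
    have hr0 : 0 ≤ r := by
      have h1 := norm_le_one_of_stable hq h
      rw [Padic.norm_eq_zpow_neg_valuation hq0] at h1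
      have : -(Qpp β).valuation ≤ 0 := by
        by_contra! h2
        exact absurd h1 (not_le.2 (one_lt_zpow₀ hp1 h2))
      rw [hr]
      exact_mod_cast neg_nonpos.1 this
    refine (csInf_le hbdd ⟨_, hfix, rfl⟩).trans ?_
    refine UNorm.dist_le (fun x => le_max_left _ _) fun x => ?_
    have hcinv : c⁻¹ = (p : ℝ) ^ (1 / 2 * r) := by rw [hc, Real.rpow_neg hp.le, inv_inv]
    change max (α x) (c⁻¹ * α (β.1 x)) ≤ _
    rw [hcinv]
    have h1 : 1 ≤ (p : ℝ) ^ (1 / 2 * r) := Real.one_le_rpow hp1.le (by linarith)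
    refine max_le (le_mul_of_one_le_left (α.nonneg x) h1) ?_
    exact mul_le_mul_of_nonneg_left (h x) (by linarith)

end Tube

/-! ### Lattices, bases and vertices. -/

section BasisNorm

variable {p : ℕ} [Fact p.Prime] {Δ : ℤ_[p]ˣ} [Fact (p ≠ 2)] [Fact (¬ IsSquare (Δ : ℤ_[p]))]
  {U : Type*} [AddCommGroup U] [Module (Qp2 p Δ) U]

/-- The norm `x ↦ max(|x₀|, |x₁|)` in the coordinates of a basis. -/
def basisNorm (b : Module.Basis (Fin 2) (Qp2 p Δ) U) : UNorm Δ U where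
  toFun x := max (absK (b.repr x 0)) (absK (b.repr x 1))
  nonneg x := le_max_of_le_left (absK_nonneg _)
  eq_zero_iff x := by
    constructor
    · intro h
      have h0 : absK (b.repr x 0) = 0 :=
        le_antisymm (h ▸ le_max_left _ _) (absK_nonneg _)
      have h1 : absK (b.repr x 1) = 0 :=
        le_antisymm (h ▸ le_max_right _ _) (absK_nonneg _)
      rw [absK_eq_zero] at h0 h1
      rw [← b.forall_coord_eq_zero_iff]
      intro i
      fin_cases i
      · exact h0
      · exact h1
    · rintro rfl; simp
  map_smul a x := by
    simp [absK_mul, mul_max_of_nonneg _ _ (absK_nonneg a)]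
  map_add_le x y := by
    simp only [map_add, Finsupp.add_apply]
    refine max_le ((absK_add_le _ _).trans ?_) ((absK_add_le _ _).trans ?_)
    · exact max_le_max (le_max_left _ _) (le_max_left _ _)
    · exact max_le_max (le_max_right _ _) (le_max_right _ _)

theorem basisNorm_apply (b : Module.Basis (Fin 2) (Qp2 p Δ) U) (x : U) :
    basisNorm b x = max (absK (b.repr x 0)) (absK (b.repr x 1)) := rfl

theorem basisNorm_le_iff (b : Module.Basis (Fin 2) (Qp2 p Δ) U) (x : U) {C : ℝ} :
    basisNorm b x ≤ C ↔ ∀ i, absK (b.repr x i) ≤ C := by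
  rw [basisNorm_apply, max_le_iff, Fin.forall_fin_two]

theorem exists_absK_eq_basisNorm (b : Module.Basis (Fin 2) (Qp2 p Δ) U) (x : U) :
    ∃ a : Qp2 p Δ, absK a = basisNorm b x := by
  rcases max_choice (absK (b.repr x 0)) (absK (b.repr x 1)) with h | h
  · exact ⟨_, h.symm⟩
  · exact ⟨_, h.symm⟩

theorem basisNorm_eq_zpow (b : Module.Basis (Fin 2) (Qp2 p Δ) U) {x : U} (hx : x ≠ 0) :
    ∃ n : ℤ, basisNorm b x = (p : ℝ) ^ n := by
  obtain ⟨a, ha⟩ := exists_absK_eq_basisNorm b x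
  have ha0 : a ≠ 0 := by
    rintro rfl
    rw [absK_zero] at ha
    exact ((basisNorm b).pos hx).ne ha
  rw [← ha]
  exact exists_absK_eq_zpow ha0

/-- Each value of the maximum norm is the absolute value of a scalar `a`, and then `x ∈ aΛ`; so the
infimum in the definition of a lattice norm is attained. -/
theorem isNormOf_iff {Λ : Submodule (Zp2 p Δ) U} (b : Module.Basis (Fin 2) (Qp2 p Δ) U)
    (hb : ∀ x, x ∈ Λ ↔ basisNorm b x ≤ 1) (α : UNorm Δ U) :
    α.IsNormOf Λ ↔ α = basisNorm b := by
  have key : ∀ x, sInf {r : ℝ | ∃ (a : Qp2 p Δ) (y : U), y ∈ Λ ∧ x = a • y ∧ r = absK a} =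
      basisNorm b x := fun x => by
    refine IsLeast.csInf_eq ⟨?_, ?_⟩
    · by_cases hx : x = 0
      · exact ⟨0, 0, Λ.zero_mem, by simp [hx], by simp [hx, UNorm.map_zero]⟩
      obtain ⟨a, ha⟩ := exists_absK_eq_basisNorm b x
      have h0 := (basisNorm b).pos hx
      have ha0 : a ≠ 0 := by
        rintro rfl
        rw [absK_zero] at ha
        exact h0.ne ha
      refine ⟨a, a⁻¹ • x, ?_, by rw [smul_inv_smul₀ ha0], ha.symm⟩
      rw [hb, UNorm.map_smul, absK_inv, ha, inv_mul_cancel₀ h0.ne']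
    · rintro _ ⟨a, y, hy, rfl, rfl⟩
      rw [UNorm.map_smul]
      exact mul_le_of_le_one_right (absK_nonneg a) ((hb y).1 hy)
  constructor
  · intro h
    have : α.toFun = (basisNorm b).toFun := funext fun x => (h x).trans (key x)
    cases α
    cases hβ : basisNorm b
    rw [hβ] at this
    simp only at this
    subst this
    rfl
  · rintro rfl x
    exact (key x).symm

/-- Over a principal ideal domain a lattice is free, and its basis extends to a basis of `U`. -/
theorem exists_basis_of_isLattice (hU : Module.finrank (Qp2 p Δ) U = 2)
    {Λ : Submodule (Zp2 p Δ) U} (hΛ : Λ.IsLattice (Qp2 p Δ)) :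
    ∃ b : Module.Basis (Fin 2) (Qp2 p Δ) U, ∀ x, x ∈ Λ ↔ basisNorm b x ≤ 1 := by
  have htf : Module.IsTorsionFree (Zp2 p Δ) (Qp2 p Δ) := ⟨fun r hr x y h => by
    refine mul_left_cancel₀ (a := (r : Qp2 p Δ)) ?_ h
    rw [Ne, ZeroMemClass.coe_eq_zero]
    exact hr.ne_zero⟩
  have hfree : Module.Free (Zp2 p Δ) Λ := Submodule.IsLattice.free (Qp2 p Δ) Λ
  let c := Module.Free.chooseBasis (Zp2 p Δ) Λ
  let d := c.extendOfIsLattice (Qp2 p Δ)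
  have hcard : Fintype.card (Module.Free.ChooseBasisIndex (Zp2 p Δ) Λ) = 2 := by
    rw [← hU, Module.finrank_eq_card_basis d]
  let e := Fintype.equivFinOfCardEq hcard
  refine ⟨d.reindex e, fun x => ?_⟩
  rw [basisNorm_le_iff]
  have hd : ∀ i, d i = (c i : U) := fun i => Module.Basis.extendOfIsLattice_apply _ _ _
  constructor
  · intro hx i
    have h1 : x = ∑ j, ((c.repr ⟨x, hx⟩ j : Zp2 p Δ) : Qp2 p Δ) • d j := by
      have h2 := congrArg Subtype.val (c.sum_repr ⟨x, hx⟩)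
      rw [AddSubmonoidClass.coe_finsetSum] at h2
      refine h2.symm.trans (Finset.sum_congr rfl fun j _ => ?_)
      rw [hd]; rfl
    have h3 : (d.reindex e).repr x i = ((c.repr ⟨x, hx⟩ (e.symm i) : Zp2 p Δ) : Qp2 p Δ) := by
      rw [Module.Basis.repr_reindex_apply]
      conv_lhs => rw [h1]
      rw [d.repr_sum_self]
    rw [h3, ← mem_Zp2_iff]
    exact Subtype.property _
  · intro h
    have h1 : x = ∑ i, (d.repr x i) • d i := (d.sum_repr x).symm
    rw [h1]
    refine Λ.sum_mem fun i _ => ?_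
    have h2 : d.repr x i ∈ Zp2 p Δ := by
      rw [mem_Zp2_iff]
      have := h (e i)
      rwa [Module.Basis.repr_reindex_apply, Equiv.symm_apply_apply] at this
    rw [hd]
    exact Λ.smul_mem (⟨_, h2⟩ : Zp2 p Δ) (c i).2

/-- The lattice spanned by a basis. -/
def basisLattice (b : Module.Basis (Fin 2) (Qp2 p Δ) U) : Submodule (Zp2 p Δ) U :=
  Submodule.span (Zp2 p Δ) (Set.range b)

omit [Fact (p ≠ 2)] in
theorem basisLattice_isLattice (b : Module.Basis (Fin 2) (Qp2 p Δ) U) :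
    (basisLattice b).IsLattice (Qp2 p Δ) where
  fg := Submodule.fg_span (Set.finite_range b)
  span_eq_top := by
    rw [eq_top_iff, ← b.span_eq]
    exact Submodule.span_mono Submodule.subset_span

theorem mem_basisLattice (b : Module.Basis (Fin 2) (Qp2 p Δ) U) (x : U) :
    x ∈ basisLattice b ↔ basisNorm b x ≤ 1 := by
  rw [basisNorm_le_iff]
  constructor
  · intro h i
    induction h using Submodule.span_induction with
    | mem x hx =>
      obtain ⟨j, rfl⟩ := hx
      rw [b.repr_self, Finsupp.single_apply]
      split_ifs <;> simp
    | zero => simp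
    | add x y _ _ hx hy =>
      rw [map_add, Finsupp.add_apply]
      exact (absK_add_le _ _).trans (max_le hx hy)
    | smul a x _ hx =>
      have : a • x = (a : Qp2 p Δ) • x := rfl
      rw [this, map_smul, Finsupp.smul_apply, smul_eq_mul, absK_mul]
      exact mul_le_one₀ (mem_Zp2_iff.1 a.2) (absK_nonneg _) hx
  · intro h
    rw [← b.sum_repr x]
    refine Submodule.sum_mem _ fun i _ => ?_
    exact Submodule.smul_mem _ (⟨_, mem_Zp2_iff.2 (h i)⟩ : Zp2 p Δ)
      (Submodule.subset_span (Set.mem_range_self i))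

theorem isVertex_iff (hU : Module.finrank (Qp2 p Δ) U = 2) (v : Building Δ U) :
    v.IsVertex ↔ ∃ b : Module.Basis (Fin 2) (Qp2 p Δ) U,
      Quotient.mk (homothety Δ U) (basisNorm b) = v := by
  constructor
  · rintro ⟨Λ, α, hΛ, hα, rfl⟩
    obtain ⟨b, hb⟩ := exists_basis_of_isLattice hU hΛ
    exact ⟨b, by rw [(isNormOf_iff b hb α).1 hα]⟩
  · rintro ⟨b, rfl⟩
    exact ⟨basisLattice b, basisNorm b, basisLattice_isLattice b,
      (isNormOf_iff b (mem_basisLattice b) _).2 rfl, rfl⟩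

end BasisNorm

/-! ### The bilinear form attached to `Q''`. -/

section SpecialForm

variable {p : ℕ} [Fact p.Prime] {Δ : ℤ_[p]ˣ} {U : Type*} [AddCommGroup U]
  [Module (Qp2 p Δ) U] [Module ℚ_[p] U] [IsScalarTower ℚ_[p] (Qp2 p Δ) U]
  {B : LinearMap.BilinForm (Qp2 p Δ) U}

/-- `β² = Q''(β)` for all special endomorphisms `β`. -/
def SqSpec (B : LinearMap.BilinForm (Qp2 p Δ) U) : Prop :=
  ∀ (β : SpecialEnd B) (x : U), β.1 (β.1 x) = Qpp β • x

theorem sqSpec (hΔ : ¬ IsSquare (Δ : ℤ_[p]))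
    (hU : Module.finrank (Qp2 p Δ) U = 2) (hB : B.IsAlt) (hnd : B.Nondegenerate) : SqSpec B := by
  intro β x
  have h := exists_sq_eq hΔ hU hB hnd β
  rw [Qpp, dif_pos h]
  exact h.choose_spec x

variable [Nontrivial U]

theorem smul_padic_injective {q q' : ℚ_[p]} (h : ∀ x : U, q • x = q' • x) : q = q' := by
  obtain ⟨x, hx⟩ := exists_ne (0 : U)
  exact smul_left_injective _ hx (h x)

theorem SqSpec.Qpp_eq (hsq : SqSpec B) {β : SpecialEnd B} {q : ℚ_[p]}
    (h : ∀ x, β.1 (β.1 x) = q • x) : Qpp β = q :=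
  smul_padic_injective fun x => by rw [← hsq, h]

omit [Nontrivial U] in
theorem map_smul_padic (β : SpecialEnd B) (c : ℚ_[p]) (x : U) : β.1 (c • x) = c • β.1 x := by
  rw [algebra_compatible_smul (Qp2 p Δ) c x, LinearMap.map_smulₛₗ,
    algebra_compatible_smul (Qp2 p Δ) c (β.1 x)]
  congr 1
  rw [starRingEnd_apply, QuadraticAlgebra.algebraMap_eq, QuadraticAlgebra.star_mk]
  simp

omit [Nontrivial U] in
theorem coe_add_apply (β γ : SpecialEnd B) (x : U) : (β + γ).1 x = β.1 x + γ.1 x := rfl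

omit [Nontrivial U] in
theorem coe_smul_apply (c : ℚ_[p]) (β : SpecialEnd B) (x : U) : (c • β).1 x = c • β.1 x := rfl

omit [Nontrivial U] in
theorem coe_sum_apply {ι : Type*} (s : Finset ι) (β : ι → SpecialEnd B) (x : U) :
    (∑ i ∈ s, β i).1 x = ∑ i ∈ s, (β i).1 x := by
  rw [AddSubmonoidClass.coe_finsetSum, LinearMap.sum_apply]

omit [Nontrivial U] in
theorem ext_apply {β γ : SpecialEnd B} (h : ∀ x, β.1 x = γ.1 x) : β = γ :=
  Subtype.ext (LinearMap.ext h)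

omit [Nontrivial U] in
theorem SqSpec.polar (hsq : SqSpec B) (β γ : SpecialEnd B) (x : U) :
    β.1 (γ.1 x) + γ.1 (β.1 x) = (Qpp (β + γ) - Qpp β - Qpp γ) • x := by
  have h := hsq (β + γ) x
  simp only [coe_add_apply, map_add] at h
  rw [sub_smul, sub_smul, ← h, hsq, hsq]
  abel

/-- The bilinear form of `Q''`. -/
def specialBil (hsq : SqSpec B) : LinearMap.BilinForm ℚ_[p] (SpecialEnd B) :=
  LinearMap.mk₂ ℚ_[p] (fun β γ => (Qpp (β + γ) - Qpp β - Qpp γ) / 2)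
    (fun β β' γ => by
      rw [← add_div]
      congr 1
      refine smul_padic_injective (U := U) fun x => ?_
      rw [add_smul, ← hsq.polar, ← hsq.polar, ← hsq.polar]
      simp only [coe_add_apply, map_add]
      abel)
    (fun c β γ => by
      rw [smul_eq_mul, ← mul_div_assoc]
      congr 1
      refine smul_padic_injective (U := U) fun x => ?_
      rw [mul_smul, ← hsq.polar, ← hsq.polar]
      simp only [coe_smul_apply, map_smul_padic, smul_add])
    (fun β γ γ' => by
      rw [← add_div]
      congr 1
      refine smul_padic_injective (U := U) fun x => ?_
      rw [add_smul, ← hsq.polar, ← hsq.polar, ← hsq.polar]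
      simp only [coe_add_apply, map_add]
      abel)
    (fun c β γ => by
      rw [smul_eq_mul, ← mul_div_assoc]
      congr 1
      refine smul_padic_injective (U := U) fun x => ?_
      rw [mul_smul, ← hsq.polar, ← hsq.polar]
      simp only [coe_smul_apply, map_smul_padic, smul_add])

theorem specialBil_apply (hsq : SqSpec B) (β γ : SpecialEnd B) :
    specialBil hsq β γ = (Qpp (β + γ) - Qpp β - Qpp γ) / 2 := rfl

/-- Polarization of `β² = Q''(β)`. In particular orthogonal special endomorphisms anticommute, which
drives the explicit count for diagonal triples. -/
theorem anticomm (hsq : SqSpec B) (β γ : SpecialEnd B) (x : U) :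
    β.1 (γ.1 x) + γ.1 (β.1 x) = (2 * specialBil hsq β γ) • x := by
  rw [hsq.polar, specialBil_apply, mul_div_cancel₀ _ (two_ne_zero' ℚ_[p])]

theorem specialBil_self (hsq : SqSpec B) (β : SpecialEnd B) : specialBil hsq β β = Qpp β := by
  have h : (2 : ℚ_[p]) * specialBil hsq β β = 2 * Qpp β :=
    smul_padic_injective (U := U) fun x => by
      rw [← anticomm, hsq, two_mul, add_smul]
  exact mul_left_cancel₀ (two_ne_zero' ℚ_[p]) h

theorem gram_apply (hsq : SqSpec B) {ι : Type*} (β : ι → SpecialEnd B) (i j : ι) :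
    gram β i j = specialBil hsq (β i) (β j) := rfl

end SpecialForm

/-! ### Endomorphisms that do not increase a norm. -/

section Stable

variable {p : ℕ} [Fact p.Prime] {Δ : ℤ_[p]ˣ} {U : Type*} [AddCommGroup U]
  [Module (Qp2 p Δ) U] [Module ℚ_[p] U] [IsScalarTower ℚ_[p] (Qp2 p Δ) U]
  {B : LinearMap.BilinForm (Qp2 p Δ) U}

/-- `β` maps the unit ball of `α` (and hence every ball) into itself. -/
def Stable (α : UNorm Δ U) (β : SpecialEnd B) : Prop := ∀ x, α (β.1 x) ≤ α x

theorem Stable.add {α : UNorm Δ U} {β γ : SpecialEnd B} (hβ : Stable α β) (hγ : Stable α γ) :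
    Stable α (β + γ) := fun x =>
  (α.map_add_le _ _).trans (max_le (hβ x) (hγ x))

theorem Stable.smul {α : UNorm Δ U} {β : SpecialEnd B} (hβ : Stable α β) {c : ℚ_[p]}
    (hc : ‖c‖ ≤ 1) : Stable α (c • β) := fun x => by
  rw [coe_smul_apply, α.map_smul_padic]
  exact (mul_le_of_le_one_left (α.nonneg _) hc).trans (hβ x)

theorem Stable.zero {α : UNorm Δ U} : Stable α (0 : SpecialEnd B) := fun x => by
  change α 0 ≤ α x
  rw [α.map_zero]; exact α.nonneg x

theorem Stable.sum {α : UNorm Δ U} {ι : Type*} (s : Finset ι) {β : ι → SpecialEnd B}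
    (h : ∀ i ∈ s, Stable α (β i)) : Stable α (∑ i ∈ s, β i) := fun x => by
  rw [coe_sum_apply]
  exact α.map_sum_le _ _ (α.nonneg x) fun i hi => h i hi x

theorem stable_congr {α α' : UNorm Δ U} (h : homothety Δ U α α') (β : SpecialEnd B) :
    Stable α β ↔ Stable α' β := by
  obtain ⟨c, hc, h⟩ := h
  refine forall_congr' fun x => ?_
  rw [h, h, mul_le_mul_iff_right₀ hc]

/-- `β` stabilizes the points of the class `b`. -/
def Building.Stable (b : Building Δ U) (β : SpecialEnd B) : Prop :=
  Quotient.lift (fun α => SpecialTree.Stable α β)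
    (fun _ _ h => propext (stable_congr h β)) b

/-- The scalar `βγ + γβ` does not increase the norm, and `2` is a unit: on the stabilizer of a norm
the bilinear form is integral. -/
theorem Stable.norm_le_one [Nontrivial U] (hsq : SqSpec B) {α : UNorm Δ U} {β γ : SpecialEnd B}
    [Fact (p ≠ 2)] (hβ : Stable α β) (hγ : Stable α γ) : ‖specialBil hsq β γ‖ ≤ 1 := by
  obtain ⟨x, hx⟩ := exists_ne (0 : U)
  have h1 : α ((2 * specialBil hsq β γ) • x) ≤ α x := by
    rw [← anticomm]
    exact (α.map_add_le _ _).trans (max_le ((hβ _).trans (hγ _)) ((hγ _).trans (hβ _)))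
  rw [α.map_smul_padic, norm_mul] at h1
  have h2 : ‖(2 : ℚ_[p])‖ = 1 := norm_two_eq_one
  rw [h2, one_mul] at h1
  exact le_of_mul_le_mul_right (by simpa using h1) (α.pos hx)

end Stable

/-! ### Matrices of special endomorphisms. -/

section Model

/-- The Gram matrix of the form `x² - d y² + 2 b c`. -/
def modelMatrix {R : Type*} [CommRing R] (d : R) : Matrix (Fin 4) (Fin 4) R :=
  !![1, 0, 0, 0; 0, -d, 0, 0; 0, 0, 0, 1; 0, 0, 1, 0]

variable {p : ℕ} [Fact p.Prime] {Δ : ℤ_[p]ˣ} {U : Type*} [AddCommGroup U]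
  [Module (Qp2 p Δ) U]

/-- The `σ`-linear map with the matrix `!![a, b; c, d]` in a given basis. -/
def semilinearOfMatrix (u : Module.Basis (Fin 2) (Qp2 p Δ) U) (a b c d : Qp2 p Δ) :
    U →ₛₗ[starRingEnd (Qp2 p Δ)] U where
  toFun x := (a * starRingEnd _ (u.repr x 0) + b * starRingEnd _ (u.repr x 1)) • u 0 +
    (c * starRingEnd _ (u.repr x 0) + d * starRingEnd _ (u.repr x 1)) • u 1
  map_add' x y := by
    simp only [map_add, Finsupp.add_apply, mul_add, add_smul]
    abel
  map_smul' r x := by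
    simp only [map_smul, Finsupp.smul_apply, smul_eq_mul, map_mul, smul_add, smul_smul]
    congr 2 <;> ring

theorem bil_eq (u : Module.Basis (Fin 2) (Qp2 p Δ) U) {B : LinearMap.BilinForm (Qp2 p Δ) U}
    (hB : B.IsAlt) (x y : U) :
    B x y = (u.repr x 0 * u.repr y 1 - u.repr x 1 * u.repr y 0) * B (u 0) (u 1) := by
  have h10 : B (u 1) (u 0) = - B (u 0) (u 1) := (LinearMap.IsAlt.neg hB _ _).symm
  conv_lhs => rw [← u.sum_repr x, ← u.sum_repr y]
  simp only [Fin.sum_univ_two, map_add, LinearMap.add_apply, map_smul, LinearMap.smul_apply,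
    smul_eq_mul, hB (u 0), hB (u 1), h10]
  ring

variable [Module ℚ_[p] U] [IsScalarTower ℚ_[p] (Qp2 p Δ) U]
  {B : LinearMap.BilinForm (Qp2 p Δ) U}

theorem star_coe (r : ℚ_[p]) : starRingEnd (Qp2 p Δ) ⟨r, 0⟩ = ⟨r, 0⟩ := by
  rw [starRingEnd_apply, QuadraticAlgebra.star_mk]; simp

theorem star_mk' (r s : ℚ_[p]) : starRingEnd (Qp2 p Δ) ⟨r, s⟩ = ⟨r, -s⟩ := by
  rw [starRingEnd_apply, QuadraticAlgebra.star_mk]; simp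

omit [Module ℚ_[p] U] [IsScalarTower ℚ_[p] (Qp2 p Δ) U] in
theorem repr_semilinearOfMatrix (u : Module.Basis (Fin 2) (Qp2 p Δ) U) (a b c d : Qp2 p Δ) (x : U) :
    u.repr (semilinearOfMatrix u a b c d x) 0 =
      a * starRingEnd _ (u.repr x 0) + b * starRingEnd _ (u.repr x 1) ∧
    u.repr (semilinearOfMatrix u a b c d x) 1 =
      c * starRingEnd _ (u.repr x 0) + d * starRingEnd _ (u.repr x 1) := by
  have : semilinearOfMatrix u a b c d x =
    (a * starRingEnd _ (u.repr x 0) + b * starRingEnd _ (u.repr x 1)) • u 0 +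
    (c * starRingEnd _ (u.repr x 0) + d * starRingEnd _ (u.repr x 1)) • u 1 := rfl
  rw [this]
  constructor <;> simp

/-- The special endomorphism with the matrix `!![x + yδ, bδ; -2cδ/Δ, x - yδ]`, for a basis with
`⟨u₀, u₁⟩ ∈ ℚ_p`. -/
def modelEnd (u : Module.Basis (Fin 2) (Qp2 p Δ) U) (hB : B.IsAlt)
    {r : ℚ_[p]} (hr : B (u 0) (u 1) = ⟨r, 0⟩) (v : Fin 4 → ℚ_[p]) : SpecialEnd B :=
  -- The factor `-2/Δ` makes the off-diagonal entries contribute exactly `2bc` to `β²`; being a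
  -- unit, it does not affect integrality.
  ⟨semilinearOfMatrix u ⟨v 0, v 1⟩ ⟨0, v 2⟩ ⟨0, -2 / ((Δ : ℤ_[p]) : ℚ_[p]) * v 3⟩ ⟨v 0, -v 1⟩, by
    intro x y
    rw [bil_eq u hB, bil_eq u hB x, (repr_semilinearOfMatrix u _ _ _ _ x).1,
      (repr_semilinearOfMatrix u _ _ _ _ x).2, (repr_semilinearOfMatrix u _ _ _ _ y).1,
      (repr_semilinearOfMatrix u _ _ _ _ y).2, hr]
    obtain ⟨x0, x0'⟩ := u.repr x 0
    obtain ⟨x1, x1'⟩ := u.repr x 1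
    obtain ⟨y0, y0'⟩ := u.repr y 0
    obtain ⟨y1, y1'⟩ := u.repr y 1
    simp only [map_mul, map_sub, map_add, star_mk']
    ext <;> simp [-mul_eq_mul_right_iff] <;> ring⟩

end Model

/-! ### Integral coordinates on the space of special endomorphisms. -/

section ModelBasis

variable {p : ℕ} [Fact p.Prime] {Δ : ℤ_[p]ˣ} [Fact (p ≠ 2)] [Fact (¬ IsSquare (Δ : ℤ_[p]))]
  {U : Type*} [AddCommGroup U] [Module (Qp2 p Δ) U]

theorem coe_unit_ne_zero (Δ : ℤ_[p]ˣ) : ((Δ : ℤ_[p]) : ℚ_[p]) ≠ 0 := by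
  rw [← norm_ne_zero_iff, norm_unit_coe]; exact one_ne_zero

/-- A basis can be rescaled by units so that `⟨u₀, u₁⟩ ∈ ℚ_p`. -/
theorem exists_basis_bil_eq {B : LinearMap.BilinForm (Qp2 p Δ) U} (hB : B.IsAlt)
    (hnd : B.Nondegenerate) (u : Module.Basis (Fin 2) (Qp2 p Δ) U) :
    ∃ (w : Module.Basis (Fin 2) (Qp2 p Δ) U) (r : ℚ_[p]), r ≠ 0 ∧
      basisNorm w = basisNorm u ∧ B (w 0) (w 1) = ⟨r, 0⟩ := by
  set ω := B (u 0) (u 1) with hω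
  have hω0 : ω ≠ 0 := by
    intro h0
    have : u 0 = 0 := hnd.1 (u 0) fun y => by
      rw [bil_eq u hB, ← hω, h0, mul_zero]
    exact u.ne_zero 0 this
  obtain ⟨n, hn⟩ := exists_absK_eq_zpow hω0
  -- As the extension is unramified, a power `r` of `p` has the absolute value of `ω`, and `t = r/ω`
  -- is a unit.
  set r : ℚ_[p] := (p : ℚ_[p]) ^ (-n) with hr
  have hrn : ‖r‖ = (p : ℝ) ^ n := by
    rw [hr, norm_zpow, Padic.norm_p, inv_zpow, zpow_neg, inv_inv]
  have hr0 : r ≠ 0 := by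
    rw [← norm_ne_zero_iff, hrn]; exact (zpow_pos p_pos _).ne'
  set t : Qp2 p Δ := algebraMap ℚ_[p] _ r * ω⁻¹ with ht
  have ht1 : absK t = 1 := by
    rw [ht, absK_mul, absK_algebraMap, absK_inv, hn, hrn, mul_inv_cancel₀ (zpow_pos p_pos _).ne']
  have ht0 : t ≠ 0 := by
    rintro h; rw [h, absK_zero] at ht1; exact zero_ne_one ht1
  let ts : Fin 2 → (Qp2 p Δ)ˣ := ![Units.mk0 t ht0, 1]
  refine ⟨u.unitsSMul ts, r, hr0, ?_, ?_⟩
  · have : ∀ x, (basisNorm (u.unitsSMul ts)).toFun x = (basisNorm u).toFun x := fun x => by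
      change max _ _ = max _ _
      rw [Module.Basis.repr_unitsSMul, Module.Basis.repr_unitsSMul]
      simp only [ts, Matrix.cons_val_zero, Matrix.cons_val_one, inv_one, one_smul]
      rw [Units.smul_def, Units.val_inv_eq_inv_val, Units.val_mk0, smul_eq_mul, absK_mul, absK_inv,
        ht1, inv_one, one_mul]
    have h2 : (basisNorm (u.unitsSMul ts)).toFun = (basisNorm u).toFun := funext this
    cases h3 : basisNorm (u.unitsSMul ts)
    cases h4 : basisNorm u
    rw [h3, h4] at h2
    simp only at h2
    subst h2
    rfl
  · rw [Module.Basis.unitsSMul_apply, Module.Basis.unitsSMul_apply]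
    simp only [ts, Matrix.cons_val_zero, Matrix.cons_val_one, one_smul]
    rw [Units.smul_def, Units.val_mk0, map_smul, LinearMap.smul_apply, ← hω, smul_eq_mul, ht,
      inv_mul_cancel_right₀ hω0]
    rfl

variable [Module ℚ_[p] U] [IsScalarTower ℚ_[p] (Qp2 p Δ) U]
  {B : LinearMap.BilinForm (Qp2 p Δ) U}

theorem repr_smul_padic (u : Module.Basis (Fin 2) (Qp2 p Δ) U) (c : ℚ_[p]) (x : U) (i : Fin 2) :
    u.repr (c • x) i = c • u.repr x i := by
  rw [algebra_compatible_smul (Qp2 p Δ) c x, map_smul, Finsupp.smul_apply,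
    ← algebra_compatible_smul]

theorem ext_repr (u : Module.Basis (Fin 2) (Qp2 p Δ) U) {x y : U} (h0 : u.repr x 0 = u.repr y 0)
    (h1 : u.repr x 1 = u.repr y 1) : x = y := by
  refine u.ext_elem fun i => ?_
  fin_cases i
  · exact h0
  · exact h1

theorem repr_modelEnd (u : Module.Basis (Fin 2) (Qp2 p Δ) U) (hB : B.IsAlt)
    {r : ℚ_[p]} (hr : B (u 0) (u 1) = ⟨r, 0⟩) (v : Fin 4 → ℚ_[p]) (x : U) :
    u.repr ((modelEnd u hB hr v).1 x) 0 =
      ⟨v 0, v 1⟩ * starRingEnd _ (u.repr x 0) + ⟨0, v 2⟩ * starRingEnd _ (u.repr x 1) ∧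
    u.repr ((modelEnd u hB hr v).1 x) 1 =
      ⟨0, -2 / ((Δ : ℤ_[p]) : ℚ_[p]) * v 3⟩ * starRingEnd _ (u.repr x 0) +
        ⟨v 0, -v 1⟩ * starRingEnd _ (u.repr x 1) :=
  repr_semilinearOfMatrix u _ _ _ _ x

theorem modelEnd_sq (u : Module.Basis (Fin 2) (Qp2 p Δ) U) (hB : B.IsAlt)
    {r : ℚ_[p]} (hr : B (u 0) (u 1) = ⟨r, 0⟩) (v : Fin 4 → ℚ_[p]) (x : U) :
    (modelEnd u hB hr v).1 ((modelEnd u hB hr v).1 x) =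
      (v 0 ^ 2 - ((Δ : ℤ_[p]) : ℚ_[p]) * v 1 ^ 2 + 2 * v 2 * v 3) • x := by
  have hΔ := coe_unit_ne_zero Δ
  refine ext_repr u ?_ ?_
  · rw [(repr_modelEnd u hB hr v _).1, (repr_modelEnd u hB hr v x).1,
      (repr_modelEnd u hB hr v x).2, repr_smul_padic]
    obtain ⟨x0, x0'⟩ := u.repr x 0
    obtain ⟨x1, x1'⟩ := u.repr x 1
    simp only [map_mul, map_add, star_mk']
    ext <;> simp [-mul_eq_mul_right_iff] <;> field_simp <;> ring
  · rw [(repr_modelEnd u hB hr v _).2, (repr_modelEnd u hB hr v x).1,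
      (repr_modelEnd u hB hr v x).2, repr_smul_padic]
    obtain ⟨x0, x0'⟩ := u.repr x 0
    obtain ⟨x1, x1'⟩ := u.repr x 1
    simp only [map_mul, map_add, star_mk']
    ext <;> simp [-mul_eq_mul_right_iff] <;> field_simp <;> ring

theorem two_coe_ne_zero : (2 : ℚ_[p]) ≠ 0 := two_ne_zero' _

theorem im_eq_of_star_eq_neg {a : Qp2 p Δ} (h : starRingEnd _ a = -a) : a = ⟨0, a.im⟩ := by
  have h1 := congrArg QuadraticAlgebra.re h
  rw [starRingEnd_apply, QuadraticAlgebra.re_star, QuadraticAlgebra.re_neg] at h1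
  have : a.re = 0 := by linear_combination (1 / 2 : ℚ_[p]) * h1
  exact QuadraticAlgebra.ext this rfl

theorem modelEnd_eq_zero (u : Module.Basis (Fin 2) (Qp2 p Δ) U) (hB : B.IsAlt)
    {r : ℚ_[p]} (hr : B (u 0) (u 1) = ⟨r, 0⟩) {v : Fin 4 → ℚ_[p]} (hv : modelEnd u hB hr v = 0) :
    v = 0 := by
  have hΔ := coe_unit_ne_zero Δ
  have h0 : ∀ x, (modelEnd u hB hr v).1 x = 0 := fun x => by
    rw [hv]; rfl
  have h1 := (repr_modelEnd u hB hr v (u 0)).1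
  have h2 := (repr_modelEnd u hB hr v (u 0)).2
  have h3 := (repr_modelEnd u hB hr v (u 1)).1
  simp only [h0, map_zero, Finsupp.zero_apply, u.repr_self, Finsupp.single_apply, if_true,
    Fin.isValue, zero_ne_one, one_ne_zero, if_false, map_one, mul_one, mul_zero, add_zero,
    zero_add] at h1 h2 h3
  have e0 := congrArg QuadraticAlgebra.re h1
  have e1 := congrArg QuadraticAlgebra.im h1
  have e2 := congrArg QuadraticAlgebra.im h3
  have e3 := congrArg QuadraticAlgebra.im h2
  simp only [QuadraticAlgebra.re_zero, QuadraticAlgebra.im_zero] at e0 e1 e2 e3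
  have e3' : v 3 = 0 := by
    have := mul_eq_zero.1 e3.symm
    refine this.resolve_left ?_
    exact div_ne_zero (neg_ne_zero.2 two_coe_ne_zero) hΔ
  funext i
  fin_cases i
  · exact e0.symm
  · exact e1.symm
  · exact e2.symm
  · exact e3'

-- Self-adjointness is tested on basis vectors: the pairs `(u₀,u₀)` and `(u₁,u₁)` make the
-- off-diagonal entries purely imaginary, and `(u₀,u₁)` makes the diagonal entries conjugate.
set_option maxHeartbeats 1000000 in
theorem modelEnd_surjective (u : Module.Basis (Fin 2) (Qp2 p Δ) U) (hB : B.IsAlt)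
    {r : ℚ_[p]} (hr0 : r ≠ 0) (hr : B (u 0) (u 1) = ⟨r, 0⟩) :
    Function.Surjective (modelEnd u hB hr) := by
  have hΔ := coe_unit_ne_zero Δ
  intro β
  set a := u.repr (β.1 (u 0)) 0 with ha
  set c := u.repr (β.1 (u 0)) 1 with hc
  set b := u.repr (β.1 (u 1)) 0 with hb
  set d := u.repr (β.1 (u 1)) 1 with hd
  have hrK : (⟨r, 0⟩ : Qp2 p Δ) ≠ 0 := fun h => hr0 (congrArg QuadraticAlgebra.re h)
  have k00 := β.2 (u 0) (u 0)
  have k01 := β.2 (u 0) (u 1)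
  have k11 := β.2 (u 1) (u 1)
  rw [bil_eq u hB (β.1 (u 0)) (u 0), bil_eq u hB (u 0) (β.1 (u 0)), hr] at k00
  rw [bil_eq u hB (β.1 (u 0)) (u 1), bil_eq u hB (u 0) (β.1 (u 1)), hr] at k01
  rw [bil_eq u hB (β.1 (u 1)) (u 1), bil_eq u hB (u 1) (β.1 (u 1)), hr] at k11
  simp only [u.repr_self, Finsupp.single_apply, if_true, Fin.isValue, zero_ne_one,
    one_ne_zero, if_false, mul_one, mul_zero, one_mul, zero_mul, sub_zero, zero_sub,
    map_mul, star_coe, map_neg, ← ha, ← hb, ← hc, ← hd] at k00 k01 k11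
  have hc' : starRingEnd _ c = -c := (mul_right_cancel₀ hrK k00).symm
  have hda : a = starRingEnd _ d := mul_right_cancel₀ hrK k01
  have hb' : starRingEnd _ b = -b := by
    have := mul_right_cancel₀ hrK k11
    exact (neg_eq_iff_eq_neg.2 this).symm
  have hbim := im_eq_of_star_eq_neg hb'
  have hcim := im_eq_of_star_eq_neg hc'
  have hdd : d = ⟨a.re, -a.im⟩ := by
    have : starRingEnd _ a = d := by rw [hda]; exact star_star d
    rw [← this]
    exact star_mk' a.re a.im
  -- The last coordinate undoes the normalizing factor `-2/Δ` of `modelEnd`.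
  refine ⟨![a.re, a.im, b.im, ((Δ : ℤ_[p]) : ℚ_[p]) / (-2) * c.im], ext_apply fun x => ?_⟩
  have hx : β.1 x = starRingEnd _ (u.repr x 0) • β.1 (u 0) +
      starRingEnd _ (u.repr x 1) • β.1 (u 1) := by
    conv_lhs => rw [← u.sum_repr x]
    rw [Fin.sum_univ_two, map_add, LinearMap.map_smulₛₗ, LinearMap.map_smulₛₗ]
  change (modelEnd u hB hr _).1 x = _
  refine ext_repr u ?_ ?_
  · rw [(repr_modelEnd u hB hr _ _).1, hx, map_add, Finsupp.add_apply, map_smul, map_smul,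
      Finsupp.smul_apply, Finsupp.smul_apply, ← ha, ← hb, smul_eq_mul, smul_eq_mul,
      mul_comm _ a, mul_comm _ b]
    conv_rhs => rw [hbim]
    simp
  · rw [(repr_modelEnd u hB hr _ _).2, hx, map_add, Finsupp.add_apply, map_smul, map_smul,
      Finsupp.smul_apply, Finsupp.smul_apply, ← hc, ← hd, smul_eq_mul, smul_eq_mul,
      mul_comm _ c, mul_comm _ d]
    conv_rhs => rw [hcim, hdd]
    have : -2 / ((Δ : ℤ_[p]) : ℚ_[p]) * (((Δ : ℤ_[p]) : ℚ_[p]) / (-2) * c.im) = c.im := by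
      field_simp
    simp [this]

/-- The linear parametrization `modelEnd` of the special endomorphisms. -/
def modelLinear (u : Module.Basis (Fin 2) (Qp2 p Δ) U) (hB : B.IsAlt)
    {r : ℚ_[p]} (hr : B (u 0) (u 1) = ⟨r, 0⟩) : (Fin 4 → ℚ_[p]) →ₗ[ℚ_[p]] SpecialEnd B where
  toFun := modelEnd u hB hr
  map_add' := fun v w => ext_apply fun x => by
    rw [coe_add_apply]
    refine ext_repr u ?_ ?_
    · rw [map_add, Finsupp.add_apply]
      simp only [(repr_modelEnd u hB hr _ _).1]
      ext <;> simp <;> ring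
    · rw [map_add, Finsupp.add_apply]
      simp only [(repr_modelEnd u hB hr _ _).2]
      ext <;> simp <;> ring
  map_smul' := fun c v => ext_apply fun x => by
    rw [RingHom.id_apply, coe_smul_apply]
    refine ext_repr u ?_ ?_
    · rw [repr_smul_padic]
      simp only [(repr_modelEnd u hB hr _ _).1]
      ext <;> simp <;> ring
    · rw [repr_smul_padic]
      simp only [(repr_modelEnd u hB hr _ _).2]
      ext <;> simp <;> ring

/-- Coordinates on the space of special endomorphisms in which the quadratic form is
`x² - Δy² + 2bc` and the stabilizer of the lattice of `u` is the standard lattice. -/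
def modelEquiv (u : Module.Basis (Fin 2) (Qp2 p Δ) U) (hB : B.IsAlt)
    {r : ℚ_[p]} (hr0 : r ≠ 0) (hr : B (u 0) (u 1) = ⟨r, 0⟩) :
    (Fin 4 → ℚ_[p]) ≃ₗ[ℚ_[p]] SpecialEnd B :=
  LinearEquiv.ofBijective (modelLinear u hB hr)
    ⟨(injective_iff_map_eq_zero _).2 fun _ hv => modelEnd_eq_zero u hB hr hv,
      modelEnd_surjective u hB hr0 hr⟩

/-- Stability means that the matrix entries are integral. An entry `x + yδ` is integral exactly when
`x` and `y` are, and `-2/Δ` is a unit. -/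
theorem stable_modelEnd_iff (u : Module.Basis (Fin 2) (Qp2 p Δ) U) (hB : B.IsAlt)
    {r : ℚ_[p]} (hr : B (u 0) (u 1) = ⟨r, 0⟩) (v : Fin 4 → ℚ_[p]) :
    Stable (basisNorm u) (modelEnd u hB hr v) ↔ ∀ i, ‖v i‖ ≤ 1 := by
  have h2 : ‖-2 / ((Δ : ℤ_[p]) : ℚ_[p])‖ = 1 := by
    rw [norm_div, norm_neg, norm_unit_coe, div_one]; exact norm_two_eq_one
  have habs : ∀ s t : ℚ_[p], absK (⟨s, t⟩ : Qp2 p Δ) = max ‖s‖ ‖t‖ := fun s t => absK_eq_max _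
  constructor
  · intro h
    have key : ∀ j i, absK (u.repr ((modelEnd u hB hr v).1 (u j)) i) ≤ 1 := fun j => by
      rw [← basisNorm_le_iff]
      refine (h (u j)).trans ?_
      rw [basisNorm_le_iff]
      intro i
      rw [u.repr_self, Finsupp.single_apply]
      split_ifs <;> simp
    have h00 := key 0 0
    have h01 := key 0 1
    have h10 := key 1 0
    rw [(repr_modelEnd u hB hr _ _).1] at h00 h10
    rw [(repr_modelEnd u hB hr _ _).2] at h01
    simp only [u.repr_self, Finsupp.single_apply, if_true, Fin.isValue, zero_ne_one, one_ne_zero,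
      if_false, map_one, map_zero, mul_one, mul_zero, add_zero, zero_add, habs, max_le_iff,
      norm_mul, h2, one_mul] at h00 h01 h10
    intro i
    fin_cases i
    · exact h00.1
    · exact h00.2
    · exact h10.2
    · exact h01.2
  · intro h x
    rw [basisNorm_le_iff]
    have hx : ∀ i, absK (starRingEnd _ (u.repr x i)) ≤ basisNorm u x := fun i => by
      rw [absK_star]; exact (basisNorm_le_iff u x).1 le_rfl i
    have hmul : ∀ (a : Qp2 p Δ) i, absK a ≤ 1 →
        absK (a * starRingEnd _ (u.repr x i)) ≤ basisNorm u x := fun a i ha => by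
      rw [absK_mul]
      exact (mul_le_of_le_one_left (absK_nonneg _) ha).trans (hx i)
    intro i
    fin_cases i
    · refine ((congrArg absK (repr_modelEnd u hB hr v x).1).le).trans ?_
      refine (absK_add_le _ _).trans (max_le (hmul _ _ ?_) (hmul _ _ ?_))
      · rw [habs]; exact max_le (h 0) (h 1)
      · rw [habs, norm_zero]; exact max_le zero_le_one (h 2)
    · refine ((congrArg absK (repr_modelEnd u hB hr v x).2).le).trans ?_
      refine (absK_add_le _ _).trans (max_le (hmul _ _ ?_) (hmul _ _ ?_))
      · rw [habs, norm_zero, norm_mul, h2, one_mul]; exact max_le zero_le_one (h 3)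
      · rw [habs, norm_neg]; exact max_le (h 0) (h 1)

/-- The stabilizer of a lattice has a basis with Gram matrix `modelMatrix Δ`. -/
theorem exists_modelEquiv [Nontrivial U] (hsq : SqSpec B) (hB : B.IsAlt) (hnd : B.Nondegenerate)
    (u : Module.Basis (Fin 2) (Qp2 p Δ) U) :
    ∃ E : (Fin 4 → ℚ_[p]) ≃ₗ[ℚ_[p]] SpecialEnd B,
      (∀ v w, specialBil hsq (E v) (E w) = v ⬝ᵥ modelMatrix ((Δ : ℤ_[p]) : ℚ_[p]) *ᵥ w) ∧
      ∀ v, Stable (basisNorm u) (E v) ↔ ∀ i, ‖v i‖ ≤ 1 := by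
  obtain ⟨w, r, hr0, hw, hr⟩ := exists_basis_bil_eq hB hnd u
  have hE : ∀ v, modelEquiv w hB hr0 hr v = modelEnd w hB hr v := fun v => rfl
  refine ⟨modelEquiv w hB hr0 hr, fun v v' => ?_, fun v => ?_⟩
  · rw [specialBil_apply, ← map_add]
    have hQ : ∀ v, Qpp (modelEquiv w hB hr0 hr v) =
        v 0 ^ 2 - ((Δ : ℤ_[p]) : ℚ_[p]) * v 1 ^ 2 + 2 * v 2 * v 3 := fun v => by
      rw [hE]; exact hsq.Qpp_eq (modelEnd_sq w hB hr v)
    rw [hQ, hQ, hQ]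
    simp [modelMatrix, dotProduct, Matrix.mulVec, Fin.sum_univ_four]
    ring
  · rw [hE, ← hw]; exact stable_modelEnd_iff w hB hr v

end ModelBasis

/-! ### Norms split along a pair of lines. -/

section Split

variable {p : ℕ} [Fact p.Prime] {Δ : ℤ_[p]ˣ} [Fact (p ≠ 2)] [Fact (¬ IsSquare (Δ : ℤ_[p]))]
  {U : Type*} [AddCommGroup U] [Module (Qp2 p Δ) U]

/-- `α` is the maximum norm for the decomposition of `U` by the basis `f`, up to weights. -/
def UNorm.Splits (α : UNorm Δ U) (f : Module.Basis (Fin 2) (Qp2 p Δ) U) : Prop :=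
  ∀ x, α x = max (absK (f.repr x 0) * α (f 0)) (absK (f.repr x 1) * α (f 1))

theorem repr_decomp (f : Module.Basis (Fin 2) (Qp2 p Δ) U) (x : U) :
    x = f.repr x 0 • f 0 + f.repr x 1 • f 1 := by
  conv_lhs => rw [← f.sum_repr x]
  rw [Fin.sum_univ_two]

/-- If `s` denotes the involution `(1, -1)` on the two lines, then `x ± sx` is twice a component of
`x`. As `2` is a unit, each component is bounded by `α x`. -/
theorem UNorm.splits_of_le {α : UNorm Δ U} {f : Module.Basis (Fin 2) (Qp2 p Δ) U}
    (h : ∀ x, α (f.repr x 0 • f 0 - f.repr x 1 • f 1) ≤ α x) : α.Splits f := by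
  intro x
  have h2 : absK (2 : Qp2 p Δ) = 1 := by
    have : (2 : Qp2 p Δ) = algebraMap ℚ_[p] _ 2 := (map_ofNat (algebraMap ℚ_[p] (Qp2 p Δ)) 2).symm
    rw [this, absK_algebraMap]; exact norm_two_eq_one
  rw [← α.map_smul, ← α.map_smul]
  refine le_antisymm ?_ (max_le ?_ ?_)
  · conv_lhs => rw [repr_decomp f x]
    exact α.map_add_le _ _
  · have h1 : α ((2 : Qp2 p Δ) • f.repr x 0 • f 0) ≤ α x := by
      have : (2 : Qp2 p Δ) • f.repr x 0 • f 0 = x + (f.repr x 0 • f 0 - f.repr x 1 • f 1) := by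
        nth_rewrite 2 [repr_decomp f x]
        rw [two_smul]; abel
      rw [this]
      exact (α.map_add_le _ _).trans (max_le le_rfl (h x))
    rwa [α.map_smul, h2, one_mul] at h1
  · have h1 : α ((2 : Qp2 p Δ) • f.repr x 1 • f 1) ≤ α x := by
      have : (2 : Qp2 p Δ) • f.repr x 1 • f 1 = x - (f.repr x 0 • f 0 - f.repr x 1 • f 1) := by
        nth_rewrite 2 [repr_decomp f x]
        rw [two_smul]; abel
      rw [this]
      exact (α.map_sub_le _ _).trans (max_le le_rfl (h x))
    rwa [α.map_smul, h2, one_mul] at h1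

theorem basisNorm_self (f : Module.Basis (Fin 2) (Qp2 p Δ) U) (i : Fin 2) :
    basisNorm f (f i) = 1 := by
  rw [basisNorm_apply]
  fin_cases i <;> simp

theorem basisNorm_splits (f : Module.Basis (Fin 2) (Qp2 p Δ) U) : (basisNorm f).Splits f := by
  intro x
  rw [basisNorm_self, basisNorm_self, mul_one, mul_one, basisNorm_apply]

omit [Fact (p ≠ 2)] in
theorem coe_prime_ne_zero (Δ : ℤ_[p]ˣ) [Fact (¬ IsSquare (Δ : ℤ_[p]))] :
    algebraMap ℚ_[p] (Qp2 p Δ) p ≠ 0 :=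
  (map_ne_zero_iff _ (algebraMap ℚ_[p] (Qp2 p Δ)).injective).2
    (by exact_mod_cast (Fact.out : p.Prime).ne_zero)

/-- The maximum norm for the basis `f₀, p^{-i} f₁`. -/
def lineNorm (f : Module.Basis (Fin 2) (Qp2 p Δ) U) (i : ℤ) : UNorm Δ U :=
  basisNorm (f.unitsSMul ![1, (Units.mk0 (algebraMap ℚ_[p] (Qp2 p Δ) p)
    (coe_prime_ne_zero Δ)) ^ (-i)])

theorem absK_zpow (a : Qp2 p Δ) (n : ℤ) : absK (a ^ n) = absK a ^ n := by
  let φ : Qp2 p Δ →*₀ ℝ :=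
    { toFun := absK, map_zero' := absK_zero, map_one' := absK_one, map_mul' := absK_mul }
  exact map_zpow₀ φ a n

theorem lineNorm_apply (f : Module.Basis (Fin 2) (Qp2 p Δ) U) (i : ℤ) (x : U) :
    lineNorm f i x = max (absK (f.repr x 0)) ((p : ℝ) ^ (-i) * absK (f.repr x 1)) := by
  rw [lineNorm, basisNorm_apply, Module.Basis.repr_unitsSMul, Module.Basis.repr_unitsSMul]
  simp only [Matrix.cons_val_zero, Matrix.cons_val_one, inv_one, one_smul, Units.smul_def,
    smul_eq_mul, Units.val_inv_eq_inv_val, Units.val_zpow_eq_zpow_val, Units.val_mk0, absK_mul,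
    absK_inv, absK_zpow, absK_algebraMap, Padic.norm_p]
  congr 2
  rw [zpow_neg, inv_inv, inv_zpow, ← zpow_neg]

theorem lineNorm_fst (f : Module.Basis (Fin 2) (Qp2 p Δ) U) (i : ℤ) : lineNorm f i (f 0) = 1 := by
  rw [lineNorm_apply]; simp

theorem lineNorm_snd (f : Module.Basis (Fin 2) (Qp2 p Δ) U) (i : ℤ) :
    lineNorm f i (f 1) = (p : ℝ) ^ (-i) := by
  rw [lineNorm_apply]
  simpa using (zpow_pos (p_pos (p := p)) i).le

theorem lineNorm_splits (f : Module.Basis (Fin 2) (Qp2 p Δ) U) (i : ℤ) :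
    (lineNorm f i).Splits f := by
  intro x
  rw [lineNorm_fst, lineNorm_snd, mul_one, lineNorm_apply, mul_comm]

theorem lineNorm_isVertex (hU : Module.finrank (Qp2 p Δ) U = 2)
    (f : Module.Basis (Fin 2) (Qp2 p Δ) U) (i : ℤ) :
    Building.IsVertex (Quotient.mk (homothety Δ U) (lineNorm f i)) :=
  (isVertex_iff hU _).2 ⟨_, rfl⟩

theorem UNorm.Splits.homothety_of_eq {α α' : UNorm Δ U} {f : Module.Basis (Fin 2) (Qp2 p Δ) U}
    (h : α.Splits f) (h' : α'.Splits f) {c : ℝ} (hc : 0 < c) (h0 : α' (f 0) = c * α (f 0))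
    (h1 : α' (f 1) = c * α (f 1)) :
    Quotient.mk (homothety Δ U) α = Quotient.mk (homothety Δ U) α' := by
  refine Quotient.sound ⟨c, hc, fun x => ?_⟩
  rw [h x, h' x, h0, h1, mul_max_of_nonneg _ _ hc.le]
  congr 1 <;> ring

theorem mk_lineNorm_injective (f : Module.Basis (Fin 2) (Qp2 p Δ) U) :
    Function.Injective fun i => Quotient.mk (homothety Δ U) (lineNorm f i) := by
  intro i j h
  obtain ⟨c, -, h⟩ := Quotient.exact h
  have h0 := h (f 0)
  have h1 := h (f 1)
  rw [lineNorm_fst, lineNorm_fst, mul_one] at h0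
  rw [← h0, one_mul, lineNorm_snd, lineNorm_snd] at h1
  exact (neg_injective (zpow_right_injective₀ p_pos (one_lt_p (p := p)).ne' h1)).symm

end Split

/-! ### Primitive vertices and eigenlines. -/

section PrimitiveVertices

variable {p : ℕ} [Fact p.Prime] {Δ : ℤ_[p]ˣ} [Fact (p ≠ 2)] [Fact (¬ IsSquare (Δ : ℤ_[p]))]
  {U : Type*} [AddCommGroup U] [Module (Qp2 p Δ) U]
  [Module ℚ_[p] U] [IsScalarTower ℚ_[p] (Qp2 p Δ) U]
  {B : LinearMap.BilinForm (Qp2 p Δ) U}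

theorem stable_iff_of_splits {α : UNorm Δ U} {f : Module.Basis (Fin 2) (Qp2 p Δ) U}
    (h : α.Splits f) (β : SpecialEnd B) :
    Stable α β ↔ α (β.1 (f 0)) ≤ α (f 0) ∧ α (β.1 (f 1)) ≤ α (f 1) := by
  refine ⟨fun hs => ⟨hs _, hs _⟩, fun hs x => ?_⟩
  rw [h x]
  conv_lhs => rw [repr_decomp f x, map_add, LinearMap.map_smulₛₗ, LinearMap.map_smulₛₗ]
  refine (α.map_add_le _ _).trans (max_le_max ?_ ?_)
  · rw [α.map_smul, absK_star]
    exact mul_le_mul_of_nonneg_left hs.1 (absK_nonneg _)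
  · rw [α.map_smul, absK_star]
    exact mul_le_mul_of_nonneg_left hs.2 (absK_nonneg _)

/-- The vertices `b` such that the components of `β` are a basis of a direct summand of the
lattice of special endomorphisms stabilizing `b`. -/
def primitiveVertices {ι : Type*} [Fintype ι] (β : ι → SpecialEnd B) : Set (Building Δ U) :=
  {b | b.IsVertex ∧ (∀ i, b.Stable (β i)) ∧ ∀ c : ι → ℤ_[p],
    b.Stable ((p : ℚ_[p])⁻¹ • ∑ i, ((c i : ℤ_[p]) : ℚ_[p]) • β i) → ∀ i, (p : ℤ_[p]) ∣ c i}

theorem dvd_iff_norm_inv_mul_le (x : ℤ_[p]) :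
    (p : ℤ_[p]) ∣ x ↔ ‖(p : ℚ_[p])⁻¹ * ((x : ℤ_[p]) : ℚ_[p])‖ ≤ 1 := by
  have hp0 : (p : ℚ_[p]) ≠ 0 := by exact_mod_cast (Fact.out : p.Prime).ne_zero
  constructor
  · rintro ⟨y, rfl⟩
    rw [PadicInt.coe_mul, PadicInt.coe_natCast, inv_mul_cancel_left₀ hp0]
    exact y.2
  · intro h
    refine ⟨⟨_, h⟩, Subtype.ext ?_⟩
    change (x : ℚ_[p]) = ((p : ℤ_[p]) : ℚ_[p]) * ((p : ℚ_[p])⁻¹ * (x : ℚ_[p]))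
    rw [PadicInt.coe_natCast]
    exact (mul_inv_cancel_left₀ hp0 _).symm

variable [Nontrivial U]

/-- Pairing a stable element `p⁻¹ ∑ c_i β_i` with `β₀` and `β₁` gives integers `p⁻¹ c_i t_i`, so `p`
divides `c₀` and `c₁`. Only divisibility of `β₂` can destroy primitivity. -/
theorem mem_primitiveVertices_diag (hsq : SqSpec B) {β : Fin 3 → SpecialEnd B}
    {t : Fin 3 → ℚ_[p]} (hg : gram β = Matrix.diagonal t) (h0 : ‖t 0‖ = 1) (h1 : ‖t 1‖ = 1)
    (α : UNorm Δ U) :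
    (Quotient.mk (homothety Δ U) α : Building Δ U) ∈ primitiveVertices β ↔
      Building.IsVertex (Quotient.mk (homothety Δ U) α) ∧
      Stable α (β 0) ∧ Stable α (β 1) ∧ Stable α (β 2) ∧ ¬ Stable α ((p : ℚ_[p])⁻¹ • β 2) := by
  have hgij : ∀ i j, specialBil hsq (β i) (β j) = Matrix.diagonal t i j := fun i j => by
    rw [← hg]; rfl
  constructor
  · rintro ⟨hv, hs, hp⟩
    refine ⟨hv, hs 0, hs 1, hs 2, fun h => ?_⟩
    have := hp (Pi.single 2 1) (by
      change Stable α _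
      simp only [Fin.sum_univ_three, Pi.single_apply]
      simpa using h) 2
    rw [Pi.single_eq_same] at this
    exact PadicInt.prime_p.not_isUnit (isUnit_of_dvd_one this)
  · rintro ⟨hv, hs0, hs1, hs2, hn⟩
    refine ⟨hv, fun i => ?_, fun c hc => ?_⟩
    · fin_cases i
      · exact hs0
      · exact hs1
      · exact hs2
    · have key : ∀ i, Stable α (β i) → ‖t i‖ = 1 → (p : ℤ_[p]) ∣ c i := fun i hi hti => by
        have h := Stable.norm_le_one hsq hi hc
        rw [map_smul, map_sum] at h
        simp only [map_smul, hgij] at h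
        rw [Finset.sum_eq_single i, Matrix.diagonal_apply_eq] at h
        · rw [dvd_iff_norm_inv_mul_le]
          simpa only [smul_eq_mul, norm_mul, hti, mul_one] using h
        · intro j _ hj
          rw [Matrix.diagonal_apply_ne _ hj.symm, smul_zero]
        · intro h; exact absurd (Finset.mem_univ i) h
      have k0 := key 0 hs0 h0
      have k1 := key 1 hs1 h1
      have k2 : (p : ℤ_[p]) ∣ c 2 := by
        by_contra hc2
        have hu : IsUnit (c 2) := by
          rw [PadicInt.isUnit_iff]
          refine le_antisymm (PadicInt.norm_le_one _) (not_lt.1 fun h => hc2 ?_)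
          rwa [← PadicInt.norm_lt_one_iff_dvd]
        have hun : ‖((c 2 : ℤ_[p]) : ℚ_[p])‖ = 1 := PadicInt.isUnit_iff.1 hu
        have hc20 : ((c 2 : ℤ_[p]) : ℚ_[p]) ≠ 0 := by
          rw [← norm_ne_zero_iff, hun]; exact one_ne_zero
        refine hn ?_
        have e : (p : ℚ_[p])⁻¹ • β 2 = ((c 2 : ℤ_[p]) : ℚ_[p])⁻¹ •
            ((p : ℚ_[p])⁻¹ • ∑ i, ((c i : ℤ_[p]) : ℚ_[p]) • β i +
            -((p : ℚ_[p])⁻¹ * ((c 0 : ℤ_[p]) : ℚ_[p])) • β 0 +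
            -((p : ℚ_[p])⁻¹ * ((c 1 : ℤ_[p]) : ℚ_[p])) • β 1) := by
          rw [Fin.sum_univ_three, eq_inv_smul_iff₀ hc20]
          module
        rw [e]
        refine Stable.smul (Stable.add (Stable.add hc (hs0.smul ?_)) (hs1.smul ?_)) ?_
        · rw [norm_neg]; exact (dvd_iff_norm_inv_mul_le _).1 k0
        · rw [norm_neg]; exact (dvd_iff_norm_inv_mul_le _).1 k1
        · rw [norm_inv, hun, inv_one]
      intro i
      fin_cases i
      · exact k0
      · exact k1
      · exact k2

/-- From `j² = L²`, the vector `jv + Lv` is an eigenvector for `L` unless it vanishes; then `v` has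
eigenvalue `-L` and `γv` has eigenvalue `L`. Since `γ` exchanges the eigenlines, `f₀` and `γf₀` form
a basis. -/
theorem exists_eigenbasis (hU : Module.finrank (Qp2 p Δ) U = 2) {j : U →ₗ[Qp2 p Δ] U}
    {L : Qp2 p Δ} (hL : L ≠ 0) (hj : ∀ x, j (j x) = (L * L) • x)
    {γ : SpecialEnd B} (hγ : ∀ x, x ≠ 0 → γ.1 x ≠ 0)
    (h1 : ∀ x, j x = L • x → j (γ.1 x) = -(L • γ.1 x))
    (h2 : ∀ x, j x = -(L • x) → j (γ.1 x) = L • γ.1 x) :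
    ∃ f : Module.Basis (Fin 2) (Qp2 p Δ) U, f 1 = γ.1 (f 0) ∧ j (f 0) = L • f 0 ∧
      j (f 1) = -(L • f 1) := by
  obtain ⟨f₀, hf0, hjf⟩ : ∃ f₀ : U, f₀ ≠ 0 ∧ j f₀ = L • f₀ := by
    obtain ⟨v, hv⟩ := exists_ne (0 : U)
    by_cases h : j v + L • v = 0
    · exact ⟨γ.1 v, hγ v hv, h2 v (eq_neg_of_add_eq_zero_left h)⟩
    · refine ⟨_, h, ?_⟩
      rw [map_add, hj, map_smul, smul_add, smul_smul, add_comm]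
  have h2K : (2 : Qp2 p Δ) ≠ 0 := by
    have : (2 : Qp2 p Δ) = algebraMap ℚ_[p] _ 2 := (map_ofNat (algebraMap ℚ_[p] (Qp2 p Δ)) 2).symm
    rw [this]
    exact (map_ne_zero_iff _ (algebraMap ℚ_[p] (Qp2 p Δ)).injective).2 two_coe_ne_zero
  have hli : LinearIndependent (Qp2 p Δ) ![f₀, γ.1 f₀] := by
    rw [LinearIndependent.pair_iff]
    intro s t hst
    have h3 := congrArg j hst
    rw [map_add, map_smul, map_smul, hjf, h1 _ hjf, map_zero] at h3
    have h4 : (2 * L * s) • f₀ = 0 := by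
      have : (2 * L * s) • f₀ = L • (s • f₀ + t • γ.1 f₀) + (s • L • f₀ + t • -(L • γ.1 f₀)) := by
        module
      rw [this, hst, h3, smul_zero, add_zero]
    have hs : s = 0 := by
      have := (smul_eq_zero.1 h4).resolve_right hf0
      exact (mul_eq_zero.1 this).resolve_left (mul_ne_zero h2K hL)
    refine ⟨hs, ?_⟩
    rw [hs, zero_smul, zero_add] at hst
    exact (smul_eq_zero.1 hst).resolve_right (hγ _ hf0)
  let f := basisOfLinearIndependentOfCardEqFinrank hli (by simp [hU])
  have hf : ∀ i, f i = ![f₀, γ.1 f₀] i := fun i => by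
    rw [coe_basisOfLinearIndependentOfCardEqFinrank]
  have e0 : f 0 = f₀ := hf 0
  have e1 : f 1 = γ.1 f₀ := hf 1
  exact ⟨f, by rw [e1, e0], by rw [e0, hjf], by rw [e1, h1 _ hjf]⟩

/-- An eigenvector of `j` for the eigenvalue `L` is a multiple of `f₀`. -/
theorem eq_smul_fst {f : Module.Basis (Fin 2) (Qp2 p Δ) U} {j : U →ₗ[Qp2 p Δ] U}
    {L : Qp2 p Δ} (hL : L ≠ 0) (h0 : j (f 0) = L • f 0) (h1 : j (f 1) = -(L • f 1)) {x : U}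
    (hx : j x = L • x) : x = f.repr x 0 • f 0 := by
  have h2K : (2 : Qp2 p Δ) ≠ 0 := by
    have : (2 : Qp2 p Δ) = algebraMap ℚ_[p] _ 2 := (map_ofNat (algebraMap ℚ_[p] (Qp2 p Δ)) 2).symm
    rw [this]
    exact (map_ne_zero_iff _ (algebraMap ℚ_[p] (Qp2 p Δ)).injective).2 two_coe_ne_zero
  have h3 : (2 * L * f.repr x 1) • f 1 = 0 := by
    have e : j x = f.repr x 0 • L • f 0 + f.repr x 1 • -(L • f 1) := by
      conv_lhs => rw [repr_decomp f x]
      rw [map_add, map_smul, map_smul, h0, h1]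
    have e2 : L • x = f.repr x 0 • L • f 0 + f.repr x 1 • (L • f 1) := by
      conv_lhs => rw [repr_decomp f x]
      module
    have : (2 * L * f.repr x 1) • f 1 = L • x - j x := by
      rw [e, e2]; module
    rw [this, hx, sub_self]
  have h4 : f.repr x 1 = 0 := by
    have := (smul_eq_zero.1 h3).resolve_right (f.ne_zero 1)
    exact (mul_eq_zero.1 this).resolve_left (mul_ne_zero h2K hL)
  conv_lhs => rw [repr_decomp f x, h4, zero_smul, add_zero]

/-- The map `L⁻¹ j` is the involution `(1, -1)` of `UNorm.splits_of_le`, and `L` is a unit. -/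
theorem splits_of_stable {f : Module.Basis (Fin 2) (Qp2 p Δ) U} {j : U →ₗ[Qp2 p Δ] U}
    {L : Qp2 p Δ} (hL : absK L = 1) (h0 : j (f 0) = L • f 0) (h1 : j (f 1) = -(L • f 1))
    {α : UNorm Δ U} (hα : ∀ x, α (j x) ≤ α x) : α.Splits f := by
  refine α.splits_of_le fun x => ?_
  have e : j x = L • (f.repr x 0 • f 0 - f.repr x 1 • f 1) := by
    conv_lhs => rw [repr_decomp f x]
    rw [map_add, map_smul, map_smul, h0, h1]
    module
  have := hα x
  rwa [e, α.map_smul, hL, one_mul] at this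

end PrimitiveVertices

/-! ### Primitive vertices of an orthogonal triple. -/

section DiagonalCount

theorem padic_smul_eq {p : ℕ} [Fact p.Prime] (Δ : ℤ_[p]ˣ) {U : Type*} [AddCommGroup U]
    [Module (Qp2 p Δ) U] [Module ℚ_[p] U] [IsScalarTower ℚ_[p] (Qp2 p Δ) U] (c : ℚ_[p]) (x : U) :
    c • x = algebraMap ℚ_[p] (Qp2 p Δ) c • x :=
  algebra_compatible_smul (Qp2 p Δ) c x

variable {p : ℕ} [Fact p.Prime] {Δ : ℤ_[p]ˣ} [Fact (p ≠ 2)] [Fact (¬ IsSquare (Δ : ℤ_[p]))]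
  {U : Type*} [AddCommGroup U] [Module (Qp2 p Δ) U]
  [Module ℚ_[p] U] [IsScalarTower ℚ_[p] (Qp2 p Δ) U]
  {B : LinearMap.BilinForm (Qp2 p Δ) U} [Nontrivial U]

/-- The linear map `β γ`. -/
def compEnd (β γ : SpecialEnd B) : U →ₗ[Qp2 p Δ] U := β.1.comp γ.1

theorem compEnd_apply (β γ : SpecialEnd B) (x : U) : compEnd β γ x = β.1 (γ.1 x) := rfl

theorem eq_zero_of_Qpp_ne_zero (hsq : SqSpec B) {β : SpecialEnd B} (h : Qpp β ≠ 0) (x : U)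
    (hx : x ≠ 0) : β.1 x ≠ 0 := fun h0 => by
  have h1 := hsq β x
  rw [h0, map_zero, padic_smul_eq Δ] at h1
  rcases smul_eq_zero.1 h1.symm with h2 | h2
  · exact h ((map_eq_zero_iff _ (algebraMap ℚ_[p] (Qp2 p Δ)).injective).1 h2)
  · exact hx h2

/-- The relations between the components of an orthogonal triple. -/
structure DiagTriple (β : Fin 3 → SpecialEnd B) (t : Fin 3 → ℚ_[p]) : Prop where
  sq : ∀ i x, (β i).1 ((β i).1 x) = t i • x
  anti : ∀ i j x, i ≠ j → (β i).1 ((β j).1 x) = -((β j).1 ((β i).1 x))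

theorem diagTriple (hsq : SqSpec B) {β : Fin 3 → SpecialEnd B} {t : Fin 3 → ℚ_[p]}
    (hg : gram β = Matrix.diagonal t) : DiagTriple β t where
  sq i x := by
    rw [hsq, ← specialBil_self hsq, ← gram_apply hsq β, hg, Matrix.diagonal_apply_eq]
  anti i j x hij := by
    have h := anticomm hsq (β i) (β j) x
    rw [← gram_apply hsq β, hg, Matrix.diagonal_apply_ne _ hij, mul_zero, zero_smul] at h
    exact eq_neg_of_add_eq_zero_left h

variable {β : Fin 3 → SpecialEnd B} {t : Fin 3 → ℚ_[p]}

theorem DiagTriple.comp_sq (h : DiagTriple β t) (x : U) :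
    compEnd (β 0) (β 1) (compEnd (β 0) (β 1) x) = (-(t 0 * t 1)) • x := by
  simp only [compEnd_apply]
  rw [h.anti 1 0 _ (by decide), map_neg, h.sq, h.sq, neg_smul, mul_smul]

theorem DiagTriple.comp_zero (h : DiagTriple β t) (x : U) :
    compEnd (β 0) (β 1) ((β 0).1 x) = -((β 0).1 (compEnd (β 0) (β 1) x)) := by
  simp only [compEnd_apply]
  rw [h.anti 1 0 _ (by decide), map_neg]

/-- Two signs cancel, whereas `β₀` anticommutes with `j = β₀β₁`. As both are `σ`-linear, it depends
on whether `σ` fixes or negates the eigenvalue of `j` which of them exchanges the eigenlines. -/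
theorem DiagTriple.comp_two (h : DiagTriple β t) (x : U) :
    compEnd (β 0) (β 1) ((β 2).1 x) = (β 2).1 (compEnd (β 0) (β 1) x) := by
  simp only [compEnd_apply]
  rw [h.anti 1 2 _ (by decide), map_neg, h.anti 0 2 _ (by decide), neg_neg]

theorem absK_eq_one_of_sq {a : Qp2 p Δ} {c : ℚ_[p]} (h : a * a = algebraMap ℚ_[p] _ c)
    (hc : ‖c‖ = 1) : absK a = 1 := by
  have h1 := congrArg absK h
  rw [absK_mul, absK_algebraMap, hc] at h1
  exact (mul_self_eq_one_iff.1 h1).resolve_right (by linarith [absK_nonneg a])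

theorem mul_star_of_eigen {γ : SpecialEnd B} {a : Qp2 p Δ} {c : ℚ_[p]} {x : U}
    (hx : x ≠ 0) (h : γ.1 x = a • x) (hc : γ.1 (γ.1 x) = c • x) :
    absK a * absK a = ‖c‖ := by
  rw [h, LinearMap.map_smulₛₗ, h, smul_smul, padic_smul_eq Δ] at hc
  have := smul_left_injective _ hx hc
  rw [← absK_algebraMap (Δ := Δ), ← this, absK_mul, absK_star]

theorem eigen_snd (h : DiagTriple β t) (ht : t 0 ≠ 0) {L : Qp2 p Δ} {x : U}
    (hx : (β 0).1 ((β 1).1 x) = L • x) :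
    (β 1).1 x = (t 0)⁻¹ • (β 0).1 (L • x) := by
  rw [← hx, h.sq, smul_smul, inv_mul_cancel₀ ht, one_smul]

theorem absK_le_inv_of_lt_one {a : Qp2 p Δ} (h : absK a < 1) : absK a ≤ (p : ℝ)⁻¹ := by
  by_cases ha : a = 0
  · rw [ha, absK_zero]; exact (inv_pos.2 p_pos).le
  obtain ⟨n, hn⟩ := exists_absK_eq_zpow ha
  rw [hn] at h ⊢
  rw [← zpow_neg_one]
  refine zpow_le_zpow_right₀ one_lt_p.le ?_
  have : n < 0 := by
    by_contra! h2
    exact absurd h (not_lt.2 (one_le_zpow₀ one_lt_p.le h2))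
  omega

/-- The elliptic case: at most one vertex. -/
theorem primitiveVertices_elliptic (hU : Module.finrank (Qp2 p Δ) U = 2) (hsq : SqSpec B)
    (hg : gram β = Matrix.diagonal t) (h0 : ‖t 0‖ = 1) (h1 : ‖t 1‖ = 1) (h2 : ‖t 2‖ ≤ 1)
    {l : ℚ_[p]} (hl : l * l = -(t 0 * t 1)) :
    ∃ v : Building Δ U, primitiveVertices β = if ‖t 2‖ = 1 then {v} else ∅ := by
  have h := diagTriple hsq hg
  have ht0 : t 0 ≠ 0 := by rw [← norm_ne_zero_iff, h0]; exact one_ne_zero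
  set L : Qp2 p Δ := algebraMap ℚ_[p] _ l with hL
  have hLL : L * L = algebraMap ℚ_[p] _ (-(t 0 * t 1)) := by rw [hL, ← map_mul, hl]
  have hL1 : absK L = 1 := absK_eq_one_of_sq hLL (by rw [norm_neg, norm_mul, h0, h1, one_mul])
  have hL0 : L ≠ 0 := by rintro h; rw [h, absK_zero] at hL1; exact zero_ne_one hL1
  have hLs : starRingEnd _ L = L := star_coe l
  -- Here `σ` fixes `L`, so `β₀` exchanges the eigenlines of `j` and `β₂` preserves them.
  obtain ⟨f, hf1, hj0, hj1⟩ := exists_eigenbasis (γ := β 0) hU hL0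
    (fun x => by rw [h.comp_sq, hLL, padic_smul_eq Δ])
    (fun x hx => eq_zero_of_Qpp_ne_zero hsq (by rw [hsq.Qpp_eq (h.sq 0)]; exact ht0) x hx)
    (fun x hx => by rw [h.comp_zero, hx, LinearMap.map_smulₛₗ, hLs])
    (fun x hx => by rw [h.comp_zero, hx, map_neg, LinearMap.map_smulₛₗ, hLs, neg_neg])
  have b01 : (β 0).1 (f 1) = t 0 • f 0 := by rw [hf1, h.sq]
  have b10 : (β 1).1 (f 0) = (t 0)⁻¹ • L • f 1 := by
    rw [eigen_snd h ht0 hj0, LinearMap.map_smulₛₗ, hLs, hf1]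
  have b11 : (β 1).1 (f 1) = -(L • f 0) := by
    rw [eigen_snd h ht0 (L := -L) (by rw [neg_smul]; exact hj1), LinearMap.map_smulₛₗ, map_neg, hLs,
      b01, neg_smul, smul_neg, smul_comm L, smul_smul, inv_mul_cancel₀ ht0, one_smul]
  obtain ⟨a, ha⟩ : ∃ a : Qp2 p Δ, (β 2).1 (f 0) = a • f 0 :=
    ⟨_, eq_smul_fst hL0 hj0 hj1 (by rw [h.comp_two, hj0, LinearMap.map_smulₛₗ, hLs])⟩
  have b21 : (β 2).1 (f 1) = -(starRingEnd _ a • f 1) := by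
    rw [hf1, h.anti 2 0 _ (by decide), ha, LinearMap.map_smulₛₗ]
  have hat : absK a * absK a = ‖t 2‖ := mul_star_of_eigen (f.ne_zero 0) ha (h.sq 2 _)
  -- A norm stable under `β₀` and `β₁` splits along the eigenlines; since `β₀` exchanges them and
  -- `t₀` is a unit, the two weights agree. So only one class is possible.
  have huniq : ∀ α : UNorm Δ U, Stable α (β 0) → Stable α (β 1) →
      Quotient.mk (homothety Δ U) (basisNorm f) = Quotient.mk (homothety Δ U) α := by
    intro α s0 s1
    have hs : α.Splits f := splits_of_stable hL1 hj0 hj1 fun x => (s0 _).trans (s1 _)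
    have e1 : α (f 1) ≤ α (f 0) := by rw [hf1]; exact s0 _
    have e2 : α (f 0) ≤ α (f 1) := by
      have := s0 (f 1)
      rwa [b01, α.map_smul_padic, h0, one_mul] at this
    have e3 := le_antisymm e1 e2
    exact (basisNorm_splits f).homothety_of_eq hs (α.pos (f.ne_zero 0))
      (by rw [basisNorm_self, mul_one]) (by rw [basisNorm_self, mul_one, e3])
  have hN0 : ∀ i, (basisNorm f) (f i) = 1 := basisNorm_self f
  have s0 : Stable (basisNorm f) (β 0) := by
    rw [stable_iff_of_splits (basisNorm_splits f), ← hf1, b01, UNorm.map_smul_padic, h0]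
    simp [hN0]
  have s1 : Stable (basisNorm f) (β 1) := by
    rw [stable_iff_of_splits (basisNorm_splits f), b10, b11, UNorm.map_smul_padic, norm_inv, h0,
      UNorm.map_neg, UNorm.map_smul, UNorm.map_smul, hL1]
    simp [hN0]
  have s2 : Stable (basisNorm f) (β 2) ↔ absK a ≤ 1 := by
    rw [stable_iff_of_splits (basisNorm_splits f), ha, b21, UNorm.map_neg, UNorm.map_smul,
      UNorm.map_smul, absK_star]
    simp [hN0]
  have s2' : Stable (basisNorm f) ((p : ℚ_[p])⁻¹ • β 2) ↔ absK a ≤ (p : ℝ)⁻¹ := by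
    rw [stable_iff_of_splits (basisNorm_splits f), coe_smul_apply, coe_smul_apply, ha, b21,
      UNorm.map_smul_padic, UNorm.map_smul_padic, UNorm.map_neg, UNorm.map_smul,
      UNorm.map_smul, absK_star, norm_inv, Padic.norm_p, inv_inv]
    simp only [hN0, mul_one, and_self]
    rw [mul_comm, ← le_div_iff₀ p_pos, one_div]
  have ha1 : absK a ≤ 1 := by
    by_contra! hlt
    nlinarith
  refine ⟨Quotient.mk (homothety Δ U) (basisNorm f), Set.ext fun v => ?_⟩
  induction v using Quotient.inductionOn with
  | h α =>
    refine (mem_primitiveVertices_diag hsq hg h0 h1 α).trans ?_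
    constructor
    · rintro ⟨hv, r0, r1, r2, hn⟩
      have e := huniq α r0 r1
      have hn' : ¬ Stable (basisNorm f) ((p : ℚ_[p])⁻¹ • β 2) := fun hh =>
        hn ((stable_congr (Quotient.exact e) _).1 hh)
      rw [s2'] at hn'
      have : absK a = 1 := by
        by_contra hne
        exact hn' (absK_le_inv_of_lt_one (lt_of_le_of_ne ha1 hne))
      rw [if_pos (by rw [← hat, this, one_mul])]
      exact e.symm
    · intro hmem
      split_ifs at hmem with hc
      · have hex := Quotient.exact (Set.mem_singleton_iff.1 hmem).symm
        refine ⟨(isVertex_iff hU _).2 ⟨f, (Set.mem_singleton_iff.1 hmem).symm⟩, (stable_congr hex _).1 s0,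
          (stable_congr hex _).1 s1, (stable_congr hex _).1 (s2.2 ha1), fun hh => ?_⟩
        have h3 := s2'.1 ((stable_congr hex _).2 hh)
        have h4 : (p : ℝ)⁻¹ < 1 := inv_lt_one_of_one_lt₀ one_lt_p
        have h5 := absK_nonneg a
        nlinarith
      · exact absurd hmem (Set.notMem_empty _)

/-- The hyperbolic case: the two ends of a segment. -/
theorem primitiveVertices_hyperbolic (hU : Module.finrank (Qp2 p Δ) U = 2) (hsq : SqSpec B)
    (hg : gram β = Matrix.diagonal t) (h0 : ‖t 0‖ = 1) (h1 : ‖t 1‖ = 1) {k : ℕ}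
    (h2 : ‖t 2‖ = (p : ℝ) ^ (-(k : ℤ)))
    {l : ℚ_[p]} (hl : ((Δ : ℤ_[p]) : ℚ_[p]) * (l * l) = -(t 0 * t 1)) :
    ∃ f : ℤ → Building Δ U, Function.Injective f ∧ primitiveVertices β = {f 0, f k} := by
  have h := diagTriple hsq hg
  have ht0 : t 0 ≠ 0 := by rw [← norm_ne_zero_iff, h0]; exact one_ne_zero
  have ht2 : t 2 ≠ 0 := by rw [← norm_ne_zero_iff, h2]; exact (zpow_pos p_pos _).ne'
  set L : Qp2 p Δ := ⟨0, l⟩ with hL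
  have hLL : L * L = algebraMap ℚ_[p] _ (-(t 0 * t 1)) := by
    rw [← hl, hL]
    ext <;> simp [mul_assoc]
  have hL1 : absK L = 1 := absK_eq_one_of_sq hLL (by rw [norm_neg, norm_mul, h0, h1, one_mul])
  have hL0 : L ≠ 0 := by rintro h; rw [h, absK_zero] at hL1; exact zero_ne_one hL1
  have hLs : starRingEnd _ L = -L := by
    rw [hL, star_mk']
    ext <;> simp
  -- Now `σ` negates `L`, so the roles are reversed: `β₂` exchanges the eigenlines and `β₀`
  -- preserves them.
  obtain ⟨f, hf1, hj0, hj1⟩ := exists_eigenbasis (γ := β 2) hU hL0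
    (fun x => by rw [h.comp_sq, hLL, padic_smul_eq Δ])
    (fun x hx => eq_zero_of_Qpp_ne_zero hsq (by rw [hsq.Qpp_eq (h.sq 2)]; exact ht2) x hx)
    (fun x hx => by rw [h.comp_two, hx, LinearMap.map_smulₛₗ, hLs, neg_smul])
    (fun x hx => by rw [h.comp_two, hx, map_neg, LinearMap.map_smulₛₗ, hLs, neg_smul, neg_neg])
  have b21 : (β 2).1 (f 1) = t 2 • f 0 := by rw [hf1, h.sq]
  obtain ⟨m, hm⟩ : ∃ m : Qp2 p Δ, (β 0).1 (f 0) = m • f 0 :=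
    ⟨_, eq_smul_fst hL0 hj0 hj1 (by
      rw [h.comp_zero, hj0, LinearMap.map_smulₛₗ, hLs, neg_smul, neg_neg])⟩
  have b01 : (β 0).1 (f 1) = -(starRingEnd _ m • f 1) := by
    rw [hf1, h.anti 0 2 _ (by decide), hm, LinearMap.map_smulₛₗ]
  have hm1 : absK m = 1 := by
    have := mul_star_of_eigen (f.ne_zero 0) hm (h.sq 0 _)
    rw [h0] at this
    exact (mul_self_eq_one_iff.1 this).resolve_right (by linarith [absK_nonneg m])
  -- On the eigenlines `β₀` and `β₁` act by units, so they stabilize every norm split along these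
  -- lines. The vertices of this kind form an apartment.
  have hst : ∀ α : UNorm Δ U, α.Splits f → Stable α (β 0) ∧ Stable α (β 1) := fun α hα => by
    have n00 : α ((β 0).1 (f 0)) = α (f 0) := by rw [hm, α.map_smul, hm1, one_mul]
    have n01 : α ((β 0).1 (f 1)) = α (f 1) := by
      rw [b01, α.map_neg, α.map_smul, absK_star, hm1, one_mul]
    have n10 : α ((β 1).1 (f 0)) = α (f 0) := by
      rw [eigen_snd h ht0 hj0, LinearMap.map_smulₛₗ, α.map_smul_padic, α.map_smul, absK_star, hL1,
        norm_inv, h0, n00]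
      simp
    have n11 : α ((β 1).1 (f 1)) = α (f 1) := by
      rw [eigen_snd h ht0 (L := -L) (by rw [neg_smul]; exact hj1), LinearMap.map_smulₛₗ,
        α.map_smul_padic, α.map_smul, absK_star, absK_neg, hL1, norm_inv, h0, n01]
      simp
    rw [stable_iff_of_splits hα, stable_iff_of_splits hα, n00, n01, n10, n11]
    simp
  have hp1 := one_lt_p (p := p)
  have hp0 := p_pos (p := p)
  -- On weights `(1, p^{-i})` the map `f₀ ↦ f₁ ↦ t₂ f₀` is stable for `0 ≤ i ≤ k`. Division by `p`
  -- shortens this segment by one at either end, so precisely the two ends are primitive.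
  have s2 : ∀ i : ℤ, Stable (lineNorm f i) (β 2) ↔ 0 ≤ i ∧ i ≤ k := fun i => by
    rw [stable_iff_of_splits (lineNorm_splits f i), ← hf1, b21, UNorm.map_smul_padic, h2,
      lineNorm_fst, lineNorm_snd, mul_one, zpow_le_zpow_iff_right₀ hp1,
      ← zpow_zero (p : ℝ), zpow_le_zpow_iff_right₀ hp1]
    omega
  have s2' : ∀ i : ℤ, Stable (lineNorm f i) ((p : ℚ_[p])⁻¹ • β 2) ↔ 1 ≤ i ∧ i + 1 ≤ k := fun i => by
    rw [stable_iff_of_splits (lineNorm_splits f i), coe_smul_apply, coe_smul_apply, ← hf1, b21,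
      UNorm.map_smul_padic, UNorm.map_smul_padic, UNorm.map_smul_padic, h2,
      lineNorm_fst, lineNorm_snd, mul_one, norm_inv, Padic.norm_p, inv_inv,
      ← zpow_one_add₀ hp0.ne', ← zpow_one_add₀ hp0.ne', zpow_le_zpow_iff_right₀ hp1,
      ← zpow_zero (p : ℝ), zpow_le_zpow_iff_right₀ hp1]
    omega
  refine ⟨fun i => Quotient.mk (homothety Δ U) (lineNorm f i), mk_lineNorm_injective f,
    Set.ext fun v => ?_⟩
  constructor
  · intro hv
    obtain ⟨g, rfl⟩ := (isVertex_iff hU v).1 hv.1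
    have hv' := (mem_primitiveVertices_diag hsq hg h0 h1 _).1 hv
    obtain ⟨-, r0, r1, r2, hn⟩ := hv'
    have hs : (basisNorm g).Splits f :=
      splits_of_stable hL1 hj0 hj1 fun x => (r0 _).trans (r1 _)
    obtain ⟨a, ha⟩ := basisNorm_eq_zpow g (f.ne_zero 0)
    obtain ⟨b, hb⟩ := basisNorm_eq_zpow g (f.ne_zero 1)
    have e : Quotient.mk (homothety Δ U) (lineNorm f (a - b)) =
        Quotient.mk (homothety Δ U) (basisNorm g) :=
      (lineNorm_splits f (a - b)).homothety_of_eq hs (zpow_pos hp0 a)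
        (by rw [lineNorm_fst, mul_one, ha])
        (by rw [lineNorm_snd, hb, ← zpow_add₀ hp0.ne']; congr 1; ring)
    have hex := Quotient.exact e
    rw [← stable_congr hex, s2] at r2
    rw [← stable_congr hex, s2'] at hn
    rw [← e]
    have : a - b = 0 ∨ a - b = k := by omega
    rcases this with h3 | h3
    · rw [h3]; exact Or.inl rfl
    · rw [h3]; exact Or.inr rfl
  · have key : ∀ i : ℤ, (i = 0 ∨ i = k) →
        (Quotient.mk (homothety Δ U) (lineNorm f i) : Building Δ U) ∈ primitiveVertices β := by
      intro i hi
      rw [mem_primitiveVertices_diag hsq hg h0 h1]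
      obtain ⟨r0, r1⟩ := hst _ (lineNorm_splits f i)
      refine ⟨lineNorm_isVertex hU f i, r0, r1, (s2 i).2 ?_, ?_⟩
      · omega
      · rw [s2']; omega
    rintro (rfl | rfl)
    · exact key 0 (Or.inl rfl)
    · exact key k (Or.inr rfl)

end DiagonalCount

/-! ### Binary quadratic equations over a finite field. -/

section FiniteField

variable {F : Type*} [Field F] [Fintype F]

theorem card_eq_sum_fiber {X Y : Type*} [Finite X] [Fintype Y] (f : X → Y) :
    Nat.card X = ∑ y, Nat.card {x // f x = y} := by
  rw [← Nat.card_congr (Equiv.sigmaFiberEquiv f), Nat.card_sigma]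

theorem card_mul_eq {k : F} (hk : k ≠ 0) :
    Nat.card {z : F × F // z.1 * z.2 = k} = Fintype.card F - 1 := by
  classical
  rw [← Fintype.card_units, ← Nat.card_eq_fintype_card]
  refine Nat.card_congr
    { toFun := fun z => Units.mk0 z.1.1 fun h => hk (by rw [← z.2, h, zero_mul])
      invFun := fun u => ⟨(u, (u : F)⁻¹ * k), mul_inv_cancel_left₀ u.ne_zero k⟩
      left_inv := fun z => ?_
      right_inv := fun u => ?_ }
  · obtain ⟨⟨a, b⟩, h⟩ := z
    have ha : a ≠ 0 := fun h0 => hk (by rw [← h]; simp [h0])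
    simp only at h
    ext
    · rfl
    · simp [← h, ha]
  · ext; rfl

theorem card_mul_eq_zero :
    Nat.card {z : F × F // z.1 * z.2 = 0} + 1 = 2 * Fintype.card F := by
  classical
  have e : {z : F × F // z.1 * z.2 = 0} ≃ F ⊕ {x : F // x ≠ 0} :=
    { toFun := fun z => if h : z.1.1 = 0 then Sum.inl z.1.2 else Sum.inr ⟨z.1.1, h⟩
      invFun := Sum.elim (fun x => ⟨(0, x), zero_mul x⟩) fun x => ⟨(x, 0), mul_zero _⟩
      left_inv := by
        rintro ⟨⟨a, b⟩, h⟩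
        by_cases ha : a = 0
        · simp [ha]
        · simp only at h
          have : b = 0 := (mul_eq_zero.1 h).resolve_left ha
          simp [ha, this]
      right_inv := by
        rintro (x | ⟨x, hx⟩)
        · simp
        · simp [hx] }
  rw [Nat.card_congr e, Nat.card_sum, Nat.card_eq_fintype_card, Nat.card_eq_fintype_card,
    Fintype.card_subtype_compl, Fintype.card_subtype_eq]
  have := Fintype.card_pos (α := F)
  omega

theorem card_mul_eq_zero_ne :
    Nat.card {z : F × F // z.1 * z.2 = 0 ∧ z ≠ 0} = 2 * (Fintype.card F - 1) := by
  classical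
  have h1 := card_mul_eq_zero (F := F)
  have e : {z : F × F // z.1 * z.2 = 0} ≃ Option {z : F × F // z.1 * z.2 = 0 ∧ z ≠ 0} :=
    { toFun := fun z => if h : z.1 = 0 then none else some ⟨z.1, z.2, h⟩
      invFun := fun o => o.elim ⟨0, mul_zero _⟩ fun z => ⟨z.1, z.2.1⟩
      left_inv := by
        rintro ⟨z, h⟩
        by_cases hz : z = 0
        · simp [hz]
        · simp [hz]
      right_inv := by
        rintro (_ | ⟨z, hz, hz0⟩)
        · simp
        · simp [hz0] }
  rw [Nat.card_congr e, Finite.card_option] at h1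
  omega

theorem sq_sub_eq_zero_iff {d : F} (hd : ¬ IsSquare d) {x y : F} :
    x ^ 2 - d * y ^ 2 = 0 ↔ x = 0 ∧ y = 0 := by
  constructor
  · intro h
    by_cases hy : y = 0
    · subst hy
      simpa using h
    · refine absurd ⟨x / y, ?_⟩ hd
      field_simp
      linear_combination -h
  · rintro ⟨rfl, rfl⟩; ring

theorem exists_sq_sub_eq (h2 : (2 : F) ≠ 0) {d : F} (hd : d ≠ 0) (k : F) :
    ∃ x y : F, x ^ 2 - d * y ^ 2 = k := by
  obtain ⟨a, b, hab⟩ := FiniteField.exists_root_sum_quadratic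
    (f := (Polynomial.X ^ 2 : Polynomial F))
    (g := Polynomial.C (-d) * Polynomial.X ^ 2 + Polynomial.C 0 * Polynomial.X + Polynomial.C (-k))
    (Polynomial.degree_X_pow 2) (Polynomial.degree_quadratic (neg_ne_zero.2 hd)) (by
      refine (FiniteField.odd_card_of_char_ne_two fun h => h2 ?_)
      have := ringChar.Nat.cast_ringChar (R := F)
      rw [h] at this
      exact_mod_cast this)
  refine ⟨a, b, ?_⟩
  simp at hab
  linear_combination hab

theorem card_sq_sub_eq_zero {d : F} (hd : ¬ IsSquare d) :
    Nat.card {z : F × F // z.1 ^ 2 - d * z.2 ^ 2 = 0} = 1 := by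
  rw [Nat.card_eq_one_iff_unique]
  refine ⟨⟨fun a b => ?_⟩, ⟨⟨0, by simp⟩⟩⟩
  obtain ⟨⟨a1, a2⟩, ha⟩ := a
  obtain ⟨⟨b1, b2⟩, hb⟩ := b
  simp only [sq_sub_eq_zero_iff hd] at ha hb
  simp [ha.1, ha.2, hb.1, hb.2]

/-- Multiplication by an element of norm `l` in `F(√d)` identifies the elements of norm `1` with
those of norm `l`. So the `q² - 1` nonzero pairs are equally distributed over the `q - 1` nonzero
values. -/
theorem card_sq_sub_eq (h2 : (2 : F) ≠ 0) {d : F} (hd : ¬ IsSquare d) {k : F} (hk : k ≠ 0) :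
    Nat.card {z : F × F // z.1 ^ 2 - d * z.2 ^ 2 = k} = Fintype.card F + 1 := by
  classical
  have hd0 : d ≠ 0 := by rintro rfl; exact hd (IsSquare.zero)
  have key : ∀ l : F, l ≠ 0 → Nat.card {z : F × F // z.1 ^ 2 - d * z.2 ^ 2 = l} =
      Nat.card {z : F × F // z.1 ^ 2 - d * z.2 ^ 2 = 1} := fun l hl => by
    obtain ⟨x, y, hxy⟩ := exists_sq_sub_eq h2 hd0 l
    refine Nat.card_congr
      { toFun := fun z => ⟨((x * z.1.1 - d * y * z.1.2) / l, (x * z.1.2 - y * z.1.1) / l), ?_⟩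
        invFun := fun z => ⟨(x * z.1.1 + d * y * z.1.2, x * z.1.2 + y * z.1.1), ?_⟩
        left_inv := fun z => ?_
        right_inv := fun z => ?_ }
    · obtain ⟨⟨a, b⟩, h⟩ := z
      simp only at h ⊢
      field_simp
      linear_combination l * hxy + (x ^ 2 - d * y ^ 2) * h
    · obtain ⟨⟨a, b⟩, h⟩ := z
      simp only at h ⊢
      linear_combination hxy + (x ^ 2 - d * y ^ 2) * h
    · obtain ⟨⟨a, b⟩, h⟩ := z
      ext
      · simp only
        field_simp
        linear_combination a * hxy
      · simp only
        field_simp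
        linear_combination b * hxy
    · obtain ⟨⟨a, b⟩, h⟩ := z
      ext
      · simp only
        field_simp
        linear_combination a * hxy
      · simp only
        field_simp
        linear_combination b * hxy
  have hsum := card_eq_sum_fiber fun z : F × F => z.1 ^ 2 - d * z.2 ^ 2
  rw [← Finset.add_sum_erase _ _ (Finset.mem_univ 0), card_sq_sub_eq_zero hd,
    Finset.sum_congr rfl fun l hl => key l (Finset.ne_of_mem_erase hl), Finset.sum_const,
    Finset.card_erase_of_mem (Finset.mem_univ _), Finset.card_univ, Nat.card_prod,
    Nat.card_eq_fintype_card, smul_eq_mul] at hsum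
  rw [key k hk]
  have hq : 1 < Fintype.card F := Fintype.one_lt_card
  obtain ⟨m, hm⟩ : ∃ m, Fintype.card F = m + 2 := ⟨_, (Nat.sub_add_cancel hq).symm⟩
  rw [hm] at hsum ⊢
  have h3 : m + 2 - 1 = m + 1 := rfl
  rw [h3] at hsum
  have : (m + 1) * Nat.card {z : F × F // z.1 ^ 2 - d * z.2 ^ 2 = 1} = (m + 1) * (m + 3) := by
    linarith
  exact Nat.eq_of_mul_eq_mul_left (Nat.succ_pos m) this

end FiniteField

/-! ### Reflections and transitivity on vectors of given norm. -/

section Isometry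

variable {F : Type*} [Field F]

/-- The bilinear form with matrix `modelMatrix d`. -/
def modelBil (d : F) : LinearMap.BilinForm F (Fin 4 → F) := Matrix.toBilin' (modelMatrix d)

theorem modelBil_apply (d : F) (v w : Fin 4 → F) :
    modelBil d v w = v 0 * w 0 - d * v 1 * w 1 + v 2 * w 3 + v 3 * w 2 := by
  rw [modelBil, Matrix.toBilin'_apply']
  simp [modelMatrix, dotProduct, Matrix.mulVec, Fin.sum_univ_four]
  ring

theorem modelBil_comm (d : F) (v w : Fin 4 → F) : modelBil d v w = modelBil d w v := by
  rw [modelBil_apply, modelBil_apply]; ring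

/-- The reflection in an anisotropic vector `r`. -/
theorem exists_reflection {V : Type*} [AddCommGroup V] [Module F V] {b : LinearMap.BilinForm F V}
    (hb : ∀ v w, b v w = b w v) {r : V} (hr : b r r ≠ 0) :
    ∃ g : V ≃ V, (∀ x, g x = x - (2 * b x r / b r r) • r) ∧ ∀ x y, b (g x) (g y) = b x y := by
  let τ : V → V := fun x => x - (2 * b x r / b r r) • r
  have hτr : ∀ x, b (τ x) r = - b x r := fun x => by
    simp only [τ, map_sub, LinearMap.sub_apply, map_smul, LinearMap.smul_apply, smul_eq_mul]
    field_simp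
    ring
  have hinv : Function.Involutive τ := fun x => by
    have : τ (τ x) = τ x - (2 * b (τ x) r / b r r) • r := rfl
    rw [this, hτr]
    simp only [τ]
    module
  refine ⟨hinv.toPerm, fun x => rfl, fun x y => ?_⟩
  change b (τ x) (τ y) = b x y
  simp only [τ, map_sub, LinearMap.sub_apply, map_smul, LinearMap.smul_apply, smul_eq_mul]
  rw [hb r y]
  field_simp
  ring

/-- Vectors of the same nonzero norm are exchanged, up to sign, by an isometry which fixes all
vectors orthogonal to both. -/
theorem exists_isometry {V : Type*} [AddCommGroup V] [Module F V] {b : LinearMap.BilinForm F V}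
    (h2 : (2 : F) ≠ 0)
    (hb : ∀ v w, b v w = b w v) {v w : V} (hvw : b v v = b w w) (hv : b v v ≠ 0) :
    ∃ g : V ≃ V, (∀ x y, b (g x) (g y) = b x y) ∧ (∀ x, b (g x) w = 0 ↔ b x v = 0) ∧
      g 0 = 0 ∧ ∀ x, b x v = 0 → b x w = 0 → g x = x := by
  have hgen : ∀ r : V, b r r ≠ 0 → ∀ g : V ≃ V, (∀ x, g x = x - (2 * b x r / b r r) • r) →
      (b v r = b v v - b v w ∧ b r r = 2 * (b v v - b v w) ∧ r = v - w ∨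
        b v r = b v v + b v w ∧ b r r = 2 * (b v v + b v w) ∧ r = v + w) →
      (∀ x y, b (g x) (g y) = b x y) →
      ∃ g : V ≃ V, (∀ x y, b (g x) (g y) = b x y) ∧ (∀ x, b (g x) w = 0 ↔ b x v = 0) ∧
      g 0 = 0 ∧ ∀ x, b x v = 0 → b x w = 0 → g x = x := by
    intro r hr g hg hcase hiso
    have hgv : g v = w ∨ g v = -w := by
      rcases hcase with ⟨h1, h3, h4⟩ | ⟨h1, h3, h4⟩
      · left
        have : 2 * b v r / b r r = 1 := by rw [h1, ← h3, div_self hr]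
        rw [hg, this, h4]; module
      · right
        have : 2 * b v r / b r r = 1 := by rw [h1, ← h3, div_self hr]
        rw [hg, this, h4]; module
    refine ⟨g, hiso, fun x => ?_, by rw [hg]; simp, fun x hxv hxw => ?_⟩
    · rw [← hiso x v]
      rcases hgv with h | h
      · rw [h]
      · rw [h, map_neg, neg_eq_zero]
    · have : b x r = 0 := by
        rcases hcase with ⟨_, _, h4⟩ | ⟨_, _, h4⟩
        · rw [h4, map_sub, hxv, hxw, sub_zero]
        · rw [h4, map_add, hxv, hxw, add_zero]
      rw [hg, this]; simp
  have e1 : b (v - w) (v - w) = 2 * (b v v - b v w) := by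
    simp only [map_sub, LinearMap.sub_apply]
    rw [hb w v, ← hvw]; ring
  have e2 : b (v + w) (v + w) = 2 * (b v v + b v w) := by
    simp only [map_add, LinearMap.add_apply]
    rw [hb w v, ← hvw]; ring
  -- The norms of `v - w` and `v + w` add up to `4 b(v,v) ≠ 0`, so at least one of the two vectors
  -- is anisotropic. Its reflection sends `v` to `w` or to `-w`.
  by_cases h : b (v - w) (v - w) = 0
  · have h' : b (v + w) (v + w) ≠ 0 := by
      intro h'
      rw [e1] at h
      rw [e2] at h'
      have : (2 * 2) * b v v = 0 := by linear_combination h + h'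
      exact hv ((mul_eq_zero.1 this).resolve_left (mul_ne_zero h2 h2))
    obtain ⟨g, hg, hiso⟩ := exists_reflection hb h'
    exact hgen _ h' g hg (Or.inr ⟨by rw [map_add], e2, rfl⟩) hiso
  · obtain ⟨g, hg, hiso⟩ := exists_reflection hb h
    exact hgen _ h g hg (Or.inl ⟨by rw [map_sub], e1, rfl⟩) hiso

end Isometry

/-! ### Counts of orthogonal vectors in the model form. -/

section TripleCount

variable {F : Type*} [Field F] [Fintype F]

/-- Primitive representations: the matrices `X` with a left inverse and `ᵗX S X = T`. -/
def PrimRep {R : Type*} [CommRing R] {m n : ℕ} (S : Matrix (Fin m) (Fin m) R)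
    (T : Matrix (Fin n) (Fin n) R) : Type _ :=
  {X : Matrix (Fin m) (Fin n) R // (∃ C : Matrix (Fin n) (Fin m) R, C * X = 1) ∧ Xᵀ * S * X = T}

theorem transpose_mul_modelMatrix_mul (d : F) {n : ℕ} (X : Matrix (Fin 4) (Fin n) F) (i j : Fin n) :
    (Xᵀ * modelMatrix d * X) i j = modelBil d (fun k => X k i) (fun k => X k j) := by
  rw [modelBil, Matrix.toBilin'_apply', Matrix.mul_assoc]
  rfl

/-- Fibre over the hyperbolic coordinates: the remaining value of the norm form of `F(√d)` is
attained once if it is `0`, which happens for `q - 1` pairs, and `q + 1` times otherwise. -/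
theorem card_norm_eq (h2 : (2 : F) ≠ 0) {d : F} (hd : ¬ IsSquare d) {u : F} (hu : u ≠ 0) :
    Nat.card {v : Fin 4 → F // modelBil d v v = u} = Fintype.card F ^ 3 + Fintype.card F := by
  classical
  have e : {v : Fin 4 → F // modelBil d v v = u} ≃
      Σ y : F × F, {z : F × F // z.1 ^ 2 - d * z.2 ^ 2 = u - y.1 * y.2} :=
    { toFun := fun v => ⟨(2 * v.1 2, v.1 3), ⟨(v.1 0, v.1 1), by
        have := v.2
        rw [modelBil_apply] at this
        simp only
        linear_combination this⟩⟩
      invFun := fun s => ⟨![s.2.1.1, s.2.1.2, s.1.1 / 2, s.1.2], by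
        have := s.2.2
        rw [modelBil_apply]
        simp
        field_simp
        linear_combination 2 * this⟩
      left_inv := fun v => by
        ext i
        fin_cases i
        · rfl
        · rfl
        · simp [h2]
        · rfl
      right_inv := fun s => by
        obtain ⟨⟨a, b⟩, ⟨c, e⟩, hs⟩ := s
        have h1 : 2 * (a / 2) = a := mul_div_cancel₀ a h2
        simp only [Matrix.cons_val]
        congr 1
        · rw [h1]
        · congr 1
          · rw [h1]
          · exact proof_irrel_heq _ _ }
  rw [Nat.card_congr e, Nat.card_sigma]
  have hc : ∀ y : F × F, Nat.card {z : F × F // z.1 ^ 2 - d * z.2 ^ 2 = u - y.1 * y.2} =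
      if y.1 * y.2 = u then 1 else Fintype.card F + 1 := fun y => by
    split_ifs with h
    · rw [h, sub_self]; exact card_sq_sub_eq_zero hd
    · exact card_sq_sub_eq h2 hd (sub_ne_zero.2 (Ne.symm h))
  rw [Finset.sum_congr rfl fun y _ => hc y, Finset.sum_ite, Finset.sum_const, Finset.sum_const,
    Finset.filter_not, Finset.card_sdiff_of_subset (Finset.filter_subset _ _), Finset.card_univ,
    Fintype.card_prod]
  have h3 := card_mul_eq hu
  rw [Nat.card_eq_fintype_card, Fintype.card_subtype] at h3
  rw [h3]
  obtain ⟨m, hm⟩ : ∃ m, Fintype.card F = m + 1 :=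
    ⟨_, (Nat.sub_add_cancel (Fintype.card_pos (α := F))).symm⟩
  rw [hm]
  have h4 : (m + 1) * (m + 1) - (m + 1 - 1) = m * m + m + 1 := by
    have : (m + 1) * (m + 1) = m * m + m + 1 + m := by ring
    rw [this]; simp
  rw [h4]
  simp only [smul_eq_mul, Nat.add_sub_cancel]
  ring

/-- Coordinates on the orthogonal complement of `(x, y, 0, 0)`. -/
theorem orthogonal_std {d x y u : F} (hxy : x ^ 2 - d * y ^ 2 = u) (hu : u ≠ 0) (w : Fin 4 → F) :
    modelBil d ![x, y, 0, 0] w = 0 ↔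
      w 0 = d * y * ((x * w 1 - y * w 0) / u) ∧ w 1 = x * ((x * w 1 - y * w 0) / u) := by
  rw [modelBil_apply]
  simp only [Matrix.cons_val]
  constructor
  · intro h
    constructor
    · field_simp; rw [← hxy]; linear_combination x * h
    · field_simp; rw [← hxy]; linear_combination y * h
  · rintro ⟨h0, h1⟩
    generalize (x * w 1 - y * w 0) / u = s at h0 h1
    rw [h0, h1]; ring

theorem card_sq_eq [DecidableEq F] (h2 : (2 : F) ≠ 0) {a : F} (ha : a ≠ 0) :
    Nat.card {s : F // s ^ 2 = a} = if IsSquare a then 2 else 0 := by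
  classical
  split_ifs with h
  · obtain ⟨r, rfl⟩ := h
    have hr : r ≠ 0 := by rintro rfl; simp at ha
    have : {s : F // s ^ 2 = r * r} ≃ ({r, -r} : Finset F) :=
      Equiv.subtypeEquivRight fun s => by
        rw [Finset.mem_insert, Finset.mem_singleton, sq, mul_self_eq_mul_self_iff]
    rw [Nat.card_congr this, Nat.card_eq_fintype_card, Fintype.card_coe, Finset.card_pair]
    intro h
    have : 2 * r = 0 := by linear_combination h
    exact hr ((mul_eq_zero.1 this).resolve_left h2)
  · rw [Nat.card_eq_zero]
    left
    exact ⟨fun s => h ⟨s.1, by have := s.2; rw [sq] at this; exact this.symm⟩⟩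

/-- The complement of `(x,y,0,0)` is the line of `(dy,x,0,0)`, of norm `-du`, plus a hyperbolic
plane. The count fibres over the coordinate `s` on that line. -/
theorem card_second [DecidableEq F] (h2 : (2 : F) ≠ 0) {d : F} (hd : ¬ IsSquare d) {x y u u' : F}
    (hxy : x ^ 2 - d * y ^ 2 = u) (hu : u ≠ 0) (hu' : u' ≠ 0) :
    Nat.card {w : Fin 4 → F // modelBil d ![x, y, 0, 0] w = 0 ∧ modelBil d w w = u'} =
      Fintype.card F * (Fintype.card F - 1) +
        Fintype.card F * if IsSquare (-(u * u' * d)) then 2 else 0 := by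
  classical
  have hd0 : d ≠ 0 := by rintro rfl; exact hd IsSquare.zero
  have e : {w : Fin 4 → F // modelBil d ![x, y, 0, 0] w = 0 ∧ modelBil d w w = u'} ≃
      Σ s : F, {z : F × F // z.1 * z.2 = u' + d * u * s ^ 2} :=
    { toFun := fun w => ⟨(x * w.1 1 - y * w.1 0) / u, ⟨(2 * w.1 2, w.1 3), by
        obtain ⟨h0, h1⟩ := (orthogonal_std hxy hu w.1).1 w.2.1
        have := w.2.2
        rw [modelBil_apply] at this
        set s := (x * w.1 1 - y * w.1 0) / u
        simp only
        linear_combination this - (w.1 0 + d * y * s) * h0 + d * (w.1 1 + x * s) * h1 +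
          d * s ^ 2 * hxy⟩⟩
      invFun := fun s => ⟨![d * y * s.1, x * s.1, s.2.1.1 / 2, s.2.1.2], by
        rw [modelBil_apply]
        simp
        ring, by
        have := s.2.2
        rw [modelBil_apply]
        simp
        field_simp
        linear_combination 2 * this - 2 * d * s.1 ^ 2 * hxy⟩
      left_inv := fun w => by
        obtain ⟨h0, h1⟩ := (orthogonal_std hxy hu w.1).1 w.2.1
        ext i
        fin_cases i
        · exact h0.symm
        · exact h1.symm
        · simp [h2]
        · rfl
      right_inv := fun s => by
        obtain ⟨s, ⟨c, e⟩, hs⟩ := s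
        have h1 : 2 * (c / 2) = c := mul_div_cancel₀ c h2
        have h3 : (x * (x * s) - y * (d * y * s)) / u = s := by
          rw [div_eq_iff hu, ← hxy]; ring
        simp only [Matrix.cons_val]
        congr 1
        congr 1
        · rw [h3]
        · rw [h1]
        · exact proof_irrel_heq _ _ }
  rw [Nat.card_congr e, Nat.card_sigma]
  have hc : ∀ s : F, Nat.card {z : F × F // z.1 * z.2 = u' + d * u * s ^ 2} =
      (Fintype.card F - 1) + if s ^ 2 = -u' / (d * u) then Fintype.card F else 0 := fun s => by
    have hiff : s ^ 2 = -u' / (d * u) ↔ u' + d * u * s ^ 2 = 0 := by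
      rw [eq_div_iff (mul_ne_zero hd0 hu)]
      constructor <;> intro h <;> linear_combination h
    split_ifs with h
    · rw [hiff.1 h]
      have := card_mul_eq_zero (F := F)
      omega
    · rw [add_zero]
      exact card_mul_eq fun h' => h (hiff.2 h')
  rw [Finset.sum_congr rfl fun y _ => hc y, Finset.sum_add_distrib, Finset.sum_const,
    ← Finset.sum_filter, Finset.sum_const, Finset.card_univ]
  have h3 := card_sq_eq h2 (a := -u' / (d * u))
    (div_ne_zero (neg_ne_zero.2 hu') (mul_ne_zero hd0 hu))
  rw [Nat.card_eq_fintype_card, Fintype.card_subtype] at h3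
  rw [h3, smul_eq_mul, smul_eq_mul, mul_comm (ite _ _ _)]
  have hsq : IsSquare (-u' / (d * u)) ↔ IsSquare (-(u * u' * d)) := by
    have : -(u * u' * d) = -u' / (d * u) * (d * u) ^ 2 := by field_simp
    rw [this]
    constructor
    · intro h; exact h.mul (IsSquare.sq _)
    · intro h
      have h4 := h.div (IsSquare.sq (d * u))
      rwa [mul_div_cancel_right₀ _ (pow_ne_zero 2 (mul_ne_zero hd0 hu))] at h4
  simp only [hsq]

/-- Inside the hyperbolic plane the complement of `(1, u'/2)` is spanned by `(1, -u'/2)`, of norm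
`-u'`. Together with the line of norm `-du` this leaves a binary form. -/
theorem card_third_equiv (h2 : (2 : F) ≠ 0) {d : F} {x y u u' c : F}
    (hxy : x ^ 2 - d * y ^ 2 = u) (hu : u ≠ 0) :
    Nat.card {z : Fin 4 → F // z ≠ 0 ∧ modelBil d ![x, y, 0, 0] z = 0 ∧
      modelBil d ![0, 0, 1, u' / 2] z = 0 ∧ modelBil d z z = c} =
    Nat.card {s : F × F // s ≠ 0 ∧ -(d * u) * s.1 ^ 2 - u' * s.2 ^ 2 = c} := by
  refine Nat.card_congr
    { toFun := fun w => ⟨((x * w.1 1 - y * w.1 0) / u, w.1 2), ?_⟩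
      invFun := fun s => ⟨![d * y * s.1.1, x * s.1.1, s.1.2, -(u' / 2) * s.1.2], ?_, ?_, ?_, ?_⟩
      left_inv := fun w => ?_
      right_inv := fun s => ?_ }
  · obtain ⟨w, hw, hw1, hw2, hw3⟩ := w
    obtain ⟨h0, h1⟩ := (orthogonal_std hxy hu w).1 hw1
    rw [modelBil_apply] at hw2 hw3
    simp only [Matrix.cons_val] at hw2
    simp only
    set s := (x * w 1 - y * w 0) / u with hs
    have h3 : w 3 = -(u' / 2) * w 2 := by linear_combination hw2
    refine ⟨fun h => hw ?_, ?_⟩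
    · rw [Prod.mk_eq_zero] at h
      funext i
      fin_cases i
      · simp [h0, h.1]
      · simp [h1, h.1]
      · exact h.2
      · simp [h3, h.2]
    · rw [← hw3, h0, h1, h3, ← hxy]; field_simp; ring
  · obtain ⟨⟨s, b⟩, hs, hs1⟩ := s
    intro h
    apply hs
    have hb : b = 0 := congrFun h 2
    have h0 : d * y * s = 0 := congrFun h 0
    have h1 : x * s = 0 := congrFun h 1
    have : u * s = 0 := by rw [← hxy]; linear_combination x * h1 - y * h0
    rw [Prod.mk_eq_zero]
    exact ⟨(mul_eq_zero.1 this).resolve_left hu, hb⟩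
  · rw [modelBil_apply]; simp; ring
  · rw [modelBil_apply]; simp
  · obtain ⟨⟨s, b⟩, hs, hs1⟩ := s
    rw [modelBil_apply]
    simp only [Matrix.cons_val] at hs1 ⊢
    rw [← hs1, ← hxy]; field_simp; ring
  · obtain ⟨w, hw, hw1, hw2, hw3⟩ := w
    obtain ⟨h0, h1⟩ := (orthogonal_std hxy hu w).1 hw1
    rw [modelBil_apply] at hw2
    simp only [Matrix.cons_val] at hw2
    have h3 : w 3 = -(u' / 2) * w 2 := by linear_combination hw2
    ext i
    fin_cases i
    · exact h0.symm
    · exact h1.symm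
    · rfl
    · exact h3.symm
  · obtain ⟨⟨s, b⟩, hs, hs1⟩ := s
    have h3 : (x * (x * s) - y * (d * y * s)) / u = s := by
      rw [div_eq_iff hu, ← hxy]; ring
    ext
    · exact h3
    · rfl

/-- Multiplied by `-u'` the form becomes `(u'b)² - (es)²` with `e² = -uu'd`, which factors. -/
theorem card_binary_of_isSquare (h2 : (2 : F) ≠ 0) {d u u' c : F} (hd : d ≠ 0) (hu : u ≠ 0)
    (hu' : u' ≠ 0) (hs : IsSquare (-(u * u' * d))) :
    Nat.card {s : F × F // s ≠ 0 ∧ -(d * u) * s.1 ^ 2 - u' * s.2 ^ 2 = c} =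
      Nat.card {z : F × F // z.1 * z.2 = -c * u' ∧ z ≠ 0} := by
  obtain ⟨e, he⟩ := hs
  have he0 : e ≠ 0 := by
    rintro rfl
    have : u * u' * d = 0 := by linear_combination -he
    simp [hd, hu, hu'] at this
  refine Nat.card_congr
    { toFun := fun s => ⟨(u' * s.1.2 - e * s.1.1, u' * s.1.2 + e * s.1.1), ?_, ?_⟩
      invFun := fun z => ⟨((z.1.2 - z.1.1) / (2 * e), (z.1.1 + z.1.2) / (2 * u')), ?_, ?_⟩
      left_inv := fun s => ?_
      right_inv := fun z => ?_ }
  · obtain ⟨⟨a, b⟩, hs, hs1⟩ := s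
    simp only at hs1 ⊢
    rw [← hs1]
    linear_combination a ^ 2 * he
  · obtain ⟨⟨a, b⟩, hs, hs1⟩ := s
    intro h
    apply hs
    rw [Prod.mk_eq_zero] at h ⊢
    have ha : (2 * e) * a = 0 := by linear_combination h.2 - h.1
    have hb : (2 * u') * b = 0 := by linear_combination h.2 + h.1
    exact ⟨(mul_eq_zero.1 ha).resolve_left (mul_ne_zero h2 he0),
      (mul_eq_zero.1 hb).resolve_left (mul_ne_zero h2 hu')⟩
  · obtain ⟨⟨a, b⟩, hz, hz0⟩ := z
    intro h
    apply hz0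
    rw [Prod.mk_eq_zero] at h ⊢
    have h3 : b - a = 0 := (div_eq_zero_iff.1 h.1).resolve_right (mul_ne_zero h2 he0)
    have h4 : a + b = 0 := (div_eq_zero_iff.1 h.2).resolve_right (mul_ne_zero h2 hu')
    have ha : 2 * a = 0 := by linear_combination h4 - h3
    have hb : 2 * b = 0 := by linear_combination h4 + h3
    exact ⟨(mul_eq_zero.1 ha).resolve_left h2, (mul_eq_zero.1 hb).resolve_left h2⟩
  · obtain ⟨⟨a, b⟩, hz, hz0⟩ := z
    simp only at hz ⊢
    have hdu : -(d * u) = e * e / u' := by field_simp; linear_combination he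
    rw [hdu]
    field_simp
    linear_combination (-4 : F) * hz
  · obtain ⟨⟨a, b⟩, hs, hs1⟩ := s
    ext
    · simp only; field_simp; ring
    · simp only; field_simp; ring
  · obtain ⟨⟨a, b⟩, hs, hs1⟩ := z
    ext
    · simp only; field_simp; ring
    · simp only; field_simp; ring

/-- Multiplication by `-u'` gives the form `X² - (-uu'd)Y²`, which is anisotropic when `-uu'd` is
not a square. -/
theorem card_binary_of_not_isSquare {d u u' c : F} (hu' : u' ≠ 0) :
    Nat.card {s : F × F // s ≠ 0 ∧ -(d * u) * s.1 ^ 2 - u' * s.2 ^ 2 = c} =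
      Nat.card {z : F × F // z.1 ^ 2 - (-(u * u' * d)) * z.2 ^ 2 = -c * u' ∧ z ≠ 0} := by
  refine Nat.card_congr
    { toFun := fun s => ⟨(u' * s.1.2, s.1.1), ?_, ?_⟩
      invFun := fun z => ⟨(z.1.2, z.1.1 / u'), ?_, ?_⟩
      left_inv := fun s => ?_
      right_inv := fun z => ?_ }
  · obtain ⟨⟨a, b⟩, hs, hs1⟩ := s
    simp only at hs1 ⊢
    rw [← hs1]; ring
  · obtain ⟨⟨a, b⟩, hs, hs1⟩ := s
    intro h
    apply hs
    rw [Prod.mk_eq_zero] at h ⊢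
    exact ⟨h.2, (mul_eq_zero.1 h.1).resolve_left hu'⟩
  · obtain ⟨⟨a, b⟩, hz, hz0⟩ := z
    intro h
    apply hz0
    rw [Prod.mk_eq_zero] at h ⊢
    exact ⟨(div_eq_zero_iff.1 h.2).resolve_right hu', h.1⟩
  · obtain ⟨⟨a, b⟩, hz, hz0⟩ := z
    simp only at hz ⊢
    field_simp
    have : u' * (d * u * b ^ 2 * u' + a ^ 2 + c * u') = 0 := by linear_combination u' * hz
    linear_combination -((mul_eq_zero.1 this).resolve_left hu')
  · obtain ⟨⟨a, b⟩, hs, hs1⟩ := s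
    ext
    · rfl
    · simp only; field_simp
  · obtain ⟨⟨a, b⟩, hs, hs1⟩ := z
    ext
    · simp only; field_simp
    · rfl

end TripleCount

/-! ### Primitive representations over a finite field. -/

section TripleCountMain

variable {F : Type*} [Field F] [Fintype F]

theorem exists_left_inverse_iff {m n : ℕ} (X : Matrix (Fin m) (Fin n) F) :
    (∃ C : Matrix (Fin n) (Fin m) F, C * X = 1) ↔ ∀ v, X *ᵥ v = 0 → v = 0 := by
  constructor
  · rintro ⟨C, hC⟩ v hv
    rw [← Matrix.one_mulVec v, ← hC, ← Matrix.mulVec_mulVec, hv, Matrix.mulVec_zero]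
  · intro h
    have hker : LinearMap.ker (Matrix.toLin' X) = ⊥ := by
      rw [LinearMap.ker_eq_bot']
      intro v hv
      exact h v (by simpa using hv)
    obtain ⟨g, hg⟩ := LinearMap.exists_leftInverse_of_injective _ hker
    refine ⟨LinearMap.toMatrix' g, ?_⟩
    rw [← LinearMap.toMatrix'_toLin' X, ← LinearMap.toMatrix'_comp, hg, LinearMap.toMatrix'_id]

/-- The third components of the primitive representations of `diag(u, u', c)`. -/
def ThirdSet (d c : F) (v w : Fin 4 → F) : Type _ :=
  {z : Fin 4 → F // z ≠ 0 ∧ modelBil d v z = 0 ∧ modelBil d w z = 0 ∧ modelBil d z z = c}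

instance (d c : F) (v w : Fin 4 → F) : Finite (ThirdSet d c v w) :=
  inferInstanceAs (Finite {_z : Fin 4 → F // _})

/-- The second components. -/
def SecondSet (d u' : F) (v : Fin 4 → F) : Type _ :=
  {w : Fin 4 → F // modelBil d v w = 0 ∧ modelBil d w w = u'}

instance (d u' : F) (v : Fin 4 → F) : Finite (SecondSet d u' v) :=
  inferInstanceAs (Finite {_z : Fin 4 → F // _})

theorem mulVec_three (X : Matrix (Fin 4) (Fin 3) F) (a : Fin 3 → F) :
    X *ᵥ a = a 0 • (fun k => X k 0) + a 1 • (fun k => X k 1) + a 2 • fun k => X k 2 := by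
  funext k
  simp [Matrix.mulVec, dotProduct, Fin.sum_univ_three]
  ring

/-- A primitive representation of a diagonal matrix is a triple of orthogonal vectors. -/
def primRepEquiv (d : F) {u u' c : F} (hu : u ≠ 0) (hu' : u' ≠ 0) :
    PrimRep (modelMatrix d) (Matrix.diagonal ![u, u', c]) ≃
      Σ v : {v : Fin 4 → F // modelBil d v v = u}, Σ w : SecondSet d u' v.1,
        ThirdSet d c v.1 w.1 where
  toFun X := by
    have hX : ∀ i j, modelBil d (fun k => X.1 k i) (fun k => X.1 k j) =
        Matrix.diagonal ![u, u', c] i j := fun i j => by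
      rw [← transpose_mul_modelMatrix_mul, X.2.2]
    refine ⟨⟨fun k => X.1 k 0, hX 0 0⟩, ⟨fun k => X.1 k 1, hX 0 1, hX 1 1⟩,
      ⟨fun k => X.1 k 2, ?_, hX 0 2, hX 1 2, hX 2 2⟩⟩
    intro h
    have h1 := (exists_left_inverse_iff _).1 X.2.1 (Pi.single 2 1) (by
      rw [mulVec_three, h]; simp)
    exact one_ne_zero (α := F) (by simpa using congrFun h1 2)
  invFun s := by
    refine ⟨Matrix.of fun k => ![s.1.1 k, s.2.1.1 k, s.2.2.1 k], ?_, ?_⟩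
    · rw [exists_left_inverse_iff]
      intro a ha
      rw [mulVec_three] at ha
      have ha' : a 0 • s.1.1 + a 1 • s.2.1.1 + a 2 • s.2.2.1 = 0 := ha
      obtain ⟨⟨v, hv⟩, ⟨w, hvw, hw⟩, ⟨z, hz, hvz, hwz, hzz⟩⟩ := s
      simp only at ha' hvw hvz hwz
      have e0 := congrArg (modelBil d v) ha'
      have e1 := congrArg (modelBil d w) ha'
      have hwv : modelBil d w v = 0 := by rw [modelBil_comm, hvw]
      simp only [map_add, map_smul, smul_eq_mul, hv, hvw, hvz, mul_zero, add_zero, map_zero] at e0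
      simp only [map_add, map_smul, smul_eq_mul, hw, hwv, hwz, mul_zero, add_zero, map_zero,
        zero_add] at e1
      have a0 : a 0 = 0 := (mul_eq_zero.1 e0).resolve_right hu
      have a1 : a 1 = 0 := (mul_eq_zero.1 e1).resolve_right hu'
      rw [a0, a1, zero_smul, zero_smul, zero_add, zero_add] at ha'
      have a2 : a 2 = 0 := (smul_eq_zero.1 ha').resolve_right hz
      funext i
      fin_cases i
      · exact a0
      · exact a1
      · exact a2
    · obtain ⟨⟨v, hv⟩, ⟨w, hvw, hw⟩, ⟨z, hz, hvz, hwz, hzz⟩⟩ := s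
      simp only at hvw hvz hwz
      ext i j
      rw [transpose_mul_modelMatrix_mul]
      fin_cases i <;> fin_cases j
      · exact hv
      · exact hvw
      · exact hvz
      · exact (modelBil_comm d w v).trans hvw
      · exact hw
      · exact hwz
      · exact (modelBil_comm d z v).trans hvz
      · exact (modelBil_comm d z w).trans hwz
      · exact hzz
  left_inv X := by
    refine Subtype.ext (Matrix.ext fun k j => ?_)
    fin_cases j <;> rfl
  right_inv s := rfl

/-- An isometry taking `v` to `±v'` carries the remaining components along, so the count may be made
for `v = (x,y,0,0)`. -/
theorem card_second_third_congr (h2 : (2 : F) ≠ 0) (d : F) {u u' c : F} (hu : u ≠ 0)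
    {v v' : Fin 4 → F} (hv : modelBil d v v = u) (hv' : modelBil d v' v' = u) :
    Nat.card (Σ w : SecondSet d u' v, ThirdSet d c v w.1) =
      Nat.card (Σ w : SecondSet d u' v', ThirdSet d c v' w.1) := by
  obtain ⟨g, hg, hgv, hg0, -⟩ := exists_isometry h2 (modelBil_comm d) (hv.trans hv'.symm)
    (by rwa [hv])
  have hgv' : ∀ x, modelBil d v x = 0 ↔ modelBil d v' (g x) = 0 := fun x => by
    rw [modelBil_comm d v', hgv, modelBil_comm]
  refine Nat.card_congr (Equiv.sigmaCongr (Equiv.subtypeEquiv g fun w => ?_) fun w =>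
    Equiv.subtypeEquiv g fun z => ?_)
  · rw [← hgv', hg]
  · have : z ≠ 0 ↔ g z ≠ 0 := by rw [Ne, Ne, ← hg0, g.injective.eq_iff, hg0]
    rw [this, ← hgv', hg]
    change _ ↔ g z ≠ 0 ∧ _ ∧ modelBil d (g w.1) (g z) = 0 ∧ _
    rw [hg]

/-- The isometry taking `w` to `±w'` fixes `v`, which is orthogonal to both; so `w` can be
normalized without moving `v`. -/
theorem card_third_congr (h2 : (2 : F) ≠ 0) (d : F) {u' c : F} (hu' : u' ≠ 0)
    {v w w' : Fin 4 → F} (hw : modelBil d w w = u') (hw' : modelBil d w' w' = u')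
    (hvw : modelBil d v w = 0) (hvw' : modelBil d v w' = 0) :
    Nat.card (ThirdSet d c v w) = Nat.card (ThirdSet d c v w') := by
  obtain ⟨g, hg, hgv, hg0, hgf⟩ := exists_isometry h2 (modelBil_comm d) (hw.trans hw'.symm)
    (by rwa [hw])
  have hgw : ∀ x, modelBil d w x = 0 ↔ modelBil d w' (g x) = 0 := fun x => by
    rw [modelBil_comm d w', hgv, modelBil_comm]
  refine Nat.card_congr (Equiv.subtypeEquiv g fun z => ?_)
  have : z ≠ 0 ↔ g z ≠ 0 := by rw [Ne, Ne, ← hg0, g.injective.eq_iff, hg0]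
  rw [this, ← hgw, hg]
  conv_rhs => rw [← hgf v hvw hvw']
  rw [hg]

/-- The number of primitive representations of a diagonal matrix with two units on the diagonal. -/
theorem card_primRep_diagonal [DecidableEq F] (h2 : (2 : F) ≠ 0) {d : F} (hd : ¬ IsSquare d)
    {u u' c : F} (hu : u ≠ 0) (hu' : u' ≠ 0) :
    (Nat.card (PrimRep (modelMatrix d) (Matrix.diagonal ![u, u', c])) : ℝ) =
      (if c ≠ 0 then 1 else if IsSquare (-(u * u' * d)) then 2 else 0) *
        ((Fintype.card F : ℝ) ^ 2 * ((Fintype.card F : ℝ) ^ 4 - 1)) := by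
  have hd0 : d ≠ 0 := by rintro rfl; exact hd IsSquare.zero
  obtain ⟨x, y, hxy⟩ := exists_sq_sub_eq h2 hd0 u
  have hv0 : modelBil d ![x, y, 0, 0] ![x, y, 0, 0] = u := by
    rw [modelBil_apply, ← hxy]; simp; ring
  have hw0 : modelBil d ![0, 0, 1, u' / 2] ![0, 0, 1, u' / 2] = u' := by
    rw [modelBil_apply]; simp only [Matrix.cons_val]; field_simp; ring
  have hvw0 : modelBil d ![x, y, 0, 0] ![0, 0, 1, u' / 2] = 0 := by
    rw [modelBil_apply]; simp
  classical
  have : Fintype (SecondSet d u' ![x, y, 0, 0]) := Fintype.ofFinite _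
  have hnorm := card_norm_eq h2 hd hu
  have hsec : Nat.card (SecondSet d u' ![x, y, 0, 0]) = _ := card_second h2 hd hxy hu hu'
  have hthird : Nat.card (ThirdSet d c ![x, y, 0, 0] ![0, 0, 1, u' / 2]) = _ :=
    card_third_equiv h2 hxy hu
  rw [Nat.card_eq_fintype_card] at hnorm hsec
  rw [Nat.card_congr (primRepEquiv d hu hu'), Nat.card_sigma,
    Finset.sum_congr rfl fun v _ => card_second_third_congr h2 d hu v.2 hv0, Finset.sum_const,
    Finset.card_univ, hnorm, Nat.card_sigma,
    Finset.sum_congr rfl fun w _ => card_third_congr h2 d hu' w.2.2 hw0 w.2.1 hvw0,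
    Finset.sum_const, Finset.card_univ, hsec, hthird]
  have hq : 0 < Fintype.card F := Fintype.card_pos
  -- For `c ≠ 0` the counts multiply to `(q³ + q) · q(q ± 1) · (q ∓ 1) = q²(q⁴ - 1)` with either
  -- sign. For `c = 0` the last factor is `2(q - 1)` or `0`.
  by_cases hs : IsSquare (-(u * u' * d))
  · rw [card_binary_of_isSquare h2 hd0 hu hu' hs, if_pos hs, if_pos hs]
    split_ifs with hc
    · have e : Nat.card {z : F × F // z.1 * z.2 = -c * u' ∧ z ≠ 0} = Fintype.card F - 1 := by
        have hne : -c * u' ≠ 0 := mul_ne_zero (neg_ne_zero.2 hc) hu'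
        rw [← card_mul_eq hne]
        refine Nat.card_congr (Equiv.subtypeEquivRight fun z => ⟨fun h => h.1, fun h => ⟨h, ?_⟩⟩)
        rintro rfl
        exact hne (by rw [← h]; simp)
      rw [e]
      simp only [smul_eq_mul]
      push_cast [Nat.cast_sub hq]
      ring
    · rw [not_ne_iff] at hc
      have e : Nat.card {z : F × F // z.1 * z.2 = -c * u' ∧ z ≠ 0} = 2 * (Fintype.card F - 1) := by
        rw [hc, neg_zero, zero_mul]; exact card_mul_eq_zero_ne
      rw [e]
      simp only [smul_eq_mul]
      push_cast [Nat.cast_sub hq]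
      ring
  · rw [card_binary_of_not_isSquare hu', if_neg hs, if_neg hs]
    split_ifs with hc
    · have e : Nat.card {z : F × F // z.1 ^ 2 - -(u * u' * d) * z.2 ^ 2 = -c * u' ∧ z ≠ 0} =
          Fintype.card F + 1 := by
        have hne : -c * u' ≠ 0 := mul_ne_zero (neg_ne_zero.2 hc) hu'
        rw [← card_sq_sub_eq h2 hs hne]
        refine Nat.card_congr (Equiv.subtypeEquivRight fun z => ⟨fun h => h.1, fun h => ⟨h, ?_⟩⟩)
        rintro rfl
        exact hne (by rw [← h]; simp)
      rw [e]
      simp only [smul_eq_mul]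
      push_cast [Nat.cast_sub hq]
      ring
    · rw [not_ne_iff] at hc
      have e : Nat.card {z : F × F // z.1 ^ 2 - -(u * u' * d) * z.2 ^ 2 = -c * u' ∧ z ≠ 0} =
          0 := by
        rw [Nat.card_eq_zero]
        left
        refine ⟨fun ⟨z, h, hz⟩ => hz ?_⟩
        rw [hc, neg_zero, zero_mul, sq_sub_eq_zero_iff hs] at h
        exact Prod.ext h.1 h.2
      rw [e]
      simp

/-- A form without totally isotropic planes does not represent primitively a matrix with rank at
most one. -/
theorem isEmpty_primRep {d : F} (hd : ¬ IsSquare d) {T : Matrix (Fin 3) (Fin 3) F}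
    (h11 : T 1 1 = 0) (h12 : T 1 2 = 0) (h22 : T 2 2 = 0) :
    IsEmpty (PrimRep (modelMatrix d) T) := by
  refine ⟨fun X => ?_⟩
  obtain ⟨X, hinv, hX⟩ := X
  rw [exists_left_inverse_iff] at hinv
  set v : Fin 4 → F := fun k => X k 1 with hv
  set w : Fin 4 → F := fun k => X k 2 with hw
  have hli : ∀ a b : F, a • v + b • w = 0 → a = 0 ∧ b = 0 := fun a b h => by
    have := hinv ![0, a, b] (by rw [mulVec_three]; simpa using h)
    exact ⟨congrFun this 1, congrFun this 2⟩
  have hvv : modelBil d v v = 0 := by rw [← h11, ← hX, transpose_mul_modelMatrix_mul]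
  have hvw : modelBil d v w = 0 := by rw [← h12, ← hX, transpose_mul_modelMatrix_mul]
  have hww : modelBil d w w = 0 := by rw [← h22, ← hX, transpose_mul_modelMatrix_mul]
  have hwv : modelBil d w v = 0 := by rw [modelBil_comm, hvw]
  have key : ∀ x : Fin 4 → F, x 3 = 0 → modelBil d x x = 0 → x 0 = 0 ∧ x 1 = 0 := by
    intro x h3 hx
    rw [modelBil_apply, h3] at hx
    exact (sq_sub_eq_zero_iff hd).1 (by linear_combination hx)
  -- A totally isotropic plane contains the vector `u` with last coordinate `0`. Being isotropic,
  -- `u` has only its third coordinate left; orthogonality to `v` and `w`, or independence if `u =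
  -- 0`, gives `v 3 = w 3 = 0`, and then `v` and `w` are proportional.
  set u := w 3 • v - v 3 • w with hu
  have hu3 : u 3 = 0 := by simp [hu]; ring
  have huv : modelBil d u v = 0 := by simp [hu, hvv, hwv]
  have huw : modelBil d u w = 0 := by simp [hu, hvw, hww]
  have huu : modelBil d u u = 0 := by
    conv_lhs => arg 2; rw [hu]
    rw [map_sub, map_smul, map_smul, huv, huw]; simp
  obtain ⟨u0, u1⟩ := key u hu3 huu
  have hv3w3 : v 3 = 0 ∧ w 3 = 0 := by
    by_cases h : u 2 = 0
    · have hu0 : u = 0 := by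
        funext i
        fin_cases i
        · exact u0
        · exact u1
        · exact h
        · exact hu3
      have := hli (w 3) (-v 3) (by rw [neg_smul, ← sub_eq_add_neg, ← hu, hu0])
      exact ⟨neg_eq_zero.1 this.2, this.1⟩
    · rw [modelBil_apply, u0, u1, hu3] at huv huw
      simp [h] at huv huw
      exact ⟨huv, huw⟩
  obtain ⟨v0, v1⟩ := key v hv3w3.1 hvv
  obtain ⟨w0, w1⟩ := key w hv3w3.2 hww
  have := hli (w 2) (-v 2) (by
    funext i
    fin_cases i
    · simp [v0, w0]
    · simp [v1, w1]
    · simp; ring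
    · simp [hv3w3.1, hv3w3.2])
  have hv2 : v 2 = 0 := neg_eq_zero.1 this.2
  refine one_ne_zero (α := F) (hli 1 0 ?_).1
  funext i
  fin_cases i
  · simp [v0]
  · simp [v1]
  · simp [hv2]
  · simp [hv3w3.1]

end TripleCountMain

/-! ### Counting by fibres. -/

section Counting

theorem card_eq_mul_of_fiber {X Y : Type*} [Finite X] [Finite Y] (f : X → Y) {c : ℕ}
    (h : ∀ y, Nat.card {x // f x = y} = c) : Nat.card X = Nat.card Y * c := by
  have := Fintype.ofFinite Y
  rw [card_eq_sum_fiber f, Finset.sum_congr rfl fun y _ => h y, Finset.sum_const,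
    Finset.card_univ, Nat.card_eq_fintype_card, smul_eq_mul]

theorem card_symm_three {A : Type*} (P : Fin 3 → Fin 3 → A → Prop)
    (hP : ∀ i j, P i j = P j i) :
    Nat.card {K : Matrix (Fin 3) (Fin 3) A // K.IsSymm ∧ ∀ i j, P i j (K i j)} =
      Nat.card {x // P 0 0 x} * Nat.card {x // P 0 1 x} * Nat.card {x // P 0 2 x} *
      Nat.card {x // P 1 1 x} * Nat.card {x // P 1 2 x} * Nat.card {x // P 2 2 x} := by
  have e : {K : Matrix (Fin 3) (Fin 3) A // K.IsSymm ∧ ∀ i j, P i j (K i j)} ≃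
      ((((({x // P 0 0 x} × {x // P 0 1 x}) × {x // P 0 2 x}) × {x // P 1 1 x}) ×
        {x // P 1 2 x}) × {x // P 2 2 x}) :=
    { toFun := fun K => (((((⟨K.1 0 0, K.2.2 0 0⟩, ⟨K.1 0 1, K.2.2 0 1⟩), ⟨K.1 0 2, K.2.2 0 2⟩),
        ⟨K.1 1 1, K.2.2 1 1⟩), ⟨K.1 1 2, K.2.2 1 2⟩), ⟨K.1 2 2, K.2.2 2 2⟩)
      invFun := fun x => ⟨!![x.1.1.1.1.1.1, x.1.1.1.1.2.1, x.1.1.1.2.1;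
          x.1.1.1.1.2.1, x.1.1.2.1, x.1.2.1; x.1.1.1.2.1, x.1.2.1, x.2.1], by
        ext i j
        fin_cases i <;> fin_cases j <;> rfl, by
        obtain ⟨⟨⟨⟨⟨x1, x2⟩, x3⟩, x4⟩, x5⟩, x6⟩ := x
        intro i j
        fin_cases i <;> fin_cases j
        · exact x1.2
        · exact x2.2
        · exact x3.2
        · exact (hP 0 1) ▸ x2.2
        · exact x4.2
        · exact x5.2
        · exact (hP 0 2) ▸ x3.2
        · exact (hP 1 2) ▸ x5.2
        · exact x6.2⟩
      left_inv := fun K => by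
        refine Subtype.ext (Matrix.ext fun i j => ?_)
        have h := K.2.1
        fin_cases i <;> fin_cases j
        · rfl
        · rfl
        · rfl
        · exact h.apply 1 0
        · rfl
        · rfl
        · exact h.apply 2 0
        · exact h.apply 2 1
        · rfl
      right_inv := fun x => rfl }
  rw [Nat.card_congr e]
  simp only [Nat.card_prod]

theorem card_matrix_cols {A : Type*} {m n : ℕ} (P : Fin n → A → Prop) :
    Nat.card {E : Matrix (Fin m) (Fin n) A // ∀ i j, P j (E i j)} =
      ∏ _i : Fin m, ∏ j : Fin n, Nat.card {x // P j x} := by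
  have e : {E : Matrix (Fin m) (Fin n) A // ∀ i j, P j (E i j)} ≃
      (∀ _i : Fin m, ∀ j : Fin n, {x // P j x}) :=
    { toFun := fun E i j => ⟨E.1 i j, E.2 i j⟩
      invFun := fun f => ⟨Matrix.of fun i j => (f i j).1, fun i j => (f i j).2⟩
      left_inv := fun E => rfl
      right_inv := fun f => rfl }
  rw [Nat.card_congr e, Nat.card_pi]
  simp only [Nat.card_pi]

end Counting

/-! ### Lifting representations along a square-zero kernel. -/

section SquareZero

variable {R R' : Type*} [CommRing R] [CommRing R'] [Finite R] [Finite R'] {π : R →+* R'}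

/-- The matrix `X` has a left inverse. -/
def IsPrim {R : Type*} [CommRing R] {m n : ℕ} (X : Matrix (Fin m) (Fin n) R) : Prop :=
  ∃ C : Matrix (Fin n) (Fin m) R, C * X = 1

instance {m n : ℕ} (S : Matrix (Fin m) (Fin m) R) (T : Matrix (Fin n) (Fin n) R) :
    Finite (PrimRep S T) := inferInstanceAs (Finite {_X : Matrix (Fin m) (Fin n) R // _})

theorem map_surjective_matrix (hπ : Function.Surjective π) {m n : ℕ}
    (X : Matrix (Fin m) (Fin n) R') : ∃ Y : Matrix (Fin m) (Fin n) R, Y.map π = X := by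
  choose g hg using hπ
  exact ⟨X.map g, by ext i j; simp [hg]⟩

theorem mul_eq_zero_of_map_eq_zero (h0 : ∀ a b, π a = 0 → π b = 0 → a * b = 0) {l m n : ℕ}
    {A : Matrix (Fin l) (Fin m) R} {C : Matrix (Fin m) (Fin n) R} (hA : A.map π = 0)
    (hC : C.map π = 0) : A * C = 0 := by
  ext i j
  rw [Matrix.mul_apply]
  refine Finset.sum_eq_zero fun k _ => h0 _ _ ?_ ?_
  · exact congrFun (congrFun hA i) k
  · exact congrFun (congrFun hC k) j

/-- A Newton step: if `DX - 1` has square zero, then `(2 - DX)D` is a left inverse of `X`. -/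
theorem isPrim_map_iff (hπ : Function.Surjective π) (h0 : ∀ a b, π a = 0 → π b = 0 → a * b = 0)
    {m n : ℕ} (X : Matrix (Fin m) (Fin n) R) : IsPrim (X.map π) ↔ IsPrim X := by
  constructor
  · rintro ⟨C, hC⟩
    obtain ⟨D, rfl⟩ := map_surjective_matrix hπ C
    have h1 : (D * X - 1).map π = 0 := by
      rw [Matrix.map_sub _ (map_sub π), Matrix.map_mul, hC, Matrix.map_one _ (map_zero π) (map_one π),
        sub_self]
    have h2 := mul_eq_zero_of_map_eq_zero h0 h1 h1
    refine ⟨(2 - D * X) * D, ?_⟩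
    rw [Matrix.mul_assoc]
    have h3 : (2 - D * X) * (D * X) = 1 - (D * X - 1) * (D * X - 1) := by noncomm_ring
    rw [h3, h2, sub_zero]
  · rintro ⟨C, hC⟩
    refine ⟨C.map π, ?_⟩
    rw [← Matrix.map_mul, hC, Matrix.map_one _ (map_zero π) (map_one π)]

/-- Changing the represented matrix by an element of the square-zero kernel does not change the
number of primitive representations. -/
theorem card_primRep_add (hπ : Function.Surjective π) (h0 : ∀ a b, π a = 0 → π b = 0 → a * b = 0)
    {h : R} (h2 : 2 * h = 1) {m n : ℕ} {S S' : Matrix (Fin m) (Fin m) R} (hS : S.IsSymm)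
    (hSS : S * S' = 1) (T : Matrix (Fin n) (Fin n) R) {K : Matrix (Fin n) (Fin n) R}
    (hK : K.IsSymm) (hK0 : K.map π = 0) :
    Nat.card (PrimRep S T) = Nat.card (PrimRep S (T + K)) := by
  classical
  -- The approximate left inverse depends on the reduction of `X` only, so `X` and its correction
  -- use the same one; this makes the correction invertible.
  let β : Matrix (Fin m) (Fin n) R' → Matrix (Fin n) (Fin m) R := fun Y =>
    if hY : IsPrim Y then (map_surjective_matrix hπ hY.choose).choose else 0
  have hβ : ∀ X : Matrix (Fin m) (Fin n) R, IsPrim X → (β (X.map π) * X - 1).map π = 0 := by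
    intro X hX
    have hX' := (isPrim_map_iff hπ h0 X).2 hX
    have h1 : (β (X.map π)).map π = hX'.choose := by
      simp only [β, dif_pos hX']
      exact (map_surjective_matrix hπ hX'.choose).choose_spec
    rw [Matrix.map_sub _ (map_sub π), Matrix.map_mul, h1, hX'.choose_spec,
      Matrix.map_one _ (map_zero π) (map_one π), sub_self]
  -- With `b` an approximate left inverse of `X`, the correction `½ S⁻¹ bᵗ K` solves `XᵗSE + EᵗSX =
  -- K`, because `Xᵗ bᵗ K = K`. The quadratic term `EᵗSE` vanishes.
  let E : Matrix (Fin m) (Fin n) R → Matrix (Fin n) (Fin n) R → Matrix (Fin m) (Fin n) R :=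
    fun X K => h • (S' * (β (X.map π))ᵀ * K)
  have hE : ∀ X K, K.map π = 0 → (E X K).map π = 0 := by
    intro X K hK0
    have : (S' * (β (X.map π))ᵀ * K).map π = 0 := by
      rw [Matrix.map_mul, hK0, Matrix.mul_zero]
    ext i j
    have h3 := congrFun (congrFun this i) j
    rw [Matrix.map_apply] at h3
    simp only [E, Matrix.map_apply, Matrix.smul_apply, smul_eq_mul, map_mul, h3, mul_zero,
      Matrix.zero_apply]
  have hE' : ∀ X K, K.map π = 0 → (X + E X K).map π = X.map π := by
    intro X K hK0
    rw [Matrix.map_add _ (map_add π), hE X K hK0, add_zero]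
  have key : ∀ X K, K.IsSymm → K.map π = 0 → IsPrim X →
      (X + E X K)ᵀ * S * (X + E X K) = Xᵀ * S * X + K := by
    intro X K hK hK0 hX
    have e1 : Xᵀ * S * E X K = h • K := by
      have hε := mul_eq_zero_of_map_eq_zero (A := (β (X.map π) * X - 1)ᵀ) h0
        (by rw [Matrix.transpose_map, hβ X hX, Matrix.transpose_zero]) hK0
      rw [Matrix.transpose_sub, Matrix.transpose_one, Matrix.sub_mul, Matrix.one_mul,
        Matrix.transpose_mul, sub_eq_zero] at hε
      calc Xᵀ * S * E X K = h • (Xᵀ * (S * S') * (β (X.map π))ᵀ * K) := by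
            simp only [E, Matrix.mul_smul, Matrix.mul_assoc]
        _ = h • K := by rw [hSS, Matrix.mul_one, hε]
    have e2 : (E X K)ᵀ * S * X = h • K := by
      have := congrArg Matrix.transpose e1
      clear_value E
      generalize E X K = Z at this ⊢
      rw [Matrix.transpose_mul, Matrix.transpose_mul, Matrix.transpose_transpose, hS.eq,
        Matrix.transpose_smul, hK.eq, ← Matrix.mul_assoc] at this
      exact this
    have e3 : (E X K)ᵀ * S * E X K = 0 := by
      refine mul_eq_zero_of_map_eq_zero h0 ?_ (hE X K hK0)
      rw [Matrix.map_mul, Matrix.transpose_map, hE X K hK0, Matrix.transpose_zero,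
        Matrix.zero_mul]
    rw [Matrix.transpose_add, Matrix.add_mul, Matrix.add_mul, Matrix.mul_add, Matrix.mul_add, e1, e2,
      e3, add_zero, add_assoc, ← add_smul]
    rw [← two_mul, h2, one_smul]
  have hneg : (-K).map π = 0 := by
    rw [Matrix.map_neg _ (map_neg π), hK0, neg_zero]
  have hEneg : ∀ X X' K, X.map π = X'.map π → E X (-K) = -E X' K := by
    intro X X' K hXX
    simp only [E, hXX, Matrix.mul_neg, smul_neg]
  refine Nat.card_congr
    { toFun := fun X => ⟨X.1 + E X.1 K, ?_, ?_⟩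
      invFun := fun X => ⟨X.1 + E X.1 (-K), ?_, ?_⟩
      left_inv := fun X => Subtype.ext ?_
      right_inv := fun X => Subtype.ext ?_ }
  · change IsPrim _
    rw [← isPrim_map_iff hπ h0, hE' _ _ hK0, isPrim_map_iff hπ h0]
    exact X.2.1
  · rw [key _ _ hK hK0 X.2.1, X.2.2]
  · change IsPrim _
    rw [← isPrim_map_iff hπ h0, hE' _ _ hneg, isPrim_map_iff hπ h0]
    exact X.2.1
  · rw [key _ _ (by rw [Matrix.IsSymm, Matrix.transpose_neg, hK.eq]) hneg X.2.1, X.2.2,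
      add_neg_cancel_right]
  · change X.1 + E X.1 K + E (X.1 + E X.1 K) (-K) = X.1
    rw [hEneg _ X.1 K (hE' _ _ hK0), add_neg_cancel_right]
  · change X.1 + E X.1 (-K) + E (X.1 + E X.1 (-K)) K = X.1
    have h3 := hEneg X.1 (X.1 + E X.1 (-K)) K (hE' _ _ hneg).symm
    rw [add_assoc, add_eq_left]
    exact eq_neg_iff_add_eq_zero.1 h3

/-- Hensel's lemma for primitive representations by a unimodular quaternary form. -/
theorem card_primRep_step (hπ : Function.Surjective π) (h0 : ∀ a b, π a = 0 → π b = 0 → a * b = 0)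
    {h : R} (h2 : 2 * h = 1) {S S' : Matrix (Fin 4) (Fin 4) R} (hS : S.IsSymm)
    (hSS : S * S' = 1) {T : Matrix (Fin 3) (Fin 3) R} (hT : T.IsSymm) :
    Nat.card (PrimRep S T) =
      Nat.card {a // π a = 0} ^ 6 * Nat.card (PrimRep (S.map π) (T.map π)) := by
  -- `Y` is counted in two ways: by the error `XᵗSX - T`, with fibres of equal size over the
  -- symmetric matrices in the kernel (six free entries), and by reduction, with twelve free entries
  -- in each fibre.
  let Y := {X : Matrix (Fin 4) (Fin 3) R // IsPrim X ∧ (Xᵀ * S * X).map π = T.map π}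
  let κ := {K : Matrix (Fin 3) (Fin 3) R // K.IsSymm ∧ ∀ i j, π (K i j) = 0}
  have hmapmul : ∀ X : Matrix (Fin 4) (Fin 3) R, (Xᵀ * S * X).map π =
      (X.map π)ᵀ * S.map π * X.map π := fun X => by
    rw [Matrix.map_mul, Matrix.map_mul, Matrix.transpose_map]
  have hκ : Nat.card κ = Nat.card {a // π a = 0} ^ 6 := by
    have := card_symm_three (A := R) (fun _ _ a => π a = 0) (fun _ _ => rfl)
    simp only [κ]
    rw [this]; ring
  have c1 : Nat.card Y = Nat.card κ * Nat.card (PrimRep S T) := by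
    let f : Y → κ := fun X => ⟨X.1ᵀ * S * X.1 - T, by
      rw [Matrix.IsSymm, Matrix.transpose_sub, Matrix.transpose_mul, Matrix.transpose_mul,
        Matrix.transpose_transpose, hS.eq, hT.eq, Matrix.mul_assoc], fun i j => by
      have := congrFun (congrFun X.2.2 i) j
      rw [Matrix.map_apply, Matrix.map_apply] at this
      rw [Matrix.sub_apply, map_sub, this, sub_self]⟩
    refine card_eq_mul_of_fiber f fun K => ?_
    have hK0 : K.1.map π = 0 := by
      ext i j; exact K.2.2 i j
    rw [card_primRep_add hπ h0 h2 hS hSS T K.2.1 hK0]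
    refine Nat.card_congr
      { toFun := fun X => ⟨X.1.1, X.1.2.1, ?_⟩
        invFun := fun X => ⟨⟨X.1, X.2.1, ?_⟩, ?_⟩
        left_inv := fun X => rfl
        right_inv := fun X => rfl }
    · have := congrArg Subtype.val X.2
      change X.1.1ᵀ * S * X.1.1 - T = K.1 at this
      rw [← this]; abel
    · rw [X.2.2, Matrix.map_add _ (map_add π), hK0, add_zero]
    · refine Subtype.ext ?_
      change X.1ᵀ * S * X.1 - T = K.1
      rw [X.2.2]; abel
  have c2 : Nat.card Y = Nat.card (PrimRep (S.map π) (T.map π)) * Nat.card {a // π a = 0} ^ 12 := by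
    let f : Y → PrimRep (S.map π) (T.map π) := fun X =>
      ⟨X.1.map π, (isPrim_map_iff hπ h0 _).2 X.2.1, by rw [← hmapmul, X.2.2]⟩
    refine card_eq_mul_of_fiber f fun Z => ?_
    have hc := card_matrix_cols (A := R) (m := 4) (n := 3) (fun _ a => π a = 0)
    simp only [Finset.prod_const, Finset.card_univ, Fintype.card_fin] at hc
    rw [← pow_mul] at hc
    rw [← hc]
    obtain ⟨W, hW⟩ := map_surjective_matrix hπ Z.1
    have hmem : ∀ E : Matrix (Fin 4) (Fin 3) R, (∀ i j, π (E i j) = 0) → (W + E).map π = Z.1 := by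
      intro E hE
      rw [Matrix.map_add _ (map_add π), hW]
      ext i j
      simp [hE]
    refine Nat.card_congr
      { toFun := fun X => ⟨X.1.1 - W, fun i j => ?_⟩
        invFun := fun E => ⟨⟨W + E.1, ?_, ?_⟩, ?_⟩
        left_inv := fun X => Subtype.ext (Subtype.ext ?_)
        right_inv := fun E => Subtype.ext ?_ }
    · have h1 : X.1.1.map π = Z.1 := congrArg Subtype.val X.2
      rw [← hW] at h1
      have := congrFun (congrFun h1 i) j
      rw [Matrix.map_apply, Matrix.map_apply] at this
      rw [Matrix.sub_apply, map_sub, this, sub_self]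
    · rw [← isPrim_map_iff hπ h0, hmem _ E.2]; exact Z.2.1
    · rw [hmapmul, hmem _ E.2, Z.2.2]
    · exact Subtype.ext (hmem _ E.2)
    · exact add_sub_cancel _ _
    · exact add_sub_cancel_left _ _
  have hpos : 0 < Nat.card {a // π a = 0} := by
    have : Nonempty {a // π a = 0} := ⟨⟨0, map_zero π⟩⟩
    exact Nat.card_pos
  rw [c1, hκ] at c2
  have : Nat.card {a // π a = 0} ^ 6 * Nat.card (PrimRep S T) = Nat.card {a // π a = 0} ^ 6 *
      (Nat.card {a // π a = 0} ^ 6 * Nat.card (PrimRep (S.map π) (T.map π))) := by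
    rw [c2]; ring
  exact Nat.eq_of_mul_eq_mul_left (pow_pos hpos 6) this

end SquareZero

/-! ### Reduction modulo powers of `p`. -/

section Reduction

variable {p : ℕ} [hp : Fact p.Prime]

theorem toZModPow_eq_zero_iff (t : ℕ) (x : ℤ_[p]) :
    PadicInt.toZModPow t x = 0 ↔ (p : ℤ_[p]) ^ t ∣ x := by
  rw [← RingHom.mem_ker, PadicInt.ker_toZModPow, Ideal.mem_span_singleton]

theorem toZModPow_eq_iff (t : ℕ) (x y : ℤ_[p]) :
    PadicInt.toZModPow t x = PadicInt.toZModPow t y ↔ (p : ℤ_[p]) ^ t ∣ x - y := by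
  rw [← toZModPow_eq_zero_iff, map_sub, sub_eq_zero]

theorem toZModPow_surjective (t : ℕ) :
    Function.Surjective (PadicInt.toZModPow t : ℤ_[p] →+* ZMod (p ^ t)) :=
  ZMod.ringHom_surjective _

/-- Reduction `ℤ/p^t → ℤ/p^s`. -/
def reduce {s t : ℕ} (h : s ≤ t) : ZMod (p ^ t) →+* ZMod (p ^ s) :=
  ZMod.castHom (pow_dvd_pow p h) _

theorem reduce_toZModPow {s t : ℕ} (h : s ≤ t) (x : ℤ_[p]) :
    reduce h (PadicInt.toZModPow t x) = PadicInt.toZModPow s x :=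
  RingHom.congr_fun (PadicInt.zmod_cast_comp_toZModPow s t h) x

theorem reduce_surjective {s t : ℕ} (h : s ≤ t) :
    Function.Surjective (reduce (p := p) h) := ZMod.castHom_surjective _

instance (t : ℕ) : Finite (ZMod (p ^ t)) :=
  have : NeZero (p ^ t) := ⟨pow_ne_zero _ hp.out.ne_zero⟩
  inferInstance

theorem card_reduce_eq_zero {s t : ℕ} (h : s ≤ t) :
    Nat.card {x : ZMod (p ^ t) // reduce (p := p) h x = 0} = p ^ (t - s) := by
  have h1 := card_eq_mul_of_fiber (reduce (p := p) h)
    (c := Nat.card {x : ZMod (p ^ t) // reduce (p := p) h x = 0}) (by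
      intro y
      obtain ⟨z, rfl⟩ := reduce_surjective h y
      exact Nat.card_congr ((Equiv.subRight z).subtypeEquiv fun x => by
        rw [Equiv.subRight_apply, map_sub, sub_eq_zero]))
  rw [Nat.card_zmod, Nat.card_zmod] at h1
  have h2 : p ^ t = p ^ s * p ^ (t - s) := by rw [← pow_add, Nat.add_sub_cancel' h]
  exact (Nat.eq_of_mul_eq_mul_left (pow_pos hp.out.pos s) (h2 ▸ h1.symm : _)).trans rfl

theorem card_pow_mul_eq_zero {s t : ℕ} (h : s ≤ t) :
    Nat.card {x : ZMod (p ^ t) // (p : ZMod (p ^ t)) ^ s * x = 0} = p ^ s := by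
  have h1 := card_reduce_eq_zero (p := p) (Nat.sub_le t s)
  rw [Nat.sub_sub_self h] at h1
  rw [← h1]
  refine Nat.card_congr (Equiv.subtypeEquivRight fun x => ?_)
  obtain ⟨z, rfl⟩ := toZModPow_surjective t x
  rw [reduce_toZModPow, toZModPow_eq_zero_iff]
  have h3 : ((p : ZMod (p ^ t)) ^ s * PadicInt.toZModPow t z) =
      PadicInt.toZModPow t ((p : ℤ_[p]) ^ s * z) := by simp
  rw [h3, toZModPow_eq_zero_iff]
  have h0 : (p : ℤ_[p]) ^ s ≠ 0 := pow_ne_zero _ (by exact_mod_cast hp.out.ne_zero)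
  have h2 : (p : ℤ_[p]) ^ t = p ^ s * p ^ (t - s) := by rw [← pow_add, Nat.add_sub_cancel' h]
  rw [h2, mul_dvd_mul_iff_left h0]

theorem card_pow_mul_eq {s t : ℕ} (h : s ≤ t) (c : ZMod (p ^ t)) (z : ZMod (p ^ t))
    (hz : (p : ZMod (p ^ t)) ^ s * z = c) :
    Nat.card {x : ZMod (p ^ t) // (p : ZMod (p ^ t)) ^ s * x = c} = p ^ s := by
  rw [← card_pow_mul_eq_zero h]
  exact Nat.card_congr ((Equiv.subRight z).subtypeEquiv fun x => by
    rw [Equiv.subRight_apply, mul_sub, hz, sub_eq_zero])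

/-- For `t ≥ 1` one has `t + 1 ≤ 2t`, so the kernel of each step is square-zero. -/
theorem reduce_mul_eq_zero {t : ℕ} (ht : 1 ≤ t) (a b : ZMod (p ^ (t + 1)))
    (ha : reduce (p := p) t.le_succ a = 0) (hb : reduce (p := p) t.le_succ b = 0) : a * b = 0 := by
  obtain ⟨a, rfl⟩ := toZModPow_surjective _ a
  obtain ⟨b, rfl⟩ := toZModPow_surjective _ b
  rw [reduce_toZModPow, toZModPow_eq_zero_iff] at ha hb
  rw [← map_mul, toZModPow_eq_zero_iff]
  refine (pow_dvd_pow _ (by omega : t + 1 ≤ t + t)).trans ?_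
  rw [pow_add]
  exact mul_dvd_mul ha hb

/-- Reduction of matrices modulo `p^t`. -/
def modPow (t : ℕ) {m n : ℕ} (X : Matrix (Fin m) (Fin n) ℤ_[p]) :
    Matrix (Fin m) (Fin n) (ZMod (p ^ t)) := X.map (PadicInt.toZModPow t)

theorem modPow_surjective (t : ℕ) {m n : ℕ} (X : Matrix (Fin m) (Fin n) (ZMod (p ^ t))) :
    ∃ Y : Matrix (Fin m) (Fin n) ℤ_[p], modPow t Y = X := by
  choose g hg using toZModPow_surjective (p := p) t
  exact ⟨X.map g, by ext i j; simp [modPow, hg]⟩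

theorem exists_symm_modPow (t : ℕ) {n : ℕ} {X : Matrix (Fin n) (Fin n) (ZMod (p ^ t))}
    (hX : X.IsSymm) : ∃ Y : Matrix (Fin n) (Fin n) ℤ_[p], Y.IsSymm ∧ modPow t Y = X := by
  choose g hg using toZModPow_surjective (p := p) t
  exact ⟨X.map g, hX.map g, by ext i j; simp [modPow, hg]⟩

theorem modPow_mul (t : ℕ) {l m n : ℕ} (X : Matrix (Fin l) (Fin m) ℤ_[p])
    (Y : Matrix (Fin m) (Fin n) ℤ_[p]) : modPow t (X * Y) = modPow t X * modPow t Y :=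
  Matrix.map_mul

theorem modPow_transpose (t : ℕ) {m n : ℕ} (X : Matrix (Fin m) (Fin n) ℤ_[p]) :
    modPow t Xᵀ = (modPow t X)ᵀ := rfl

theorem modPow_one (t : ℕ) (n : ℕ) :
    modPow t (1 : Matrix (Fin n) (Fin n) ℤ_[p]) = 1 :=
  Matrix.map_one _ (map_zero _) (map_one _)

theorem modPow_eq_iff (t : ℕ) {m n : ℕ} (X Y : Matrix (Fin m) (Fin n) ℤ_[p]) :
    modPow t X = modPow t Y ↔ ∀ i j, (p : ℤ_[p]) ^ t ∣ X i j - Y i j := by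
  simp only [← toZModPow_eq_iff]
  exact ⟨fun h i j => congrFun (congrFun h i) j, fun h => Matrix.ext h⟩

theorem modPow_reduce {s t : ℕ} (h : s ≤ t) {m n : ℕ} (X : Matrix (Fin m) (Fin n) ℤ_[p]) :
    (modPow t X).map (reduce h) = modPow s X := by
  ext i j
  exact reduce_toZModPow h _

/-- `X` is primitive modulo `p`. -/
def PrimMod {m n : ℕ} (X : Matrix (Fin m) (Fin n) ℤ_[p]) : Prop :=
  ∀ c : Fin n → ℤ_[p], (∀ i, (p : ℤ_[p]) ∣ (X *ᵥ c) i) → ∀ j, (p : ℤ_[p]) ∣ c j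

theorem toZModPow_mulVec (t : ℕ) {m n : ℕ} (X : Matrix (Fin m) (Fin n) ℤ_[p]) (c : Fin n → ℤ_[p])
    (i : Fin m) : PadicInt.toZModPow t ((X *ᵥ c) i) =
      (modPow t X *ᵥ fun j => PadicInt.toZModPow t (c j)) i := by
  simp [Matrix.mulVec, dotProduct, modPow]

theorem isPrim_modPow_one_iff {m n : ℕ} (X : Matrix (Fin m) (Fin n) ℤ_[p]) :
    IsPrim (modPow 1 X) ↔ PrimMod X := by
  have : Fact (p ^ 1).Prime := ⟨by simpa using hp.out⟩
  rw [IsPrim, exists_left_inverse_iff]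
  have hdvd : ∀ x : ℤ_[p], (p : ℤ_[p]) ∣ x ↔ PadicInt.toZModPow 1 x = 0 := fun x => by
    rw [toZModPow_eq_zero_iff, pow_one]
  constructor
  · intro h c hc j
    rw [hdvd]
    refine congrFun (h (fun j => PadicInt.toZModPow 1 (c j)) (funext fun i => ?_)) j
    rw [← toZModPow_mulVec, (hdvd _).1 (hc i)]; rfl
  · intro h v hv
    choose c hc using fun j => toZModPow_surjective 1 (v j)
    have h1 := h c fun i => by
      rw [hdvd, toZModPow_mulVec, funext hc, hv]; rfl
    exact funext fun j => by rw [← hc j, (hdvd _).1 (h1 j)]; rfl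

theorem isPrim_modPow_iff {t : ℕ} (ht : 1 ≤ t) {m n : ℕ} (X : Matrix (Fin m) (Fin n) ℤ_[p]) :
    IsPrim (modPow t X) ↔ PrimMod X := by
  induction t, ht using Nat.le_induction with
  | base => exact isPrim_modPow_one_iff X
  | succ t ht ih =>
    rw [← ih, ← modPow_reduce t.le_succ,
      isPrim_map_iff (reduce_surjective _) (reduce_mul_eq_zero ht)]

/-- Each step from `p^t` to `p^{t+1}` multiplies the count by `p⁶`: twelve new digits, subject to
six equations. -/
theorem card_primRep_modPow (hp2 : p ≠ 2) {S S' : Matrix (Fin 4) (Fin 4) ℤ_[p]} (hS : S.IsSymm)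
    (hSS : S * S' = 1) {T : Matrix (Fin 3) (Fin 3) ℤ_[p]} (hT : T.IsSymm) {t : ℕ} (ht : 1 ≤ t) :
    Nat.card (PrimRep (modPow t S) (modPow t T)) =
      (p ^ 6) ^ (t - 1) * Nat.card (PrimRep (modPow 1 S) (modPow 1 T)) := by
  have : Fact (p ≠ 2) := ⟨hp2⟩
  induction t, ht using Nat.le_induction with
  | base => simp
  | succ t ht ih =>
    obtain ⟨u, hu⟩ := isUnit_two (p := p)
    have h2 : (2 : ZMod (p ^ (t + 1))) * PadicInt.toZModPow (t + 1) (u⁻¹ : ℤ_[p]ˣ) = 1 := by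
      rw [← map_ofNat (PadicInt.toZModPow (t + 1) : ℤ_[p] →+* ZMod (p ^ (t + 1))) 2, ← map_mul,
        ← hu, Units.mul_inv, map_one]
    have hS1 : (modPow (t + 1) S).IsSymm := hS.map _
    have hT1 : (modPow (t + 1) T).IsSymm := hT.map _
    rw [card_primRep_step (π := reduce (p := p) t.le_succ) (reduce_surjective _)
      (reduce_mul_eq_zero ht) h2 hS1 (S' := modPow (t + 1) S')
      (by rw [← modPow_mul, hSS, modPow_one]) hT1, modPow_reduce, modPow_reduce, ih,
      card_reduce_eq_zero]
    obtain ⟨s, rfl⟩ := Nat.exists_eq_add_of_le' ht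
    rw [show s + 1 + 1 - (s + 1) = 1 by omega, show s + 1 - 1 = s by omega,
      show s + 1 + 1 - 1 = s + 1 by omega]
    ring

end Reduction

/-! ### Multiples of primitive representations by a diagonal matrix of powers of `p`. -/

section Scaling

variable {p : ℕ} [hp : Fact p.Prime]

variable (p) in
/-- The diagonal matrix with entries `p^{a_i}`. -/
def powDiag {n : ℕ} (a : Fin n → ℕ) : Matrix (Fin n) (Fin n) ℤ_[p] :=
  Matrix.diagonal fun i => (p : ℤ_[p]) ^ a i

theorem modPow_powDiag (t : ℕ) {n : ℕ} (a : Fin n → ℕ) :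
    modPow t (powDiag p a) =
      Matrix.diagonal fun i => (p : ZMod (p ^ t)) ^ a i := by
  ext i j
  by_cases h : i = j
  · subst h; simp [modPow, powDiag]
  · simp [modPow, powDiag, h]

theorem powDiag_conj_apply {n : ℕ} (a : Fin n → ℕ) (Z : Matrix (Fin n) (Fin n) ℤ_[p])
    (i j : Fin n) : (powDiag p a * Z * powDiag p a) i j =
      (p : ℤ_[p]) ^ (a i + a j) * Z i j := by
  rw [powDiag, Matrix.mul_diagonal, Matrix.diagonal_mul]; ring

/-- The representations of `p^a T p^a` of the form `Y p^a` with `Y` primitive. -/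
theorem card_scaled_primRep (hp2 : p ≠ 2) {S S' : Matrix (Fin 4) (Fin 4) ℤ_[p]} (hS : S.IsSymm)
    (hSS : S * S' = 1) {T : Matrix (Fin 3) (Fin 3) ℤ_[p]} (hT : T.IsSymm) {a : Fin 3 → ℕ} {t : ℕ}
    (ht : ∀ i j, a i + a j < t) :
    Nat.card {X : Matrix (Fin 4) (Fin 3) (ZMod (p ^ t)) //
        Xᵀ * modPow t S * X = modPow t (powDiag p a * T * powDiag p a) ∧
        ∃ Y, IsPrim Y ∧ X = Y * modPow t (powDiag p a)} =
      (p ^ 6) ^ (t - 1) * Nat.card (PrimRep (modPow 1 S) (modPow 1 T)) := by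
  have ht1 : 1 ≤ t := by have := ht 0 0; omega
  set A : Matrix (Fin 3) (Fin 3) (ZMod (p ^ t)) := modPow t (powDiag p a) with hA
  have hAT : Aᵀ = A := by rw [hA, modPow_powDiag, Matrix.diagonal_transpose]
  have hmulA : ∀ (E : Matrix (Fin 4) (Fin 3) (ZMod (p ^ t))) i j,
      (E * A) i j = (p : ZMod (p ^ t)) ^ a j * E i j := fun E i j => by
    rw [hA, modPow_powDiag, Matrix.mul_diagonal, mul_comm]
  have hconj : ∀ (E : Matrix (Fin 3) (Fin 3) (ZMod (p ^ t))) i j,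
      (A * E * A) i j = (p : ZMod (p ^ t)) ^ (a i + a j) * E i j := fun E i j => by
    rw [hA, modPow_powDiag, Matrix.mul_diagonal, Matrix.diagonal_mul]; ring
  set T₁ := modPow t (powDiag p a * T * powDiag p a) with hT₁
  have hT₁' : T₁ = A * modPow t T * A := by rw [hT₁, modPow_mul, modPow_mul]
  let F := {X : Matrix (Fin 4) (Fin 3) (ZMod (p ^ t)) // Xᵀ * modPow t S * X = T₁ ∧
        ∃ Y, IsPrim Y ∧ X = Y * A}
  -- The map `Y ↦ YA` from `G` to `F` has fibres of size `p^{4(a₀+a₁+a₂)}`. The map `Y ↦ YᵗSY` goes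
  -- to `H`, which has the same size, each `a_i` occurring four times among the sums `a_i + a_j`
  -- with `i ≤ j`. Hence `F` has as many elements as a fibre over `H`.
  let G := {Y : Matrix (Fin 4) (Fin 3) (ZMod (p ^ t)) // IsPrim Y ∧
    A * (Yᵀ * modPow t S * Y) * A = T₁}
  let H := {Z : Matrix (Fin 3) (Fin 3) (ZMod (p ^ t)) // Z.IsSymm ∧
    ∀ i j, (p : ZMod (p ^ t)) ^ (a i + a j) * Z i j = T₁ i j}
  have hN : ∀ Y : Matrix (Fin 4) (Fin 3) (ZMod (p ^ t)),
      (Y * A)ᵀ * modPow t S * (Y * A) = A * (Yᵀ * modPow t S * Y) * A := fun Y => by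
    rw [Matrix.transpose_mul, hAT]; simp only [Matrix.mul_assoc]
  -- Since `a j < t`, a matrix killed by `p^{a j}` column by column is divisible by `p`, so adding
  -- it preserves primitivity.
  have hshift : ∀ Y E : Matrix (Fin 4) (Fin 3) (ZMod (p ^ t)),
      (∀ i j, (p : ZMod (p ^ t)) ^ a j * E i j = 0) → IsPrim Y → IsPrim (Y + E) := by
    intro Y E hE hY
    obtain ⟨Y, rfl⟩ := modPow_surjective t Y
    obtain ⟨E, rfl⟩ := modPow_surjective t E
    have hE1 : ∀ i j, (p : ℤ_[p]) ∣ E i j := by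
      intro i j
      have h1 := hE i j
      have h3 : ((p : ZMod (p ^ t)) ^ a j * modPow t E i j) =
        PadicInt.toZModPow t ((p : ℤ_[p]) ^ a j * E i j) := by simp [modPow]
      rw [h3, toZModPow_eq_zero_iff] at h1
      have h2 : (p : ℤ_[p]) ^ t = p ^ a j * p ^ (t - a j) := by
        rw [← pow_add, Nat.add_sub_cancel' (by have := ht j j; omega)]
      rw [h2, mul_dvd_mul_iff_left (pow_ne_zero _ (by exact_mod_cast hp.out.ne_zero))] at h1
      exact (dvd_pow_self _ (by have := ht j j; omega)).trans h1
    have h4 : modPow t Y + modPow t E = modPow t (Y + E) := by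
      ext i j; simp [modPow]
    rw [h4]
    rw [isPrim_modPow_iff ht1] at hY ⊢
    intro c hc
    refine hY c fun i => ?_
    have h5 := hc i
    rw [Matrix.add_mulVec, Pi.add_apply] at h5
    exact (dvd_add_left (Finset.dvd_sum fun j _ => (hE1 i j).mul_right _)).1 h5
  have c1 : Nat.card G = Nat.card F * p ^ (4 * (a 0 + a 1 + a 2)) := by
    let f : G → F := fun Y => ⟨Y.1 * A, by rw [hN, Y.2.2], Y.1, Y.2.1, rfl⟩
    refine card_eq_mul_of_fiber f ?_
    rintro ⟨X, hX, W, hW, rfl⟩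
    have hc := card_matrix_cols (m := 4) (n := 3)
      (fun j (x : ZMod (p ^ t)) => (p : ZMod (p ^ t)) ^ a j * x = 0)
    simp only [Finset.prod_const, Finset.card_univ, Fintype.card_fin, Fin.prod_univ_three] at hc
    rw [card_pow_mul_eq_zero (by have := ht 0 0; omega), card_pow_mul_eq_zero (by have := ht 1 1; omega),
      card_pow_mul_eq_zero (by have := ht 2 2; omega), ← pow_add, ← pow_add, ← pow_mul, mul_comm] at hc
    rw [← hc]
    have hWE : ∀ E : Matrix (Fin 4) (Fin 3) (ZMod (p ^ t)),
        (∀ i j, (p : ZMod (p ^ t)) ^ a j * E i j = 0) → (W + E) * A = W * A := by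
      intro E hE
      have : E * A = 0 := by ext i j; rw [hmulA, hE]; rfl
      rw [Matrix.add_mul, this, add_zero]
    refine Nat.card_congr
      { toFun := fun Y => ⟨Y.1.1 - W, fun i j => ?_⟩
        invFun := fun E => ⟨⟨W + E.1, hshift _ _ E.2 hW, ?_⟩, ?_⟩
        left_inv := fun Y => Subtype.ext (Subtype.ext (add_sub_cancel _ _))
        right_inv := fun E => Subtype.ext (add_sub_cancel_left _ _) }
    · have h1 : Y.1.1 * A = W * A := congrArg Subtype.val Y.2
      have h2 := congrFun (congrFun h1 i) j
      rw [hmulA, hmulA] at h2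
      rw [Matrix.sub_apply, mul_sub, h2, sub_self]
    · rw [← hN, hWE _ E.2]; exact hX
    · exact Subtype.ext (hWE _ E.2)
  have hHcard : Nat.card H = p ^ (4 * (a 0 + a 1 + a 2)) := by
    have hT₁s : T₁.IsSymm := by
      have : (modPow t T).IsSymm := hT.map _
      rw [Matrix.IsSymm, hT₁', Matrix.transpose_mul, Matrix.transpose_mul, hAT, this.eq,
        Matrix.mul_assoc]
    have := card_symm_three (fun i j (x : ZMod (p ^ t)) =>
      (p : ZMod (p ^ t)) ^ (a i + a j) * x = T₁ i j) (fun i j => by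
        funext x; rw [hT₁s.apply i j, add_comm])
    have h3 : ∀ i j, Nat.card {x // (p : ZMod (p ^ t)) ^ (a i + a j) * x = T₁ i j} =
        p ^ (a i + a j) := fun i j =>
      card_pow_mul_eq (ht i j).le _ (modPow t T i j) (by rw [hT₁', hconj])
    simp only [H]
    rw [this]
    simp only [h3]
    ring
  have c2 : Nat.card G = Nat.card H *
      ((p ^ 6) ^ (t - 1) * Nat.card (PrimRep (modPow 1 S) (modPow 1 T))) := by
    let f : G → H := fun Y => ⟨Y.1ᵀ * modPow t S * Y.1, by
        have : (modPow t S).IsSymm := hS.map _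
        rw [Matrix.IsSymm, Matrix.transpose_mul, Matrix.transpose_mul, Matrix.transpose_transpose,
          this.eq, Matrix.mul_assoc], fun i j => by rw [← hconj, Y.2.2]⟩
    refine card_eq_mul_of_fiber f ?_
    rintro ⟨Z, hZ, hZ'⟩
    obtain ⟨Z, hZs, rfl⟩ := exists_symm_modPow t hZ
    -- An element of `H` agrees with `T` modulo `p^{t - a_i - a_j}`, hence modulo `p` by the strict
    -- inequality `ht`. So all fibres over `H` have the size found for `T`.
    have hZT : modPow 1 T = modPow 1 Z := by
      rw [modPow_eq_iff]
      intro i j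
      have h1 := hZ' i j
      rw [hT₁', hconj] at h1
      have h3 : ∀ W : Matrix (Fin 3) (Fin 3) ℤ_[p],
        ((p : ZMod (p ^ t)) ^ (a i + a j) * modPow t W i j) =
        PadicInt.toZModPow t ((p : ℤ_[p]) ^ (a i + a j) * W i j) := fun W => by simp [modPow]
      have h2 : (p : ℤ_[p]) ^ t = p ^ (a i + a j) * p ^ (t - (a i + a j)) := by
        rw [← pow_add, Nat.add_sub_cancel' (ht i j).le]
      rw [h3, h3, eq_comm, toZModPow_eq_iff, ← mul_sub, h2,
        mul_dvd_mul_iff_left (pow_ne_zero _ (by exact_mod_cast hp.out.ne_zero))] at h1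
      exact (pow_dvd_pow _ (by have := ht i j; omega)).trans h1
    rw [hZT, ← card_primRep_modPow hp2 hS hSS hZs ht1]
    refine Nat.card_congr
      { toFun := fun Y => ⟨Y.1.1, Y.1.2.1, congrArg Subtype.val Y.2⟩
        invFun := fun Y => ⟨⟨Y.1, Y.2.1, ?_⟩, Subtype.ext Y.2.2⟩
        left_inv := fun Y => rfl
        right_inv := fun Y => rfl }
    rw [Y.2.2]
    ext i j
    rw [hconj, hZ']
  rw [c1, hHcard, mul_comm] at c2
  exact Nat.eq_of_mul_eq_mul_left (pow_pos hp.out.pos _) c2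

end Scaling

/-! ### Elementary divisors of submodules of `ℤ_p³`. -/

section SmithForm

/-- The matrix whose columns are the vectors of a basis. -/
def basisMatrix {R : Type*} [CommRing R] {m : ℕ} (b : Module.Basis (Fin m) R (Fin m → R)) :
    Matrix (Fin m) (Fin m) R := Matrix.of fun i j => b j i

theorem basisMatrix_inverse {R : Type*} [CommRing R] {m : ℕ}
    (b : Module.Basis (Fin m) R (Fin m → R)) :
    ∃ k' : Matrix (Fin m) (Fin m) R, basisMatrix b * k' = 1 ∧ k' * basisMatrix b = 1 := by
  refine ⟨(Matrix.of fun i j => b.repr (Pi.single j 1) i : Matrix (Fin m) (Fin m) R), ?_, ?_⟩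
  · ext i j
    have h1 := congrFun (b.sum_repr (Pi.single j 1)) i
    rw [Finset.sum_apply] at h1
    have h2 : (Pi.single j 1 : Fin m → R) i = if i = j then 1 else 0 := by
      simp [Pi.single_apply]
    rw [Matrix.one_apply, ← h2, ← h1, Matrix.mul_apply]
    exact Finset.sum_congr rfl fun l _ => mul_comm _ _
  · ext i j
    have h1 : b j = ∑ l, b j l • (Pi.single l 1 : Fin m → R) := by
      funext m
      simp [Pi.single_apply]
    have h2 := congrArg (fun f => f i) (b.repr_self j)
    rw [h1, map_sum, Finsupp.finsetSum_apply] at h2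
    rw [Matrix.one_apply, Matrix.mul_apply]
    simp only [map_smul, Finsupp.smul_apply, smul_eq_mul, Finsupp.single_apply] at h2
    simp only [eq_comm (a := i), ← h2]
    exact Finset.sum_congr rfl fun l _ => mul_comm _ _

variable {p : ℕ} [hp : Fact p.Prime]

/-- A submodule containing `pⁿ ℤ_p³` has elementary divisors `p^{e_i}` with `e_i ≤ n`. When `D` is a
kernel modulo `pⁿ`, the exponent `a_i = n - e_i` measures the divisibility of the image of the
`i`-th adapted basis vector. -/
theorem exists_smith (D : Submodule ℤ_[p] (Fin 3 → ℤ_[p])) {n : ℕ}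
    (hD : ∀ c : Fin 3 → ℤ_[p], (p : ℤ_[p]) ^ n • c ∈ D) :
    ∃ (k k' : Matrix (Fin 3) (Fin 3) ℤ_[p]) (a : Fin 3 → ℕ), k * k' = 1 ∧ k' * k = 1 ∧
      (∀ i, a i ≤ n) ∧ ∀ c, k *ᵥ c ∈ D ↔ ∀ i, (p : ℤ_[p]) ^ (n - a i) ∣ c i := by
  have hp0 : (p : ℤ_[p]) ^ n ≠ 0 := pow_ne_zero _ (by exact_mod_cast hp.out.ne_zero)
  have hrank : Module.finrank ℤ_[p] D = Module.finrank ℤ_[p] (Fin 3 → ℤ_[p]) := by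
    refine le_antisymm (Submodule.finrank_le D) ?_
    let f : (Fin 3 → ℤ_[p]) →ₗ[ℤ_[p]] D :=
      (LinearMap.lsmul ℤ_[p] _ ((p : ℤ_[p]) ^ n)).codRestrict D hD
    refine LinearMap.finrank_le_finrank_of_injective (f := f) fun x y hxy => ?_
    have : (p : ℤ_[p]) ^ n • x = (p : ℤ_[p]) ^ n • y := congrArg Subtype.val hxy
    exact smul_right_injective _ hp0 this
  obtain ⟨b, d, bD, hb⟩ := Submodule.exists_smith_normal_form_of_rank_eq
    (Pi.basisFun ℤ_[p] (Fin 3)) hrank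
  have hmem : ∀ x, x ∈ D ↔ ∀ i, d i ∣ b.repr x i := by
    intro x
    constructor
    · intro hx i
      have h1 := congrArg Subtype.val (bD.sum_repr ⟨x, hx⟩)
      simp only [AddSubmonoidClass.coe_finsetSum, Submodule.coe_smul, hb, smul_smul] at h1
      rw [← h1, Module.Basis.repr_sum_self]
      exact dvd_mul_left _ _
    · intro h
      rw [← b.sum_repr x]
      refine D.sum_mem fun i _ => ?_
      obtain ⟨r, hr⟩ := h i
      rw [hr, mul_comm, ← smul_smul, ← hb]
      exact D.smul_mem _ (bD i).2
  have hdvd : ∀ i, d i ∣ (p : ℤ_[p]) ^ n := fun i => by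
    have := (hmem _).1 (hD (b i)) i
    simpa using this
  choose e he hde using fun i => (dvd_prime_pow PadicInt.prime_p n).1 (hdvd i)
  obtain ⟨k', hk, hk'⟩ := basisMatrix_inverse b
  refine ⟨_, k', fun i => n - e i, hk, hk', fun i => Nat.sub_le _ _, fun c => ?_⟩
  · have h1 : basisMatrix b *ᵥ c = ∑ i, c i • b i := by
      ext i
      simp [basisMatrix, Matrix.mulVec, dotProduct, mul_comm]
    rw [h1, hmem]
    refine forall_congr' fun i => ?_
    rw [Module.Basis.repr_sum_self, (hde i).dvd_iff_dvd_left, Nat.sub_sub_self (he i)]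

end SmithForm

/-! ### Divisibility levels and primitivity. -/

section Levels

variable {p : ℕ} [hp : Fact p.Prime]

/-- `W n d` stands for `d` being divisible by `p^n` in some torsion-free module. -/
theorem level_iff {W : ℕ → (Fin 3 → ℤ_[p]) → Prop} (h0 : ∀ d, W 0 d)
    (hs : ∀ m d, W (m + 1) ((p : ℤ_[p]) • d) ↔ W m d) (hm : ∀ m d, W (m + 1) d → W 1 d)
    {a : Fin 3 → ℕ} {n : ℕ} (ha : ∀ i, a i < n) :
    (∀ c : Fin 3 → ℤ_[p], W n (fun i => (p : ℤ_[p]) ^ a i * c i) ↔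
      ∀ i, (p : ℤ_[p]) ^ (n - a i) ∣ c i) ↔ ∀ c, W 1 c → ∀ i, (p : ℤ_[p]) ∣ c i := by
  have hp0 : (p : ℤ_[p]) ≠ 0 := by exact_mod_cast hp.out.ne_zero
  have hs' : ∀ s m d, W (m + s) ((p : ℤ_[p]) ^ s • d) ↔ W m d := by
    intro s
    induction s with
    | zero => intro m d; simp
    | succ s ih =>
      intro m d
      rw [pow_succ', mul_smul, ← add_assoc, hs, ih]
  have hn : 1 ≤ n := (ha 0).trans_le' (by omega)
  obtain ⟨n, rfl⟩ := Nat.exists_eq_add_of_le' hn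
  constructor
  · intro h c hc i
    -- Raising `c` by `pⁿ` gives level `n + 1`, and `pⁿ c` is `p^a` times `p^{n-a} c`. The required
    -- exponent `n + 1 - a_i` exceeds the available `n - a_i` by one, so `p ∣ c_i`; strictness of
    -- `ha` allows the factorization.
    have h1 := (hs' n 1 c).2 hc
    have h2 : (p : ℤ_[p]) ^ n • c = fun i => (p : ℤ_[p]) ^ a i * ((p : ℤ_[p]) ^ (n - a i) * c i) := by
      funext i
      rw [← mul_assoc, ← pow_add, Nat.add_sub_cancel' (by have := ha i; omega)]
      rfl
    rw [h2, add_comm] at h1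
    have h3 := (h _).1 h1 i
    rw [show n + 1 - a i = n - a i + 1 by have := ha i; omega, pow_succ,
      mul_dvd_mul_iff_left (pow_ne_zero _ hp0)] at h3
    exact h3
  · intro h
    have key : ∀ m d, W m d → ∀ i, (p : ℤ_[p]) ^ m ∣ d i := by
      intro m
      induction m with
      | zero => intro d _ i; simp
      | succ m ih =>
        intro d hd i
        choose d' hd' using h d (hm m d hd)
        obtain rfl : d = (p : ℤ_[p]) • d' := funext hd'
        rw [hs] at hd
        rw [pow_succ']
        exact mul_dvd_mul_left _ (ih d' hd i)
    intro c
    have hpow : ∀ i, (p : ℤ_[p]) ^ (n + 1) = p ^ a i * p ^ (n + 1 - a i) := fun i => by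
      rw [← pow_add, Nat.add_sub_cancel' (ha i).le]
    constructor
    · intro hc i
      have h1 := key _ _ hc i
      rwa [hpow i, mul_dvd_mul_iff_left (pow_ne_zero _ hp0)] at h1
    · intro hc
      choose e he using hc
      have h1 : (fun i => (p : ℤ_[p]) ^ a i * c i) = (p : ℤ_[p]) ^ (n + 1) • e := by
        funext i
        rw [he, ← mul_assoc, ← hpow]; rfl
      rw [h1]
      have := (hs' (n + 1) 0 e).2 (h0 e)
      rwa [zero_add] at this

end Levels

/-! ### Representations modulo `p^t` sorted by their kernel modulo `pⁿ`. -/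

section RepKernel

variable {p : ℕ} [hp : Fact p.Prime]

/-- The vectors `c` with `X c ≡ 0 mod p^n`. -/
def repKernel {n t : ℕ} (h : n ≤ t) (X : Matrix (Fin 4) (Fin 3) (ZMod (p ^ t))) :
    Submodule ℤ_[p] (Fin 3 → ℤ_[p]) where
  carrier := {c | ∀ i, reduce h ((X *ᵥ fun j => PadicInt.toZModPow t (c j)) i) = 0}
  add_mem' := by
    intro c d hc hd i
    have : (fun j => PadicInt.toZModPow t ((c + d) j)) =
      (fun j => PadicInt.toZModPow t (c j)) + fun j => PadicInt.toZModPow t (d j) := by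
      funext j; simp
    rw [this, Matrix.mulVec_add, Pi.add_apply, map_add, hc i, hd i, add_zero]
  zero_mem' := by
    intro i
    have : (fun j => PadicInt.toZModPow t ((0 : Fin 3 → ℤ_[p]) j)) = 0 := by
      funext j; simp
    rw [this, Matrix.mulVec_zero, Pi.zero_apply, map_zero]
  smul_mem' := by
    intro r c hc i
    have : (fun j => PadicInt.toZModPow t ((r • c) j)) =
      PadicInt.toZModPow t r • fun j => PadicInt.toZModPow t (c j) := by
      funext j; simp
    rw [this, Matrix.mulVec_smul, Pi.smul_apply, smul_eq_mul, map_mul, hc i, mul_zero]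

theorem mem_repKernel_modPow {n t : ℕ} (h : n ≤ t) (X : Matrix (Fin 4) (Fin 3) ℤ_[p])
    (c : Fin 3 → ℤ_[p]) : c ∈ repKernel h (modPow t X) ↔ ∀ i, (p : ℤ_[p]) ^ n ∣ (X *ᵥ c) i := by
  refine forall_congr' fun i => ?_
  rw [← toZModPow_mulVec, reduce_toZModPow, toZModPow_eq_zero_iff]

theorem smul_mem_repKernel {n t : ℕ} (h : n ≤ t) (X : Matrix (Fin 4) (Fin 3) (ZMod (p ^ t)))
    (c : Fin 3 → ℤ_[p]) : (p : ℤ_[p]) ^ n • c ∈ repKernel h X := by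
  obtain ⟨X, rfl⟩ := modPow_surjective t X
  rw [mem_repKernel_modPow]
  intro i
  rw [Matrix.mulVec_smul]
  exact dvd_mul_right _ _

variable {k k' : Matrix (Fin 3) (Fin 3) ℤ_[p]} {a : Fin 3 → ℕ} {n t : ℕ}
  {D : Submodule ℤ_[p] (Fin 3 → ℤ_[p])}

/-- The vector `k(p^{n-a_j} e_j)` lies in the kernel, so `pⁿ` divides `p^{n-a_j}` times the `j`-th
column of `Xk`. -/
theorem exists_factor (h : n ≤ t) (ha : ∀ i, a i ≤ n)
    (hD : ∀ c, k *ᵥ c ∈ D ↔ ∀ i, (p : ℤ_[p]) ^ (n - a i) ∣ c i)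
    {X : Matrix (Fin 4) (Fin 3) ℤ_[p]} (hX : repKernel h (modPow t X) = D) :
    ∃ Y : Matrix (Fin 4) (Fin 3) ℤ_[p], X * k = Y * powDiag p a := by
  have hp0 : (p : ℤ_[p]) ≠ 0 := by exact_mod_cast hp.out.ne_zero
  have key : ∀ i j, (p : ℤ_[p]) ^ a j ∣ (X * k) i j := by
    intro i j
    have h1 := (hD (Pi.single j ((p : ℤ_[p]) ^ (n - a j)))).2 (fun l => by
      by_cases hl : l = j
      · subst hl; simp
      · simp [hl])
    rw [← hX, mem_repKernel_modPow] at h1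
    have h2 := h1 i
    rw [Matrix.mulVec_mulVec, Matrix.mulVec_single] at h2
    have h3 : (p : ℤ_[p]) ^ n = p ^ (n - a j) * p ^ a j := by
      rw [← pow_add, Nat.sub_add_cancel (ha j)]
    simp only [Pi.smul_apply, Matrix.col_apply, MulOpposite.smul_eq_mul_unop,
      MulOpposite.unop_op] at h2
    rw [h3, mul_comm ((X * k) i j), mul_dvd_mul_iff_left (pow_ne_zero _ hp0)] at h2
    exact h2
  choose Y hY using key
  refine ⟨Matrix.of Y, ?_⟩
  ext i j
  rw [hY, powDiag, Matrix.mul_diagonal, Matrix.of_apply, mul_comm]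

theorem powDiag_mulVec (a : Fin 3 → ℕ) (c : Fin 3 → ℤ_[p]) :
    (powDiag p a) *ᵥ c = fun i => (p : ℤ_[p]) ^ a i * c i := by
  funext i
  rw [powDiag, Matrix.mulVec_diagonal]

/-- Apply `level_iff` to divisibility in `ℤ_p⁴`: the kernel is exactly `D`, not larger, when nothing
more than `p^a` can be divided out. -/
theorem repKernel_eq_iff (hkk : k * k' = 1) (h : n ≤ t) (ha : ∀ i, a i < n)
    (hD : ∀ c, k *ᵥ c ∈ D ↔ ∀ i, (p : ℤ_[p]) ^ (n - a i) ∣ c i)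
    {X Y : Matrix (Fin 4) (Fin 3) ℤ_[p]}
    (hXY : modPow t (X * k) = modPow t (Y * powDiag p a)) :
    repKernel h (modPow t X) = D ↔ PrimMod Y := by
  have hp0 : (p : ℤ_[p]) ≠ 0 := by exact_mod_cast hp.out.ne_zero
  have hmem : ∀ c, k *ᵥ c ∈ repKernel h (modPow t X) ↔
      ∀ i, (p : ℤ_[p]) ^ n ∣ (Y *ᵥ fun i => (p : ℤ_[p]) ^ a i * c i) i := by
    intro c
    rw [← powDiag_mulVec, Matrix.mulVec_mulVec, ← mem_repKernel_modPow h, ← hXY,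
      mem_repKernel_modPow, mem_repKernel_modPow, Matrix.mulVec_mulVec]
  have hlev := level_iff (p := p) (W := fun m d => ∀ i, (p : ℤ_[p]) ^ m ∣ (Y *ᵥ d) i)
    (fun d i => by simp) (fun m d => by
      refine forall_congr' fun i => ?_
      rw [Matrix.mulVec_smul, Pi.smul_apply, smul_eq_mul, pow_succ', mul_dvd_mul_iff_left hp0])
    (fun m d hd i => (pow_dvd_pow _ (by omega)).trans (hd i)) ha
  simp only [pow_one] at hlev
  rw [PrimMod, ← hlev]
  constructor
  · rintro rfl c
    rw [← hmem, hD]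
  · intro hc
    ext c
    have : c = k *ᵥ (k' *ᵥ c) := by rw [Matrix.mulVec_mulVec, hkk, Matrix.one_mulVec]
    rw [this, hmem, hc, hD]

/-- Since `a_i + a_j ≤ 2n < t`, the factorization of `Xk` through `p^a` makes the entries of `kᵗTk`
divisible, although the equation holds only modulo `p^t`. -/
theorem dvd_of_repKernel_eq (h : 2 * n < t) (ha : ∀ i, a i ≤ n)
    (hD : ∀ c, k *ᵥ c ∈ D ↔ ∀ i, (p : ℤ_[p]) ^ (n - a i) ∣ c i)
    {S : Matrix (Fin 4) (Fin 4) ℤ_[p]} {T : Matrix (Fin 3) (Fin 3) ℤ_[p]}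
    {X : Matrix (Fin 4) (Fin 3) (ZMod (p ^ t))} (hXT : Xᵀ * modPow t S * X = modPow t T)
    (hX : repKernel (by omega : n ≤ t) X = D) (i j : Fin 3) :
    (p : ℤ_[p]) ^ (a i + a j) ∣ (kᵀ * T * k) i j := by
  obtain ⟨X, rfl⟩ := modPow_surjective t X
  obtain ⟨Y, hY⟩ := exists_factor _ ha hD hX
  have h1 : modPow t (powDiag p a * (Yᵀ * S * Y) * powDiag p a) = modPow t (kᵀ * T * k) := by
    have h2 : powDiag p a * (Yᵀ * S * Y) * powDiag p a =
        kᵀ * (Xᵀ * S * X) * k := by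
      calc _ = (Y * powDiag p a)ᵀ * S * (Y * powDiag p a) := by
            rw [Matrix.transpose_mul, powDiag, Matrix.diagonal_transpose]
            simp only [Matrix.mul_assoc]
        _ = _ := by
            rw [← hY, Matrix.transpose_mul]
            simp only [Matrix.mul_assoc]
    rw [h2, modPow_mul, modPow_mul, modPow_mul _ (Xᵀ * S), modPow_mul, modPow_transpose t X, hXT,
      ← modPow_mul, ← modPow_mul]
  have h3 := (modPow_eq_iff _ _ _).1 h1 i j
  rw [powDiag_conj_apply] at h3
  have h4 : (p : ℤ_[p]) ^ (a i + a j) ∣ p ^ t := pow_dvd_pow _ (by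
    have := ha i; have := ha j; omega)
  exact (dvd_sub_right (dvd_mul_right _ _)).1 (h4.trans h3)

/-- The substitution `X ↦ Xk` turns the solutions with kernel `D` into products `Y p^a` with `Y`
primitive, to which `card_scaled_primRep` applies. -/
theorem card_repKernel_eq (hp2 : p ≠ 2) (h : 2 * n < t) (ha : ∀ i, a i < n) (hkk : k * k' = 1)
    (hkk' : k' * k = 1)
    (hD : ∀ c, k *ᵥ c ∈ D ↔ ∀ i, (p : ℤ_[p]) ^ (n - a i) ∣ c i)
    {S S' : Matrix (Fin 4) (Fin 4) ℤ_[p]} (hS : S.IsSymm) (hSS : S * S' = 1)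
    {T T' : Matrix (Fin 3) (Fin 3) ℤ_[p]} (hT' : T'.IsSymm)
    (hTT : powDiag p a * T' * powDiag p a = kᵀ * T * k) :
    Nat.card {X : Matrix (Fin 4) (Fin 3) (ZMod (p ^ t)) //
        Xᵀ * modPow t S * X = modPow t T ∧ repKernel (by omega : n ≤ t) X = D} =
      (p ^ 6) ^ (t - 1) * Nat.card (PrimRep (modPow 1 S) (modPow 1 T')) := by
  have ht1 : 1 ≤ t := by omega
  rw [← card_scaled_primRep hp2 hS hSS hT' (a := a) (t := t) (fun i j => by
    have := ha i; have := ha j; omega)]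
  have e1 : modPow t k * modPow t k' = 1 := by rw [← modPow_mul, hkk, modPow_one]
  have e2 : modPow t k' * modPow t k = 1 := by rw [← modPow_mul, hkk', modPow_one]
  let e : Matrix (Fin 4) (Fin 3) (ZMod (p ^ t)) ≃ Matrix (Fin 4) (Fin 3) (ZMod (p ^ t)) :=
    { toFun := fun X => X * modPow t k
      invFun := fun X => X * modPow t k'
      left_inv := fun X => by beta_reduce; rw [Matrix.mul_assoc, e1, Matrix.mul_one]
      right_inv := fun X => by beta_reduce; rw [Matrix.mul_assoc, e2, Matrix.mul_one] }
  refine Nat.card_congr (e.subtypeEquiv fun X => and_congr ?_ ?_)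
  · change _ ↔ (X * modPow t k)ᵀ * modPow t S * (X * modPow t k) = _
    have h1 : (X * modPow t k)ᵀ * modPow t S * (X * modPow t k) =
        (modPow t k)ᵀ * (Xᵀ * modPow t S * X) * modPow t k := by
      rw [Matrix.transpose_mul]; simp only [Matrix.mul_assoc]
    rw [h1, hTT, modPow_mul, modPow_mul, modPow_transpose]
    constructor
    · intro h2; rw [h2]
    · intro h2
      have e3 : (modPow t k')ᵀ * (modPow t k)ᵀ = 1 := by
        rw [← Matrix.transpose_mul, e1, Matrix.transpose_one]
      have h3 := congrArg (fun Z => (modPow t k')ᵀ * Z * modPow t k') h2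
      simp only [Matrix.mul_assoc, e1, Matrix.mul_one] at h3
      simp only [← Matrix.mul_assoc, e3, Matrix.one_mul] at h3
      exact h3
  · change _ ↔ ∃ Y, IsPrim Y ∧ X * modPow t k = Y * modPow t (powDiag p a)
    obtain ⟨X, rfl⟩ := modPow_surjective t X
    constructor
    · intro hX
      obtain ⟨Y, hY⟩ := exists_factor _ (fun i => (ha i).le) hD hX
      refine ⟨modPow t Y, ?_, by rw [← modPow_mul, hY, modPow_mul]⟩
      rw [isPrim_modPow_iff ht1]
      exact (repKernel_eq_iff hkk _ ha hD (by rw [hY])).1 hX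
    · rintro ⟨Y, hY, hXY⟩
      obtain ⟨Y, rfl⟩ := modPow_surjective t Y
      rw [isPrim_modPow_iff ht1] at hY
      exact (repKernel_eq_iff hkk _ ha hD (by rw [modPow_mul, hXY, modPow_mul])).2 hY

end RepKernel

/-! ### Stable vertices sorted by divisibility of the tuple. -/

section VertexKernel

variable {p : ℕ} [hp : Fact p.Prime] {Δ : ℤ_[p]ˣ} [Fact (p ≠ 2)] [Fact (¬ IsSquare (Δ : ℤ_[p]))]
  {U : Type*} [AddCommGroup U] [Module (Qp2 p Δ) U]
  [Module ℚ_[p] U] [IsScalarTower ℚ_[p] (Qp2 p Δ) U]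
  {B : LinearMap.BilinForm (Qp2 p Δ) U}

theorem Building.Stable.add {b : Building Δ U} {β γ : SpecialEnd B} (hβ : b.Stable β)
    (hγ : b.Stable γ) : b.Stable (β + γ) := by
  induction b using Quotient.inductionOn
  exact SpecialTree.Stable.add hβ hγ

theorem Building.Stable.smul {b : Building Δ U} {β : SpecialEnd B} (hβ : b.Stable β) {c : ℚ_[p]}
    (hc : ‖c‖ ≤ 1) : b.Stable (c • β) := by
  induction b using Quotient.inductionOn
  exact SpecialTree.Stable.smul hβ hc

theorem Building.Stable.zero (b : Building Δ U) : b.Stable (0 : SpecialEnd B) := by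
  induction b using Quotient.inductionOn
  exact SpecialTree.Stable.zero

theorem Building.Stable.sum {b : Building Δ U} {ι : Type*} [Fintype ι] {β : ι → SpecialEnd B}
    (h : ∀ i, b.Stable (β i)) : b.Stable (∑ i, β i) := by
  induction b using Quotient.inductionOn
  exact SpecialTree.Stable.sum _ fun i _ => h i

/-- The integral combination `∑ c_i β_i`. -/
def intComb (c : Fin 3 → ℤ_[p]) (β : Fin 3 → SpecialEnd B) : SpecialEnd B :=
  ∑ i, ((c i : ℤ_[p]) : ℚ_[p]) • β i

theorem intComb_add (c d : Fin 3 → ℤ_[p]) (β : Fin 3 → SpecialEnd B) :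
    intComb (c + d) β = intComb c β + intComb d β := by
  simp [intComb, add_smul, Finset.sum_add_distrib]

theorem intComb_smul (r : ℤ_[p]) (c : Fin 3 → ℤ_[p]) (β : Fin 3 → SpecialEnd B) :
    intComb (r • c) β = (r : ℚ_[p]) • intComb c β := by
  simp [intComb, Finset.smul_sum, smul_smul]

theorem intComb_single (i : Fin 3) (r : ℤ_[p]) (β : Fin 3 → SpecialEnd B) :
    intComb (Pi.single i r) β = (r : ℚ_[p]) • β i := by
  rw [intComb, Finset.sum_eq_single i]
  · simp
  · intro j _ hj; simp [hj]
  · intro h; exact absurd (Finset.mem_univ i) h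

theorem Building.Stable.intComb {b : Building Δ U} {β : Fin 3 → SpecialEnd B}
    (h : ∀ i, b.Stable (β i)) (c : Fin 3 → ℤ_[p]) : b.Stable (intComb c β) :=
  Building.Stable.sum fun i => (h i).smul (PadicInt.norm_le_one _)

/-- The vectors `c` such that `∑ c_i β_i` is divisible by `p^n` in the stabilizer of `b`. -/
def vertexKernel (n : ℕ) (β : Fin 3 → SpecialEnd B) (b : Building Δ U) :
    Submodule ℤ_[p] (Fin 3 → ℤ_[p]) where
  carrier := {c | b.Stable (((p : ℚ_[p]) ^ n)⁻¹ • intComb c β)}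
  add_mem' := by
    intro c d hc hd
    change b.Stable _
    rw [intComb_add, smul_add]
    exact Building.Stable.add hc hd
  zero_mem' := by
    change b.Stable _
    have : intComb (0 : Fin 3 → ℤ_[p]) β = 0 := by simp [intComb]
    rw [this, smul_zero]
    exact Building.Stable.zero b
  smul_mem' := by
    intro r c hc
    change b.Stable _
    rw [intComb_smul, smul_comm]
    exact Building.Stable.smul hc (PadicInt.norm_le_one _)

theorem mem_vertexKernel (n : ℕ) (β : Fin 3 → SpecialEnd B) (b : Building Δ U)
    (c : Fin 3 → ℤ_[p]) :
    c ∈ vertexKernel n β b ↔ b.Stable (((p : ℚ_[p]) ^ n)⁻¹ • intComb c β) := Iff.rfl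

theorem padic_p_ne_zero : (p : ℚ_[p]) ≠ 0 := by exact_mod_cast hp.out.ne_zero

theorem inv_pow_smul_intComb (n : ℕ) (c : Fin 3 → ℤ_[p]) (β : Fin 3 → SpecialEnd B) :
    ((p : ℚ_[p]) ^ n)⁻¹ • intComb ((p : ℤ_[p]) ^ n • c) β = intComb c β := by
  rw [intComb_smul, PadicInt.coe_pow, PadicInt.coe_natCast,
    inv_smul_smul₀ (pow_ne_zero _ padic_p_ne_zero)]

theorem smul_mem_vertexKernel (n : ℕ) {β : Fin 3 → SpecialEnd B} {b : Building Δ U}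
    (h : ∀ i, b.Stable (β i)) (c : Fin 3 → ℤ_[p]) : (p : ℤ_[p]) ^ n • c ∈ vertexKernel n β b := by
  rw [mem_vertexKernel, inv_pow_smul_intComb]
  exact Building.Stable.intComb h c

/-- The tuple `p^{-a} kᵀ β`. -/
def scaledTuple (k : Matrix (Fin 3) (Fin 3) ℤ_[p]) (a : Fin 3 → ℕ) (β : Fin 3 → SpecialEnd B) :
    Fin 3 → SpecialEnd B :=
  fun i => ((p : ℚ_[p]) ^ a i)⁻¹ • intComb (fun j => k j i) β

variable {k k' : Matrix (Fin 3) (Fin 3) ℤ_[p]} {a : Fin 3 → ℕ} {n : ℕ}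
  {D : Submodule ℤ_[p] (Fin 3 → ℤ_[p])} {β : Fin 3 → SpecialEnd B}

theorem intComb_mulVec (c : Fin 3 → ℤ_[p]) : intComb (k *ᵥ c) β =
    intComb (fun i => (p : ℤ_[p]) ^ a i * c i) (scaledTuple k a β) := by
  have h1 : ∀ i, (((p : ℤ_[p]) ^ a i * c i : ℤ_[p]) : ℚ_[p]) • scaledTuple k a β i =
      (c i : ℚ_[p]) • intComb (fun j => k j i) β := fun i => by
    rw [scaledTuple, smul_smul, PadicInt.coe_mul, PadicInt.coe_pow, PadicInt.coe_natCast,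
      mul_comm ((p : ℚ_[p]) ^ a i), mul_assoc, mul_inv_cancel₀ (pow_ne_zero _ padic_p_ne_zero),
      mul_one]
  rw [intComb, intComb, Finset.sum_congr rfl fun i _ => h1 i]
  simp only [intComb, Finset.smul_sum, smul_smul]
  rw [Finset.sum_comm]
  refine Finset.sum_congr rfl fun i _ => ?_
  rw [← Finset.sum_smul]
  congr 1
  simp [Matrix.mulVec, dotProduct, mul_comm]

theorem gram_scaledTuple [Nontrivial U] (hsq : SqSpec B) (T : Matrix (Fin 3) (Fin 3) ℤ_[p])
    (hβ : gram β = T.map (fun z : ℤ_[p] => (z : ℚ_[p]))) (i j : Fin 3) :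
    (p : ℚ_[p]) ^ (a i + a j) * gram (scaledTuple k a β) i j =
      (((kᵀ * T * k) i j : ℤ_[p]) : ℚ_[p]) := by
  have h1 : specialBil hsq (intComb (fun l => k l i) β) (intComb (fun l => k l j) β) =
      (((kᵀ * T * k) i j : ℤ_[p]) : ℚ_[p]) := by
    have h2 : ∀ l m, specialBil hsq (β l) (β m) = ((T l m : ℤ_[p]) : ℚ_[p]) := fun l m => by
      rw [← gram_apply, hβ]; rfl
    simp only [intComb, Matrix.mul_apply, Matrix.transpose_apply, Fin.sum_univ_three, map_add,
      LinearMap.add_apply, map_smul, LinearMap.smul_apply, h2, smul_eq_mul]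
    push_cast
    ring
  rw [gram_apply hsq, ← h1, scaledTuple, scaledTuple, map_smul, map_smul, LinearMap.smul_apply,
    smul_eq_mul, smul_eq_mul, pow_add]
  have h3 : ∀ m, (p : ℚ_[p]) ^ m ≠ 0 := fun m => pow_ne_zero _ padic_p_ne_zero
  field_simp [h3]

theorem stable_scaledTuple {b : Building Δ U} (ha : ∀ i, a i ≤ n)
    (hD : ∀ c, k *ᵥ c ∈ D ↔ ∀ i, (p : ℤ_[p]) ^ (n - a i) ∣ c i) (hb : vertexKernel n β b = D)
    (i : Fin 3) : b.Stable (scaledTuple k a β i) := by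
  have h1 := (hD (Pi.single i ((p : ℤ_[p]) ^ (n - a i)))).2 (fun l => by
      by_cases hl : l = i
      · subst hl; simp
      · simp [hl])
  rw [← hb, mem_vertexKernel, intComb_mulVec (a := a)] at h1
  have h2 : (fun l => (p : ℤ_[p]) ^ a l * (Pi.single i ((p : ℤ_[p]) ^ (n - a i)) : Fin 3 → ℤ_[p]) l)
      = (p : ℤ_[p]) ^ n • Pi.single i 1 := by
    funext l
    by_cases hl : l = i
    · subst hl
      simp only [Pi.single_eq_same, Pi.smul_apply, smul_eq_mul, mul_one]
      rw [← pow_add, Nat.add_sub_cancel' (ha l)]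
    · simp [hl]
  rwa [h2, inv_pow_smul_intComb, intComb_single, PadicInt.coe_one, one_smul] at h1

/-- The counterpart of `repKernel_eq_iff`: `level_iff` is applied to divisibility by `p^m` in the
stabilizer of `b` in place of `ℤ_p⁴`. -/
theorem vertexKernel_eq_iff [Nontrivial U] (hkk : k * k' = 1) (ha : ∀ i, a i < n)
    (hD : ∀ c, k *ᵥ c ∈ D ↔ ∀ i, (p : ℤ_[p]) ^ (n - a i) ∣ c i) {b : Building Δ U}
    (hb : b.IsVertex) :
    ((∀ i, b.Stable (β i)) ∧ vertexKernel n β b = D) ↔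
      b ∈ primitiveVertices (scaledTuple k a β) := by
  have hlev : (∀ i, b.Stable (scaledTuple k a β i)) →
      ((∀ c : Fin 3 → ℤ_[p], b.Stable (((p : ℚ_[p]) ^ n)⁻¹ •
        intComb (fun i => (p : ℤ_[p]) ^ a i * c i) (scaledTuple k a β)) ↔
        ∀ i, (p : ℤ_[p]) ^ (n - a i) ∣ c i) ↔ ∀ c : Fin 3 → ℤ_[p],
        b.Stable ((p : ℚ_[p])⁻¹ • ∑ i, ((c i : ℤ_[p]) : ℚ_[p]) • scaledTuple k a β i) →
        ∀ i, (p : ℤ_[p]) ∣ c i) := by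
    intro hs
    have h := level_iff (p := p)
      (W := fun m d => b.Stable (((p : ℚ_[p]) ^ m)⁻¹ • intComb d (scaledTuple k a β)))
      (fun d => by
        simp only [pow_zero, inv_one, one_smul]
        exact Building.Stable.intComb hs d)
      (fun m d => by
        have : ((p : ℚ_[p]) ^ (m + 1))⁻¹ • intComb ((p : ℤ_[p]) • d) (scaledTuple k a β) =
            ((p : ℚ_[p]) ^ m)⁻¹ • intComb d (scaledTuple k a β) := by
          rw [intComb_smul, smul_smul, PadicInt.coe_natCast, pow_succ, mul_inv, mul_assoc,
            inv_mul_cancel₀ padic_p_ne_zero, mul_one]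
        rw [this])
      (fun m d hd => by
        have : ((p : ℚ_[p]) ^ 1)⁻¹ • intComb d (scaledTuple k a β) = (p : ℚ_[p]) ^ m •
            ((p : ℚ_[p]) ^ (m + 1))⁻¹ • intComb d (scaledTuple k a β) := by
          rw [smul_smul, pow_succ' _ m, mul_inv, mul_left_comm, pow_one,
            mul_inv_cancel₀ (pow_ne_zero _ padic_p_ne_zero), mul_one]
        rw [this]
        refine hd.smul ?_
        rw [norm_pow]
        exact pow_le_one₀ (norm_nonneg _) Padic.norm_p_lt_one.le) ha
    simp only [pow_one] at h
    exact h
  constructor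
  · rintro ⟨hs, hk⟩
    have hs' := stable_scaledTuple (fun i => (ha i).le) hD hk
    refine ⟨hb, hs', (hlev hs').1 fun c => ?_⟩
    rw [← intComb_mulVec, ← mem_vertexKernel, hk, hD]
  · rintro ⟨-, hs', hprim⟩
    have h1 := (hlev hs').2 hprim
    have hc : ∀ c, c = k *ᵥ (k' *ᵥ c) := fun c => by
      rw [Matrix.mulVec_mulVec, hkk, Matrix.one_mulVec]
    constructor
    · intro i
      have h2 : β i = intComb (Pi.single i 1) β := by
        rw [intComb_single, PadicInt.coe_one, one_smul]
      rw [h2, hc (Pi.single i 1), intComb_mulVec (a := a)]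
      exact Building.Stable.intComb hs' _
    · ext c
      rw [hc c, hD, ← h1, mem_vertexKernel, intComb_mulVec]

end VertexKernel

/-! ### Diagonalization of symmetric matrices over `ℤ_p`. -/

section Diagonalize

variable {p : ℕ} [hp : Fact p.Prime]

theorem dvd_total_padic (x y : ℤ_[p]) : x ∣ y ∨ y ∣ x := by
  have := ValuationRing.dvd_total x y
  exact this

/-- Choose `v` with `Φ(v,v)` of least valuation. As `2` is a unit, polarization shows that `Φ(v,v)`
divides all values of `Φ`, so `v` splits off as an orthogonal summand. The minimal choice also
yields the divisibility chain. -/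
theorem exists_orthogonal_basis (hp2 : p ≠ 2) (n : ℕ) : ∀ {M : Type} [AddCommGroup M]
    [Module ℤ_[p] M] (_b : Module.Basis (Fin n) ℤ_[p] M) (Φ : LinearMap.BilinForm ℤ_[p] M)
    (_hΦ : ∀ x y, Φ x y = Φ y x), ∃ b' : Module.Basis (Fin n) ℤ_[p] M,
      (∀ i j, i ≠ j → Φ (b' i) (b' j) = 0) ∧
      ∀ i j, i ≤ j → Φ (b' i) (b' i) ∣ Φ (b' j) (b' j) := by
  have : Fact (p ≠ 2) := ⟨hp2⟩
  induction n with
  | zero => intro M _ _ b Φ _; exact ⟨b, fun i => i.elim0, fun i => i.elim0⟩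
  | succ n ih =>
    intro M _ _ b Φ hΦ
    obtain ⟨u, hu⟩ := isUnit_two (p := p)
    by_cases h0 : ∀ x, Φ x x = 0
    · have hpol : ∀ x y, Φ x y = 0 := fun x y => by
        have h1 := h0 (x + y)
        simp only [map_add, LinearMap.add_apply, h0, hΦ y x, zero_add, add_zero] at h1
        rw [← two_mul] at h1
        exact (mul_eq_zero.1 h1).resolve_left two_ne_zero
      exact ⟨b, fun i j _ => hpol _ _, fun i j _ => by rw [hpol, hpol]⟩
    push Not at h0
    obtain ⟨v, hv0, hv⟩ : ∃ v, Φ v v ≠ 0 ∧ ∀ x, Φ v v ∣ Φ x x := by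
      obtain ⟨x, hx⟩ := h0
      have hne : ∃ m : ℕ, ∃ x, Φ x x ≠ 0 ∧ (Φ x x).valuation = m := ⟨_, x, hx, rfl⟩
      classical
      obtain ⟨v, hv0, hv⟩ := Nat.find_spec hne
      refine ⟨v, hv0, fun y => ?_⟩
      rcases dvd_total_padic (Φ v v) (Φ y y) with h | ⟨c, hc⟩
      · exact h
      · have hy0 : Φ y y ≠ 0 := by rintro h; rw [h, zero_mul] at hc; exact hv0 hc
        have hc0 : c ≠ 0 := by rintro rfl; rw [mul_zero] at hc; exact hv0 hc
        have h1 : Nat.find hne ≤ (Φ y y).valuation := Nat.find_min' hne ⟨y, hy0, rfl⟩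
        have h2 := PadicInt.valuation_mul hy0 hc0
        rw [← hc, hv] at h2
        have h3 : c.valuation = 0 := by omega
        have h4 : IsUnit c := by
          rw [PadicInt.isUnit_iff, PadicInt.norm_eq_zpow_neg_valuation hc0, h3]; simp
        exact (Associated.symm ⟨h4.unit, by rw [IsUnit.unit_spec, hc]⟩).dvd
    have hpol : ∀ x y, Φ v v ∣ Φ x y := fun x y => by
      have h1 : Φ (x + y) (x + y) - Φ x x - Φ y y = 2 * Φ x y := by
        simp only [map_add, LinearMap.add_apply, hΦ y x]; ring
      have h2 : Φ v v ∣ (u : ℤ_[p]) * Φ x y := by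
        rw [hu, ← h1]; exact dvd_sub (dvd_sub (hv _) (hv _)) (hv _)
      exact (Units.dvd_mul_left).1 h2
    let N : Submodule ℤ_[p] M := LinearMap.ker (Φ v)
    obtain ⟨m, bN⟩ := Submodule.basisOfPid b N
    have hli : ∀ (c : ℤ_[p]), ∀ x ∈ N, c • v + x = 0 → c = 0 := by
      intro c x hx h
      have h1 := congrArg (Φ v) h
      rw [map_add, map_smul, LinearMap.mem_ker.1 hx, add_zero, map_zero, smul_eq_mul] at h1
      exact (mul_eq_zero.1 h1).resolve_right hv0
    have hsp : ∀ z, ∃ c : ℤ_[p], z + c • v ∈ N := by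
      intro z
      obtain ⟨c, hc⟩ := hpol v z
      refine ⟨-c, ?_⟩
      rw [LinearMap.mem_ker, map_add, map_smul, hc, smul_eq_mul]
      ring
    obtain rfl : m = n := by
      have h1 := Module.finrank_eq_card_basis (Module.Basis.mkFinCons v bN hli hsp)
      have h2 := Module.finrank_eq_card_basis b
      rw [h1] at h2
      simpa using h2
    obtain ⟨bN', ho, hd⟩ := ih bN (Φ.restrict N) (fun x y => hΦ _ _)
    refine ⟨Module.Basis.mkFinCons v bN' hli hsp, fun i j => ?_, fun i j => ?_⟩
    · simp only [Module.Basis.coe_mkFinCons]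
      refine Fin.cases ?_ (fun i => ?_) i <;> refine Fin.cases ?_ (fun j => ?_) j
      · intro h; exact absurd rfl h
      · intro _; exact (bN' j).2
      · intro _; rw [hΦ]; exact (bN' i).2
      · intro h; exact ho i j fun hij => h (by rw [hij])
    · simp only [Module.Basis.coe_mkFinCons]
      refine Fin.cases ?_ (fun i => ?_) i <;> refine Fin.cases ?_ (fun j => ?_) j
      · intro _; rfl
      · intro _; exact hv _
      · intro h; exact absurd h (by simp)
      · intro h; exact hd i j (by simpa using h)

theorem exists_diagonalization (hp2 : p ≠ 2) {n : ℕ} {T : Matrix (Fin n) (Fin n) ℤ_[p]}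
    (hT : T.IsSymm) : ∃ (k k' : Matrix (Fin n) (Fin n) ℤ_[p]) (t : Fin n → ℤ_[p]),
      k * k' = 1 ∧ k' * k = 1 ∧ kᵀ * T * k = Matrix.diagonal t ∧ ∀ i j, i ≤ j → t i ∣ t j := by
  have hΦ : ∀ x y : Fin n → ℤ_[p], Matrix.toBilin' T x y = x ⬝ᵥ T *ᵥ y :=
    fun x y => Matrix.toBilin'_apply' _ _ _
  obtain ⟨b, ho, hd⟩ := exists_orthogonal_basis hp2 n (Pi.basisFun ℤ_[p] (Fin n))
    (Matrix.toBilin' T) (fun x y => by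
      rw [hΦ, hΦ, Matrix.dotProduct_mulVec, ← Matrix.mulVec_transpose, hT.eq, dotProduct_comm])
  obtain ⟨k', h1, h2⟩ := basisMatrix_inverse b
  refine ⟨_, k', fun i => Matrix.toBilin' T (b i) (b i), h1, h2, ?_, hd⟩
  ext i j
  have h3 : ((basisMatrix b)ᵀ * T * basisMatrix b) i j = Matrix.toBilin' T (b i) (b j) := by
    rw [hΦ, Matrix.mul_assoc, Matrix.mul_apply]
    simp only [dotProduct, Matrix.mulVec, Matrix.mul_apply, basisMatrix, Matrix.transpose_apply,
      Matrix.of_apply]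
  rw [h3, Matrix.diagonal_apply]
  split_ifs with h
  · rw [h]
  · exact ho i j h

end Diagonalize

/-! ### Square classes of units. -/

section Squares

variable {p : ℕ} [hp : Fact p.Prime] [hp2 : Fact (p ≠ 2)]

instance : Fact (p ^ 1).Prime := ⟨by simpa using hp.out⟩

theorem toZModPow_one_ne_zero_iff (x : ℤ_[p]) : PadicInt.toZModPow 1 x ≠ 0 ↔ IsUnit x := by
  rw [Ne, toZModPow_eq_zero_iff, pow_one, ← PadicInt.norm_lt_one_iff_dvd, not_lt,
    PadicInt.isUnit_iff]
  exact ⟨fun h => le_antisymm (PadicInt.norm_le_one _) h, fun h => h.ge⟩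

theorem isSquare_toZModPow_one_iff {w : ℤ_[p]} (hw : IsUnit w) :
    IsSquare (PadicInt.toZModPow 1 w) ↔ IsSquare w := by
  refine ⟨?_, fun h => h.map _⟩
  rintro ⟨u, hu⟩
  obtain ⟨u, rfl⟩ := toZModPow_surjective 1 u
  refine isSquare_of_norm_sub_lt_one hw (u := u) ?_
  rw [PadicInt.norm_lt_one_iff_dvd, ← pow_one (p : ℤ_[p]), ← toZModPow_eq_iff, sq, map_mul, hu]

theorem two_ne_zero_zmod : (2 : ZMod (p ^ 1)) ≠ 0 := by
  have := (toZModPow_one_ne_zero_iff (2 : ℤ_[p])).2 isUnit_two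
  rwa [map_ofNat] at this

theorem isSquare_mul_of_not_isSquare {F : Type*} [Field F] [Fintype F]
    {a b : F} (ha : ¬ IsSquare a) (hb : ¬ IsSquare b) : IsSquare (a * b) := by
  classical
  have hF : ringChar F ≠ 2 := fun h => ha (FiniteField.isSquare_of_char_two h a)
  have ha0 : a ≠ 0 := by rintro rfl; exact ha IsSquare.zero
  have hb0 : b ≠ 0 := by rintro rfl; exact hb IsSquare.zero
  rw [← quadraticChar_one_iff_isSquare (mul_ne_zero ha0 hb0), map_mul,
    (quadraticChar_neg_one_iff_not_isSquare).2 ha, (quadraticChar_neg_one_iff_not_isSquare).2 hb]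
  norm_num

/-- Units have only two square classes. So `-t₀t₁` is either a square or `Δ` times a square, which
are the two cases of the vertex count. -/
theorem isSquare_mul_unit {Δ : ℤ_[p]ˣ} (hΔ : ¬ IsSquare (Δ : ℤ_[p])) {w : ℤ_[p]} (hw : IsUnit w)
    (h : ¬ IsSquare w) : IsSquare (w * Δ) := by
  rw [← isSquare_toZModPow_one_iff (hw.mul Δ.isUnit), map_mul]
  rw [← isSquare_toZModPow_one_iff hw] at h
  rw [← isSquare_toZModPow_one_iff Δ.isUnit] at hΔ
  exact isSquare_mul_of_not_isSquare h hΔ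

end Squares

/-! ### Primitive vertices against primitive representations over `𝔽_p`. -/

section PrimitiveCount

theorem map_modelMatrix {R R' : Type*} [CommRing R] [CommRing R'] (f : R →+* R') (d : R) :
    (modelMatrix d).map f = modelMatrix (f d) := by
  ext i j
  fin_cases i <;> fin_cases j <;> simp [modelMatrix]

theorem card_primRep_congr {R : Type*} [CommRing R] {m n : ℕ} (S : Matrix (Fin m) (Fin m) R)
    (T : Matrix (Fin n) (Fin n) R) {k k' : Matrix (Fin n) (Fin n) R} (hkk : k * k' = 1)
    (hkk' : k' * k = 1) : Nat.card (PrimRep S T) = Nat.card (PrimRep S (kᵀ * T * k)) := by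
  refine Nat.card_congr
    { toFun := fun X => ⟨X.1 * k, ?_, ?_⟩
      invFun := fun X => ⟨X.1 * k', ?_, ?_⟩
      left_inv := fun X => Subtype.ext ?_
      right_inv := fun X => Subtype.ext ?_ }
  · obtain ⟨C, hC⟩ := X.2.1
    exact ⟨k' * C, by rw [Matrix.mul_assoc, ← Matrix.mul_assoc C, hC, Matrix.one_mul, hkk']⟩
  · have h1 : (X.1 * k)ᵀ * S * (X.1 * k) = kᵀ * (X.1ᵀ * S * X.1) * k := by
      rw [Matrix.transpose_mul]; simp only [Matrix.mul_assoc]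
    rw [h1, X.2.2]
  · obtain ⟨C, hC⟩ := X.2.1
    exact ⟨k * C, by rw [Matrix.mul_assoc, ← Matrix.mul_assoc C, hC, Matrix.one_mul, hkk]⟩
  · have h1 : (X.1 * k')ᵀ * S * (X.1 * k') = k'ᵀ * (X.1ᵀ * S * X.1) * k' := by
      rw [Matrix.transpose_mul]; simp only [Matrix.mul_assoc]
    have h2 : k'ᵀ * kᵀ = 1 := by rw [← Matrix.transpose_mul, hkk, Matrix.transpose_one]
    rw [h1, X.2.2]
    simp only [Matrix.mul_assoc, hkk, Matrix.mul_one]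
    rw [← Matrix.mul_assoc, h2, Matrix.one_mul]
  · change X.1 * k * k' = X.1
    rw [Matrix.mul_assoc, hkk, Matrix.mul_one]
  · change X.1 * k' * k = X.1
    rw [Matrix.mul_assoc, hkk', Matrix.mul_one]

variable {p : ℕ} [hp : Fact p.Prime] {Δ : ℤ_[p]ˣ} [hp2 : Fact (p ≠ 2)]
  [hΔ : Fact (¬ IsSquare (Δ : ℤ_[p]))]
  {U : Type*} [AddCommGroup U] [Module (Qp2 p Δ) U]
  [Module ℚ_[p] U] [IsScalarTower ℚ_[p] (Qp2 p Δ) U]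
  {B : LinearMap.BilinForm (Qp2 p Δ) U} [Nontrivial U]

/-- For `n = 1` and `a = 0`, primitivity says that the kernel is `p ℤ_p³`, a module preserved by
every invertible matrix. So `vertexKernel_eq_iff` may be used for `k` and for `1` alike. -/
theorem primitiveVertices_scaledTuple_zero {k k' : Matrix (Fin 3) (Fin 3) ℤ_[p]}
    (hkk : k * k' = 1) (hkk' : k' * k = 1) (β : Fin 3 → SpecialEnd B) :
    primitiveVertices (scaledTuple k (fun _ => 0) β) = primitiveVertices β := by
  let D : Submodule ℤ_[p] (Fin 3 → ℤ_[p]) :=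
    { carrier := {c | ∀ i, (p : ℤ_[p]) ∣ c i}
      add_mem' := fun hc hd i => dvd_add (hc i) (hd i)
      zero_mem' := fun i => dvd_zero _
      smul_mem' := fun r c hc i => (hc i).mul_left _ }
  have hmul : ∀ (k : Matrix (Fin 3) (Fin 3) ℤ_[p]) c, c ∈ D → k *ᵥ c ∈ D := fun k c hc i => by
    rw [Matrix.mulVec, dotProduct]
    exact Finset.dvd_sum fun j _ => (hc j).mul_left _
  have hD : ∀ {k k' : Matrix (Fin 3) (Fin 3) ℤ_[p]}, k' * k = 1 →
      ∀ c, k *ᵥ c ∈ D ↔ ∀ i, (p : ℤ_[p]) ^ (1 - 0) ∣ c i := by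
    intro k k' hkk' c
    simp only [Nat.sub_zero, pow_one]
    refine ⟨fun h => ?_, fun h => hmul k c h⟩
    have := hmul k' _ h
    rwa [Matrix.mulVec_mulVec, hkk', Matrix.one_mulVec] at this
  have h1 : scaledTuple (1 : Matrix (Fin 3) (Fin 3) ℤ_[p]) (fun _ => 0) β = β := by
    funext i
    have h2 : (fun j => (1 : Matrix (Fin 3) (Fin 3) ℤ_[p]) j i) = Pi.single i 1 := by
      funext j
      simp [Matrix.one_apply, Pi.single_apply]
    rw [scaledTuple, h2, intComb_single]
    simp
  ext b
  by_cases hb : b.IsVertex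
  · rw [← vertexKernel_eq_iff hkk (fun _ => one_pos) (hD hkk') hb,
      vertexKernel_eq_iff (mul_one 1) (fun _ => one_pos) (hD (mul_one 1)) hb, h1]
  · exact ⟨fun h => absurd h.1 hb, fun h => absurd h.1 hb⟩

/-- A primitive vertex yields a primitive representation. -/
theorem exists_primRep (hU : Module.finrank (Qp2 p Δ) U = 2) (hsq : SqSpec B) (hB : B.IsAlt)
    (hnd : B.Nondegenerate) {β : Fin 3 → SpecialEnd B} {T : Matrix (Fin 3) (Fin 3) ℤ_[p]}
    (hβ : gram β = T.map (fun z : ℤ_[p] => (z : ℚ_[p]))) {b : Building Δ U}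
    (hb : b ∈ primitiveVertices β) :
    Nonempty (PrimRep (modPow 1 (modelMatrix (Δ : ℤ_[p]))) (modPow 1 T)) := by
  obtain ⟨hv, hs, hprim⟩ := hb
  obtain ⟨u, rfl⟩ := (isVertex_iff hU b).1 hv
  obtain ⟨E, hE, hES⟩ := exists_modelEquiv hsq hB hnd u
  have hx : ∀ i j, ‖E.symm (β j) i‖ ≤ 1 := fun i j =>
    (hES (E.symm (β j))).1 (by rw [E.apply_symm_apply]; exact hs j) i
  let X : Matrix (Fin 4) (Fin 3) ℤ_[p] := Matrix.of fun i j => ⟨E.symm (β j) i, hx i j⟩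
  have hX : ∀ j, E (fun i => ((X i j : ℤ_[p]) : ℚ_[p])) = β j := fun j => E.apply_symm_apply _
  have hXT : Xᵀ * modelMatrix (Δ : ℤ_[p]) * X = T := by
    ext i j
    have h1 : ((T i j : ℤ_[p]) : ℚ_[p]) = specialBil hsq (β i) (β j) := by
      rw [← gram_apply, hβ]; rfl
    refine PadicInt.ext ?_
    rw [h1, ← hX i, ← hX j, hE]
    simp only [Matrix.mul_apply, Matrix.transpose_apply, dotProduct, Matrix.mulVec, modelMatrix,
      Fin.sum_univ_four]
    simp
    ring
  refine ⟨modPow 1 X, (isPrim_modPow_one_iff X).2 fun c hc => ?_, ?_⟩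
  · refine hprim c ?_
    have h2 : (p : ℚ_[p])⁻¹ • ∑ i, ((c i : ℤ_[p]) : ℚ_[p]) • β i =
        E ((p : ℚ_[p])⁻¹ • fun i => (((X *ᵥ c) i : ℤ_[p]) : ℚ_[p])) := by
      rw [map_smul]
      congr 1
      have h3 : (fun i => (((X *ᵥ c) i : ℤ_[p]) : ℚ_[p])) =
          ∑ j, ((c j : ℤ_[p]) : ℚ_[p]) • fun i => ((X i j : ℤ_[p]) : ℚ_[p]) := by
        funext i
        simp [Matrix.mulVec, dotProduct, Fin.sum_univ_three, mul_comm]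
      rw [h3, map_sum]
      exact Finset.sum_congr rfl fun j _ => by rw [map_smul, hX]
    rw [h2]
    change Stable (basisNorm u) _
    rw [hES]
    intro i
    exact (dvd_iff_norm_inv_mul_le _).1 (hc i)
  · rw [← modPow_transpose, ← modPow_mul, ← modPow_mul, hXT]

/-- For units `t₀, t₁` the number of vertices is `1` if `t₂` is a unit, and otherwise `2` or `0`
according as `-t₀t₁Δ` is a square or not; these are the factors in `card_primRep_diagonal`. If `t₁`
is not a unit, `isEmpty_primRep` and `exists_primRep` make both sides zero. -/
theorem ncard_primitiveVertices_diagonal (hU : Module.finrank (Qp2 p Δ) U = 2) (hsq : SqSpec B)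
    (hB : B.IsAlt) (hnd : B.Nondegenerate) {β : Fin 3 → SpecialEnd B} {t : Fin 3 → ℤ_[p]}
    (hβ : gram β = (Matrix.diagonal t).map (fun z : ℤ_[p] => (z : ℚ_[p])))
    (ht0 : ∀ i, t i ≠ 0) (ht : ∀ i j, i ≤ j → t i ∣ t j) :
    (primitiveVertices β).Finite ∧
      ((primitiveVertices β).ncard : ℝ) * ((p : ℝ) ^ 2 * ((p : ℝ) ^ 4 - 1)) =
        Nat.card (PrimRep (modPow 1 (modelMatrix (Δ : ℤ_[p]))) (modPow 1 (Matrix.diagonal t))) := by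
  have hd : ¬ IsSquare (PadicInt.toZModPow 1 (Δ : ℤ_[p])) := by
    rw [isSquare_toZModPow_one_iff Δ.isUnit]; exact hΔ.out
  have hmod : modPow 1 (modelMatrix (Δ : ℤ_[p])) =
      modelMatrix (PadicInt.toZModPow 1 (Δ : ℤ_[p])) := map_modelMatrix _ _
  by_cases hu1 : IsUnit (t 1)
  · have hu0 : IsUnit (t 0) := isUnit_of_dvd_unit (ht 0 1 (by decide)) hu1
    have hdiag : modPow 1 (Matrix.diagonal t) = Matrix.diagonal
        ![PadicInt.toZModPow 1 (t 0), PadicInt.toZModPow 1 (t 1), PadicInt.toZModPow 1 (t 2)] := by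
      ext i j
      fin_cases i <;> fin_cases j <;> simp [modPow]
    have hg : gram β = Matrix.diagonal fun i => ((t i : ℤ_[p]) : ℚ_[p]) := by
      rw [hβ]
      ext i j
      by_cases hij : i = j
      · subst hij; simp
      · simp [hij]
    have hn : ∀ i, IsUnit (t i) ↔ ‖((t i : ℤ_[p]) : ℚ_[p])‖ = 1 := fun i => PadicInt.isUnit_iff
    have hcard : (Fintype.card (ZMod (p ^ 1)) : ℝ) = p := by
      rw [ZMod.card, pow_one]
    rw [hmod, hdiag, card_primRep_diagonal two_ne_zero_zmod hd
      ((toZModPow_one_ne_zero_iff _).2 hu0) ((toZModPow_one_ne_zero_iff _).2 hu1), hcard]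
    have hw : IsUnit (-(t 0 * t 1)) := (hu0.mul hu1).neg
    have hsqd : IsSquare (-(PadicInt.toZModPow 1 (t 0) * PadicInt.toZModPow 1 (t 1) *
        PadicInt.toZModPow 1 (Δ : ℤ_[p]))) ↔ IsSquare (-(t 0 * t 1) * Δ) := by
      rw [← isSquare_toZModPow_one_iff (hw.mul Δ.isUnit)]
      simp only [map_mul, map_neg, neg_mul]
    classical
    simp only [hsqd, toZModPow_one_ne_zero_iff]
    suffices h : (primitiveVertices β).Finite ∧ ((primitiveVertices β).ncard : ℝ) =
        if IsUnit (t 2) then 1 else if IsSquare (-(t 0 * t 1) * Δ) then 2 else 0 from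
      ⟨h.1, by rw [h.2]⟩
    by_cases hs : IsSquare (-(t 0 * t 1))
    · obtain ⟨l, hl⟩ := hs
      obtain ⟨v, hv⟩ := primitiveVertices_elliptic hU hsq hg ((hn 0).1 hu0) ((hn 1).1 hu1)
        (PadicInt.norm_le_one _) (l := (l : ℚ_[p])) (by
          rw [← PadicInt.coe_mul, ← hl]; push_cast; ring)
      -- Since `Δ` is not a square, `-t₀t₁` and `-t₀t₁Δ` cannot both be squares.
      have hns : ¬ IsSquare (-(t 0 * t 1) * Δ) := by
        rintro ⟨r, hr⟩
        rw [hl] at hr hw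
        have hlu : IsUnit l := isUnit_of_mul_isUnit_left hw
        obtain ⟨l, rfl⟩ := hlu
        refine hΔ.out ⟨r * (l⁻¹ : ℤ_[p]ˣ), ?_⟩
        calc (Δ : ℤ_[p]) = (l * l * Δ) * ((l⁻¹ : ℤ_[p]ˣ) * (l⁻¹ : ℤ_[p]ˣ)) := by
              rw [mul_comm _ (Δ : ℤ_[p]), mul_assoc, mul_mul_mul_comm, Units.mul_inv, mul_one, mul_one]
          _ = _ := by rw [hr]; ring
      rw [hv, if_neg hns]
      simp only [← hn 2]
      split_ifs <;> simp
    · have hs' := isSquare_mul_unit hΔ.out hw hs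
      obtain ⟨r, hr⟩ := hs'
      obtain ⟨k, hk⟩ : ∃ k : ℕ, ‖((t 2 : ℤ_[p]) : ℚ_[p])‖ = (p : ℝ) ^ (-(k : ℤ)) :=
        ⟨(t 2).valuation, PadicInt.norm_eq_zpow_neg_valuation (ht0 2)⟩
      have hΔ0 : ((Δ : ℤ_[p]) : ℚ_[p]) ≠ 0 := coe_unit_ne_zero Δ
      obtain ⟨f, hf, hv⟩ := primitiveVertices_hyperbolic hU hsq hg ((hn 0).1 hu0) ((hn 1).1 hu1)
        hk (l := (r : ℚ_[p]) / ((Δ : ℤ_[p]) : ℚ_[p])) (by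
          have h1 : ((r : ℤ_[p]) : ℚ_[p]) * r = -(t 0 * t 1) * (Δ : ℤ_[p]) := by
            rw [← PadicInt.coe_mul, ← hr]; push_cast; ring
          rw [div_mul_div_comm, h1]
          field_simp)
      simp only [hv, if_pos (show IsSquare (-(t 0 * t 1) * (Δ : ℤ_[p])) from ⟨r, hr⟩), hn 2, hk]
      have hpk : (p : ℝ) ^ (-(k : ℤ)) = 1 ↔ k = 0 := by
        rw [zpow_eq_one_iff_right₀ p_pos.le one_lt_p.ne']
        simp
      simp only [hpk]
      -- For `k = 0` the two ends of the segment coincide.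
      split_ifs with h
      · subst h; simp
      · refine ⟨Set.toFinite _, ?_⟩
        rw [Set.ncard_pair (fun h1 => h (by exact_mod_cast (hf h1).symm))]
        norm_num
  · have hu2 : ¬ IsUnit (t 2) := fun h => hu1 (isUnit_of_dvd_unit (ht 1 2 (by decide)) h)
    have h1 : PadicInt.toZModPow 1 (t 1) = 0 := by
      by_contra h; exact hu1 ((toZModPow_one_ne_zero_iff _).1 h)
    have h2 : PadicInt.toZModPow 1 (t 2) = 0 := by
      by_contra h; exact hu2 ((toZModPow_one_ne_zero_iff _).1 h)
    have hempty := isEmpty_primRep hd (T := modPow 1 (Matrix.diagonal t)) (by simpa [modPow] using h1)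
      (by simp [modPow]) (by simpa [modPow] using h2)
    rw [← hmod] at hempty
    have h3 : primitiveVertices β = ∅ := Set.eq_empty_of_forall_notMem fun b hb => by
      obtain ⟨X⟩ := exists_primRep hU hsq hB hnd hβ hb
      exact hempty.false X
    rw [h3]
    simp

theorem ncard_primitiveVertices (hU : Module.finrank (Qp2 p Δ) U = 2) (hsq : SqSpec B)
    (hB : B.IsAlt) (hnd : B.Nondegenerate) {β : Fin 3 → SpecialEnd B}
    {T : Matrix (Fin 3) (Fin 3) ℤ_[p]} (hT : T.IsSymm) (hdet : T.det ≠ 0)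
    (hβ : gram β = T.map (fun z : ℤ_[p] => (z : ℚ_[p]))) :
    (primitiveVertices β).Finite ∧
      ((primitiveVertices β).ncard : ℝ) * ((p : ℝ) ^ 2 * ((p : ℝ) ^ 4 - 1)) =
        Nat.card (PrimRep (modPow 1 (modelMatrix (Δ : ℤ_[p]))) (modPow 1 T)) := by
  obtain ⟨k, k', t, hkk, hkk', hk, ht⟩ := exists_diagonalization hp2.out hT
  have ht0 : ∀ i, t i ≠ 0 := by
    have h1 := congrArg Matrix.det hk
    rw [Matrix.det_diagonal, Matrix.det_mul, Matrix.det_mul, Matrix.det_transpose] at h1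
    have h2 : k.det ≠ 0 := by
      have := congrArg Matrix.det hkk
      rw [Matrix.det_mul, Matrix.det_one] at this
      exact left_ne_zero_of_mul_eq_one this
    have h3 : ∏ i, t i ≠ 0 := by
      rw [← h1]; exact mul_ne_zero (mul_ne_zero h2 hdet) h2
    intro i
    exact Finset.prod_ne_zero_iff.1 h3 i (Finset.mem_univ i)
  have hg : gram (scaledTuple k (fun _ => 0) β) =
      (Matrix.diagonal t).map (fun z : ℤ_[p] => (z : ℚ_[p])) := by
    ext i j
    have := gram_scaledTuple (k := k) (a := fun _ => 0) hsq T hβ i j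
    simp only [add_zero, pow_zero, one_mul] at this
    rw [this, hk]; rfl
  have h := ncard_primitiveVertices_diagonal hU hsq hB hnd hg ht0 ht
  rw [primitiveVertices_scaledTuple_zero hkk hkk'] at h
  refine ⟨h.1, h.2.trans ?_⟩
  rw [← hk, modPow_mul, modPow_mul, modPow_transpose]
  exact congrArg _ (card_primRep_congr _ _ (by rw [← modPow_mul, hkk, modPow_one])
    (by rw [← modPow_mul, hkk', modPow_one])).symm

end PrimitiveCount

/-! ### Finiteness of the index set of kernels. -/

section Trace

variable {p : ℕ} [hp : Fact p.Prime]

/-- The intersection of `D` with the standard representatives modulo `p^n`. -/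
def traceMod (n : ℕ) (D : Submodule ℤ_[p] (Fin 3 → ℤ_[p])) : Set (Fin 3 → ZMod (p ^ n)) :=
  {c | (fun j => ((c j).val : ℤ_[p])) ∈ D}

theorem mem_iff_mem_traceMod {n : ℕ} {D : Submodule ℤ_[p] (Fin 3 → ℤ_[p])}
    (hD : ∀ c : Fin 3 → ℤ_[p], (p : ℤ_[p]) ^ n • c ∈ D) (c : Fin 3 → ℤ_[p]) :
    c ∈ D ↔ (fun j => PadicInt.toZModPow n (c j)) ∈ traceMod n D := by
  have : NeZero (p ^ n) := ⟨pow_ne_zero _ hp.out.ne_zero⟩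
  have h1 : ∀ j, (p : ℤ_[p]) ^ n ∣ c j - ((PadicInt.toZModPow n (c j)).val : ℤ_[p]) := fun j => by
    rw [← toZModPow_eq_iff, map_natCast, ZMod.natCast_zmod_val]
  choose d hd using h1
  have h2 : c = (fun j => ((PadicInt.toZModPow n (c j)).val : ℤ_[p])) + (p : ℤ_[p]) ^ n • d := by
    funext j
    rw [Pi.add_apply, Pi.smul_apply, smul_eq_mul, ← hd, add_sub_cancel]
  change _ ↔ (fun j => ((PadicInt.toZModPow n (c j)).val : ℤ_[p])) ∈ D
  conv_lhs => rw [h2]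
  exact Submodule.add_mem_iff_left _ (hD d)

/-- A module containing `pⁿ ℤ_p³` is known from its residues modulo `pⁿ`; thus the sum over kernels
becomes a sum over a finite type. -/
theorem eq_of_traceMod_eq {n : ℕ} {D D' : Submodule ℤ_[p] (Fin 3 → ℤ_[p])}
    (hD : ∀ c : Fin 3 → ℤ_[p], (p : ℤ_[p]) ^ n • c ∈ D)
    (hD' : ∀ c : Fin 3 → ℤ_[p], (p : ℤ_[p]) ^ n • c ∈ D') (h : traceMod n D = traceMod n D') :
    D = D' := by
  ext c
  rw [mem_iff_mem_traceMod hD, mem_iff_mem_traceMod hD', h]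

/-- Up to a unit square, `det T` is `det T'` times the square of `∏ p^{a_i}`; an exponent `a_i ≥ n`
would make `pⁿ` divide it. -/
theorem lt_of_det {n : ℕ} {T T' k k' : Matrix (Fin 3) (Fin 3) ℤ_[p]} {a : Fin 3 → ℕ}
    (hn : ¬ (p : ℤ_[p]) ^ n ∣ T.det) (hkk : k * k' = 1)
    (hTT : powDiag p a * T' * powDiag p a = kᵀ * T * k) : T'.det ≠ 0 ∧ ∀ i, a i < n := by
  have h1 := congrArg Matrix.det hTT
  have h2 : k.det * k'.det = 1 := by rw [← Matrix.det_mul, hkk, Matrix.det_one]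
  simp only [Matrix.det_mul, Matrix.det_transpose, powDiag, Matrix.det_diagonal] at h1
  have h3 : T.det = ((∏ i, (p : ℤ_[p]) ^ a i) * T'.det * ∏ i, (p : ℤ_[p]) ^ a i) *
      (k'.det * k'.det) := by
    rw [h1]
    calc T.det = (k.det * k'.det) * T.det * (k.det * k'.det) := by rw [h2]; ring
      _ = _ := by ring
  constructor
  · intro h
    rw [h, mul_zero, zero_mul, zero_mul] at h3
    exact hn (h3 ▸ dvd_zero _)
  · intro i
    by_contra hi
    refine hn ?_
    rw [h3]
    have h4 : (p : ℤ_[p]) ^ n ∣ ∏ i, (p : ℤ_[p]) ^ a i :=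
      (pow_dvd_pow _ (not_lt.1 hi)).trans
        (Finset.dvd_prod_of_mem (fun i => (p : ℤ_[p]) ^ a i) (Finset.mem_univ i))
    exact (h4.mul_left _).mul_right _

end Trace

/-! ### Stable vertices against all representations modulo `p^t`. -/

section Count

variable {p : ℕ} [hp : Fact p.Prime] {Δ : ℤ_[p]ˣ} [hp2 : Fact (p ≠ 2)]
  [hΔ : Fact (¬ IsSquare (Δ : ℤ_[p]))]
  {U : Type*} [AddCommGroup U] [Module (Qp2 p Δ) U]
  [Module ℚ_[p] U] [IsScalarTower ℚ_[p] (Qp2 p Δ) U]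
  {B : LinearMap.BilinForm (Qp2 p Δ) U} [Nontrivial U]

theorem modelMatrix_isSymm {R : Type*} [CommRing R] (d : R) : (modelMatrix d).IsSymm := by
  ext i j
  fin_cases i <;> fin_cases j <;> rfl

theorem modelMatrix_mul_inv (Δ : ℤ_[p]ˣ) :
    modelMatrix (Δ : ℤ_[p]) * modelMatrix ((Δ⁻¹ : ℤ_[p]ˣ) : ℤ_[p]) = 1 := by
  ext i j
  fin_cases i <;> fin_cases j <;> simp [modelMatrix, Matrix.mul_apply, Fin.sum_univ_four]

/-- The vertices stabilized by a tuple. -/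
def stableVertices (β : Fin 3 → SpecialEnd B) : Set (Building Δ U) :=
  {b | b.IsVertex ∧ ∀ i, b.Stable (β i)}

/-- With the Smith data of `D`, both counts concern the matrix `p^{-a} kᵗ T k p^{-a}` and are
compared by `ncard_primitiveVertices`. If that matrix is not integral, both sets are empty. -/
theorem card_fiber (hU : Module.finrank (Qp2 p Δ) U = 2) (hsq : SqSpec B)
    (hB : B.IsAlt) (hnd : B.Nondegenerate) {β : Fin 3 → SpecialEnd B}
    {T : Matrix (Fin 3) (Fin 3) ℤ_[p]} (hT : T.IsSymm)
    (hβ : gram β = T.map (fun z : ℤ_[p] => (z : ℚ_[p]))) {n t : ℕ}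
    (hn : ¬ (p : ℤ_[p]) ^ n ∣ T.det) (ht : 2 * n < t) {D : Submodule ℤ_[p] (Fin 3 → ℤ_[p])}
    (hD : ∀ c : Fin 3 → ℤ_[p], (p : ℤ_[p]) ^ n • c ∈ D) :
    {b | b ∈ stableVertices β ∧ vertexKernel n β b = D}.Finite ∧
    (Nat.card {X : Matrix (Fin 4) (Fin 3) (ZMod (p ^ t)) //
      Xᵀ * modPow t (modelMatrix (Δ : ℤ_[p])) * X = modPow t T ∧
        repKernel (by omega : n ≤ t) X = D} : ℝ) =
      ((p : ℝ) ^ 6) ^ (t - 1) * (({b | b ∈ stableVertices β ∧ vertexKernel n β b = D}.ncard : ℝ) *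
        ((p : ℝ) ^ 2 * ((p : ℝ) ^ 4 - 1))) := by
  obtain ⟨k, k', a, hkk, hkk', ha, hk⟩ := exists_smith D hD
  have hp0 : (p : ℤ_[p]) ≠ 0 := by exact_mod_cast hp.out.ne_zero
  by_cases hdvd : ∀ i j, (p : ℤ_[p]) ^ (a i + a j) ∣ (kᵀ * T * k) i j
  · choose T' hT' using hdvd
    have hTT : powDiag p a * (Matrix.of T') * powDiag p a = kᵀ * T * k := by
      ext i j
      rw [powDiag_conj_apply, hT']; rfl
    have hsym : (Matrix.of T').IsSymm := by
      have h1 : (kᵀ * T * k).IsSymm := by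
        rw [Matrix.IsSymm, Matrix.transpose_mul, Matrix.transpose_mul, Matrix.transpose_transpose,
          hT.eq, Matrix.mul_assoc]
      ext i j
      have h2 := h1.apply i j
      rw [hT', hT', add_comm] at h2
      exact mul_left_cancel₀ (pow_ne_zero _ hp0) h2
    obtain ⟨hdet', ha'⟩ := lt_of_det hn hkk hTT
    have hg : gram (scaledTuple k a β) = (Matrix.of T').map (fun z : ℤ_[p] => (z : ℚ_[p])) := by
      ext i j
      have h1 := gram_scaledTuple (k := k) (a := a) hsq T hβ i j
      rw [hT', PadicInt.coe_mul, PadicInt.coe_pow, PadicInt.coe_natCast] at h1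
      exact mul_left_cancel₀ (pow_ne_zero _ padic_p_ne_zero) h1
    obtain ⟨hfin, hcard⟩ := ncard_primitiveVertices hU hsq hB hnd hsym hdet' hg
    have hset : {b | b ∈ stableVertices β ∧ vertexKernel n β b = D} =
        primitiveVertices (scaledTuple k a β) := by
      ext b
      constructor
      · rintro ⟨⟨hb, hs⟩, hbD⟩
        exact (vertexKernel_eq_iff hkk ha' hk hb).1 ⟨hs, hbD⟩
      · intro hb
        have h1 := (vertexKernel_eq_iff hkk ha' hk hb.1).2 hb
        exact ⟨⟨hb.1, h1.1⟩, h1.2⟩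
    rw [hset]
    refine ⟨hfin, ?_⟩
    rw [hcard, card_repKernel_eq hp2.out ht ha' hkk hkk' hk (modelMatrix_isSymm _)
      (modelMatrix_mul_inv Δ) hsym hTT]
    push_cast
    rfl
  · have h1 : {b | b ∈ stableVertices β ∧ vertexKernel n β b = D} = ∅ := by
      refine Set.eq_empty_of_forall_notMem fun b hb => hdvd fun i j => ?_
      obtain ⟨⟨-, hs⟩, hbD⟩ := hb
      have h2 := stable_scaledTuple ha hk hbD
      have h3 : ‖gram (scaledTuple k a β) i j‖ ≤ 1 := by
        rw [gram_apply hsq]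
        have hi := h2 i
        have hj := h2 j
        induction b using Quotient.inductionOn
        exact Stable.norm_le_one hsq hi hj
      refine ⟨⟨_, h3⟩, PadicInt.ext ?_⟩
      rw [← gram_scaledTuple (a := a) hsq T hβ i j]
      rfl
    have h2 : IsEmpty {X : Matrix (Fin 4) (Fin 3) (ZMod (p ^ t)) //
        Xᵀ * modPow t (modelMatrix (Δ : ℤ_[p])) * X = modPow t T ∧
        repKernel (by omega : n ≤ t) X = D} :=
      ⟨fun X => hdvd fun i j => dvd_of_repKernel_eq ht ha hk X.2.1 X.2.2 i j⟩
    rw [h1, Nat.card_of_isEmpty]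
    simp

/-- The comparison over each kernel `D` is summed over all `D`, indexed by their traces modulo `pⁿ`.
-/
theorem card_representations (hU : Module.finrank (Qp2 p Δ) U = 2) (hsq : SqSpec B)
    (hB : B.IsAlt) (hnd : B.Nondegenerate) {β : Fin 3 → SpecialEnd B}
    {T : Matrix (Fin 3) (Fin 3) ℤ_[p]} (hT : T.IsSymm)
    (hβ : gram β = T.map (fun z : ℤ_[p] => (z : ℚ_[p]))) {n t : ℕ}
    (hn : ¬ (p : ℤ_[p]) ^ n ∣ T.det) (ht : 2 * n < t) :
    (stableVertices β).Finite ∧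
    (Nat.card {X : Matrix (Fin 4) (Fin 3) (ZMod (p ^ t)) //
      Xᵀ * modPow t (modelMatrix (Δ : ℤ_[p])) * X = modPow t T} : ℝ) =
      ((p : ℝ) ^ 6) ^ (t - 1) * (((stableVertices β).ncard : ℝ) *
        ((p : ℝ) ^ 2 * ((p : ℝ) ^ 4 - 1))) := by
  classical
  let R := {X : Matrix (Fin 4) (Fin 3) (ZMod (p ^ t)) //
      Xᵀ * modPow t (modelMatrix (Δ : ℤ_[p])) * X = modPow t T}
  let f : R → Set (Fin 3 → ZMod (p ^ n)) := fun X => traceMod n (repKernel (by omega : n ≤ t) X.1)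
  let g : stableVertices β → Set (Fin 3 → ZMod (p ^ n)) := fun b =>
    traceMod n (vertexKernel n β b.1)
  have hg : ∀ b : stableVertices β, ∀ c : Fin 3 → ℤ_[p],
      (p : ℤ_[p]) ^ n • c ∈ vertexKernel n β b.1 :=
    fun b c => smul_mem_vertexKernel n b.2.2 c
  have key : ∀ y, Finite {b // g b = y} ∧ (Nat.card {X // f X = y} : ℝ) =
      ((p : ℝ) ^ 6) ^ (t - 1) * ((Nat.card {b // g b = y} : ℝ) *
        ((p : ℝ) ^ 2 * ((p : ℝ) ^ 4 - 1))) := by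
    intro y
    by_cases hy : ∃ D : Submodule ℤ_[p] (Fin 3 → ℤ_[p]),
        (∀ c : Fin 3 → ℤ_[p], (p : ℤ_[p]) ^ n • c ∈ D) ∧ traceMod n D = y
    · obtain ⟨D, hD, rfl⟩ := hy
      obtain ⟨hfin, hcard⟩ := card_fiber hU hsq hB hnd hT hβ hn ht hD
      have eg : {b // g b = traceMod n D} ≃ {b | b ∈ stableVertices β ∧ vertexKernel n β b = D} :=
        { toFun := fun b => ⟨b.1.1, b.1.2, eq_of_traceMod_eq (hg b.1) hD b.2⟩
          invFun := fun b => ⟨⟨b.1, b.2.1⟩, congrArg (traceMod n) b.2.2⟩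
          left_inv := fun b => rfl
          right_inv := fun b => rfl }
      have ef : {X // f X = traceMod n D} ≃ {X : Matrix (Fin 4) (Fin 3) (ZMod (p ^ t)) //
          Xᵀ * modPow t (modelMatrix (Δ : ℤ_[p])) * X = modPow t T ∧
          repKernel (by omega : n ≤ t) X = D} :=
        { toFun := fun X => ⟨X.1.1, X.1.2,
            eq_of_traceMod_eq (smul_mem_repKernel _ X.1.1) hD X.2⟩
          invFun := fun X => ⟨⟨X.1, X.2.1⟩, congrArg (traceMod n) X.2.2⟩
          left_inv := fun X => rfl
          right_inv := fun X => rfl }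
      have := hfin.to_subtype
      exact ⟨Finite.of_equiv _ eg.symm, by
        rw [Nat.card_congr ef, Nat.card_congr eg, hcard, Nat.card_coe_set_eq]⟩
    · have h1 : IsEmpty {b // g b = y} := ⟨fun b => hy ⟨_, hg b.1, b.2⟩⟩
      have h2 : IsEmpty {X // f X = y} :=
        ⟨fun X => hy ⟨_, smul_mem_repKernel _ X.1.1, X.2⟩⟩
      rw [Nat.card_of_isEmpty, Nat.card_of_isEmpty]
      exact ⟨inferInstance, by simp⟩
  have hfin : Finite (stableVertices β) := by
    have := fun y => (key y).1
    exact Finite.of_equiv _ (Equiv.sigmaFiberEquiv g)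
  have := Fintype.ofFinite (Set (Fin 3 → ZMod (p ^ n)))
  refine ⟨Set.toFinite _, ?_⟩
  change (Nat.card R : ℝ) = _
  rw [← Nat.card_coe_set_eq, card_eq_sum_fiber f, card_eq_sum_fiber g]
  push_cast
  rw [Finset.sum_mul, Finset.mul_sum]
  exact Finset.sum_congr rfl fun y _ => (key y).2

end Count

/-! ### Change of basis in the representing form. -/

section Density

variable {p : ℕ} [hp : Fact p.Prime]

theorem card_representations_congr (t : ℕ) {M M' S : Matrix (Fin 4) (Fin 4) ℤ_[p]}
    (hM : M * M' = 1) (T : Matrix (Fin 3) (Fin 3) ℤ_[p]) :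
    Nat.card {X : Matrix (Fin 4) (Fin 3) (ZMod (p ^ t)) //
        Xᵀ * modPow t (Mᵀ * S * M) * X = modPow t T} =
      Nat.card {X : Matrix (Fin 4) (Fin 3) (ZMod (p ^ t)) //
        Xᵀ * modPow t S * X = modPow t T} := by
  have e1 : modPow t M * modPow t M' = 1 := by rw [← modPow_mul, hM, modPow_one]
  have e2 : modPow t M' * modPow t M = 1 := by
    rw [← modPow_mul, mul_eq_one_comm.1 hM, modPow_one]
  let e : Matrix (Fin 4) (Fin 3) (ZMod (p ^ t)) ≃ Matrix (Fin 4) (Fin 3) (ZMod (p ^ t)) :=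
    { toFun := fun X => modPow t M * X
      invFun := fun X => modPow t M' * X
      left_inv := fun X => by
        change modPow t M' * (modPow t M * X) = X
        rw [← Matrix.mul_assoc, e2, Matrix.one_mul]
      right_inv := fun X => by
        change modPow t M * (modPow t M' * X) = X
        rw [← Matrix.mul_assoc, e1, Matrix.one_mul] }
  refine Nat.card_congr (e.subtypeEquiv fun X => ?_)
  change _ ↔ (modPow t M * X)ᵀ * modPow t S * (modPow t M * X) = _
  have h1 : (modPow t M * X)ᵀ * modPow t S * (modPow t M * X) =
      Xᵀ * modPow t (Mᵀ * S * M) * X := by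
    rw [modPow_mul, modPow_mul, modPow_transpose, Matrix.transpose_mul]
    simp only [Matrix.mul_assoc]
  rw [h1]

end Density

/-! ### Bases of the stabilizer lattice. -/

section Bases

variable {p : ℕ} [hp : Fact p.Prime] {Δ : ℤ_[p]ˣ} [hp2 : Fact (p ≠ 2)]
  [hΔ : Fact (¬ IsSquare (Δ : ℤ_[p]))]

/-- `-1` is of the form `x² + Δ y²`. -/
theorem exists_sq_add_eq_neg_one (Δ : ℤ_[p]ˣ) :
    ∃ x y : ℤ_[p], x * x + (Δ : ℤ_[p]) * (y * y) = -1 := by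
  obtain ⟨x, y, hxy⟩ := exists_sq_sub_eq (F := ZMod (p ^ 1)) two_ne_zero_zmod
    (d := PadicInt.toZModPow 1 (-(Δ : ℤ_[p]))) ((toZModPow_one_ne_zero_iff _).2 Δ.isUnit.neg) (-1)
  obtain ⟨x, rfl⟩ := toZModPow_surjective 1 x
  obtain ⟨y, rfl⟩ := toZModPow_surjective 1 y
  rw [map_neg] at hxy
  -- If `x` is a unit, `y` is kept and `x` is lifted by Hensel's lemma. Otherwise `x` vanishes
  -- modulo `p`, so `-Δ⁻¹` is a square modulo `p` and `y` is lifted instead.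
  by_cases hx : IsUnit x
  · have h1 : PadicInt.toZModPow 1 (-1 - (Δ : ℤ_[p]) * (y * y)) =
        PadicInt.toZModPow 1 x * PadicInt.toZModPow 1 x := by
      simp only [map_sub, map_neg, map_one, map_mul]
      linear_combination -hxy
    have h2 : IsUnit (-1 - (Δ : ℤ_[p]) * (y * y)) := by
      rw [← toZModPow_one_ne_zero_iff, h1, ← map_mul, toZModPow_one_ne_zero_iff]
      exact hx.mul hx
    obtain ⟨r, hr⟩ := (isSquare_toZModPow_one_iff h2).1 ⟨_, h1⟩
    exact ⟨r, y, by rw [← hr]; ring⟩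
  · have hx0 : PadicInt.toZModPow 1 x = 0 := by
      by_contra h; exact hx ((toZModPow_one_ne_zero_iff _).1 h)
    have hinv : PadicInt.toZModPow 1 (Δ : ℤ_[p]) *
        PadicInt.toZModPow 1 ((Δ⁻¹ : ℤ_[p]ˣ) : ℤ_[p]) = 1 := by
      rw [← map_mul, Units.mul_inv, map_one]
    rw [hx0] at hxy
    have h1 : PadicInt.toZModPow 1 (-((Δ⁻¹ : ℤ_[p]ˣ) : ℤ_[p])) =
        PadicInt.toZModPow 1 y * PadicInt.toZModPow 1 y := by
      rw [map_neg]
      linear_combination (PadicInt.toZModPow 1 y) ^ 2 * hinv -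
        PadicInt.toZModPow 1 ((Δ⁻¹ : ℤ_[p]ˣ) : ℤ_[p]) * hxy
    obtain ⟨r, hr⟩ := (isSquare_toZModPow_one_iff (Δ⁻¹).isUnit.neg).1 ⟨_, h1⟩
    exact ⟨0, r, by rw [← hr, mul_neg, Units.mul_inv]; ring⟩

/-- The model form is equivalent to `diag(1, 1, 1, Δ)`. -/
theorem exists_modelMatrix_equiv (Δ : ℤ_[p]ˣ) : ∃ M C : Matrix (Fin 4) (Fin 4) ℤ_[p], C * M = 1 ∧
    Mᵀ * modelMatrix (Δ : ℤ_[p]) * M = Matrix.diagonal ![1, 1, 1, (Δ : ℤ_[p])] := by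
  obtain ⟨s, r, hsr⟩ := exists_sq_add_eq_neg_one Δ
  obtain ⟨u, hu⟩ := isUnit_two (p := p)
  have hh : 2 * ((u⁻¹ : ℤ_[p]ˣ) : ℤ_[p]) = 1 := by rw [← hu, Units.mul_inv]
  generalize ((u⁻¹ : ℤ_[p]ˣ) : ℤ_[p]) = h at hh
  -- With `h = ½`, the hyperbolic plane is spanned by `(1, h)` of norm `1` and `(1, -h)` of norm
  -- `-1`. The latter and the vector of norm `-Δ` span the form `-s² - Δr²`, in which `(s, r)` has
  -- norm `1` and `(-Δr, s)` is orthogonal to it of norm `Δ`.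
  let M : Matrix (Fin 4) (Fin 4) ℤ_[p] :=
    !![1, 0, 0, 0; 0, r, 0, s; 0, s, 1, -(Δ * r); 0, -(s * h), h, Δ * r * h]
  have hM : Mᵀ * modelMatrix (Δ : ℤ_[p]) * M = Matrix.diagonal ![1, 1, 1, (Δ : ℤ_[p])] := by
    ext i j
    fin_cases i <;> fin_cases j <;>
      simp [M, modelMatrix, Matrix.mul_apply, Fin.sum_univ_four]
    · linear_combination -hsr - s * s * hh
    · linear_combination r * Δ * s * hh
    · ring
    · linear_combination hh
    · ring
    · linear_combination r * Δ * s * hh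
    · linear_combination (-(Δ : ℤ_[p])) * hsr - Δ * Δ * r * r * hh
  refine ⟨M, Matrix.diagonal ![1, 1, 1, ((Δ⁻¹ : ℤ_[p]ˣ) : ℤ_[p])] * Mᵀ * modelMatrix (Δ : ℤ_[p]),
    ?_, hM⟩
  rw [Matrix.mul_assoc, Matrix.mul_assoc, ← Matrix.mul_assoc Mᵀ, hM]
  ext i j
  fin_cases i <;> fin_cases j <;> simp

variable {U : Type*} [AddCommGroup U] [Module (Qp2 p Δ) U]

/-- Every value of the norm is the absolute value of a scalar, so a vector can be scaled to norm `1`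
and the inequality tested on the lattice. -/
theorem forall_mem_lattice_iff {Λ : Submodule (Zp2 p Δ) U}
    {b : Module.Basis (Fin 2) (Qp2 p Δ) U} (hb : ∀ x, x ∈ Λ ↔ basisNorm b x ≤ 1)
    [Module ℚ_[p] U] [IsScalarTower ℚ_[p] (Qp2 p Δ) U]
    {B : LinearMap.BilinForm (Qp2 p Δ) U} (β : SpecialEnd B) :
    (∀ x ∈ Λ, β.1 x ∈ Λ) ↔ Stable (basisNorm b) β := by
  constructor
  · intro h x
    obtain ⟨a, ha⟩ := exists_absK_eq_basisNorm b x
    by_cases hx : x = 0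
    · subst hx; rw [map_zero]
    have hpos : 0 < absK a := by rw [ha]; exact (basisNorm b).pos hx
    have h1 := h (a⁻¹ • x) ((hb _).2 (by
      rw [(basisNorm b).map_smul, absK_inv, ← ha, inv_mul_cancel₀ hpos.ne']))
    rw [hb, LinearMap.map_smulₛₗ, (basisNorm b).map_smul, absK_star, absK_inv,
      inv_mul_le_iff₀ hpos, mul_one, ha] at h1
    exact h1
  · intro h x hx
    rw [hb] at hx ⊢
    exact (h x).trans hx

variable [Module ℚ_[p] U] [IsScalarTower ℚ_[p] (Qp2 p Δ) U]
  {B : LinearMap.BilinForm (Qp2 p Δ) U} [Nontrivial U]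

/-- Coercion of integral vectors. -/
def coeVec {m : ℕ} (v : Fin m → ℤ_[p]) : Fin m → ℚ_[p] := fun i => ((v i : ℤ_[p]) : ℚ_[p])

theorem coeVec_mulVec (M : Matrix (Fin 4) (Fin 4) ℤ_[p]) (c : Fin 4 → ℤ_[p]) :
    coeVec (M *ᵥ c) = ∑ j, ((c j : ℤ_[p]) : ℚ_[p]) • coeVec (fun i => M i j) := by
  funext i
  simp [coeVec, Matrix.mulVec, dotProduct, Fin.sum_univ_four, mul_comm]

theorem coeVec_injective {m : ℕ} : Function.Injective (coeVec (p := p) (m := m)) :=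
  fun _ _ h => funext fun i => PadicInt.ext (congrFun h i)

theorem gram_columns (hsq : SqSpec B) {E : (Fin 4 → ℚ_[p]) ≃ₗ[ℚ_[p]] SpecialEnd B}
    (hE : ∀ v w, specialBil hsq (E v) (E w) = v ⬝ᵥ modelMatrix ((Δ : ℤ_[p]) : ℚ_[p]) *ᵥ w)
    (M : Matrix (Fin 4) (Fin 4) ℤ_[p]) :
    gram (fun j => E (coeVec fun i => M i j)) =
      (Mᵀ * modelMatrix (Δ : ℤ_[p]) * M).map (fun z : ℤ_[p] => (z : ℚ_[p])) := by
  ext i j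
  rw [gram_apply hsq, hE]
  simp only [Matrix.map_apply, Matrix.mul_apply, Matrix.transpose_apply, dotProduct, Matrix.mulVec,
    modelMatrix, Fin.sum_univ_four, coeVec]
  simp
  ring

theorem isBasisOfN₀_columns {Λ : Submodule (Zp2 p Δ) U}
    {E : (Fin 4 → ℚ_[p]) ≃ₗ[ℚ_[p]] SpecialEnd B}
    (hE : ∀ v, (∀ x ∈ Λ, (E v).1 x ∈ Λ) ↔ ∀ i, ‖v i‖ ≤ 1)
    {M C : Matrix (Fin 4) (Fin 4) ℤ_[p]} (hC : C * M = 1) :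
    IsBasisOfN₀ Λ fun j => E (coeVec fun i => M i j) := by
  constructor
  · rw [show (fun j => E (coeVec fun i => M i j)) = E ∘ fun j => coeVec fun i => M i j from rfl]
    refine LinearIndependent.map' (f := E.toLinearMap) ?_ (LinearMap.ker_eq_bot.2 E.injective)
    have h1 : (M.map (algebraMap ℤ_[p] ℚ_[p]))ᵀ.row = fun j => coeVec fun i => M i j := rfl
    rw [← h1, Matrix.linearIndependent_rows_iff_isUnit, Matrix.isUnit_transpose]
    refine IsUnit.of_mul_eq_one_right (C.map (algebraMap ℤ_[p] ℚ_[p])) ?_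
    rw [← Matrix.map_mul, hC, Matrix.map_one _ (map_zero _) (map_one _)]
  · intro β
    obtain ⟨v, rfl⟩ := E.surjective β
    rw [hE]
    have h1 : ∀ c : Fin 4 → ℤ_[p], ∑ j, ((c j : ℤ_[p]) : ℚ_[p]) • E (coeVec fun i => M i j) =
        E (coeVec (M *ᵥ c)) := fun c => by
      rw [coeVec_mulVec, map_sum]
      exact Finset.sum_congr rfl fun j _ => (map_smul _ _ _).symm
    simp only [h1, E.injective.eq_iff]
    constructor
    · intro hv
      let w : Fin 4 → ℤ_[p] := fun i => ⟨v i, hv i⟩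
      refine ⟨C *ᵥ w, ?_⟩
      rw [Matrix.mulVec_mulVec, mul_eq_one_comm.1 hC, Matrix.one_mulVec]
      rfl
    · rintro ⟨c, rfl⟩ i
      exact PadicInt.norm_le_one _

/-- In the coordinates `E` the stabilizer is `ℤ_p⁴`, so the coordinates of the basis are integral;
expressing the standard vectors in this basis gives the inverse matrix. -/
theorem exists_columns {Λ : Submodule (Zp2 p Δ) U}
    {E : (Fin 4 → ℚ_[p]) ≃ₗ[ℚ_[p]] SpecialEnd B}
    (hE : ∀ v, (∀ x ∈ Λ, (E v).1 x ∈ Λ) ↔ ∀ i, ‖v i‖ ≤ 1) {e : Fin 4 → SpecialEnd B}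
    (he : IsBasisOfN₀ Λ e) : ∃ M C : Matrix (Fin 4) (Fin 4) ℤ_[p], M * C = 1 ∧
      e = fun j => E (coeVec fun i => M i j) := by
  have h1 : ∀ j i, ‖E.symm (e j) i‖ ≤ 1 := fun j => by
    rw [← hE, E.apply_symm_apply, he.2]
    refine ⟨Pi.single j 1, ?_⟩
    rw [Finset.sum_eq_single j]
    · simp
    · intro l _ hl; simp [hl]
    · intro h; exact absurd (Finset.mem_univ j) h
  let M : Matrix (Fin 4) (Fin 4) ℤ_[p] := Matrix.of fun i j => ⟨E.symm (e j) i, h1 j i⟩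
  have hM : ∀ j, E (coeVec fun i => M i j) = e j := fun j => E.apply_symm_apply _
  have h2 : ∀ l : Fin 4, ∃ c : Fin 4 → ℤ_[p], M *ᵥ c = Pi.single l 1 := by
    intro l
    obtain ⟨c, hc⟩ := (he.2 (E (coeVec (Pi.single l 1)))).1 ((hE _).2 fun i =>
      PadicInt.norm_le_one _)
    refine ⟨c, coeVec_injective (E.injective ?_)⟩
    rw [hc, coeVec_mulVec, map_sum]
    exact Finset.sum_congr rfl fun j _ => by rw [map_smul, hM]
  choose c hc using h2
  refine ⟨M, (Matrix.of fun j l => c l j : Matrix (Fin 4) (Fin 4) ℤ_[p]), ?_,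
    funext fun j => (hM j).symm⟩
  ext i l
  have := congrFun (hc l) i
  rw [Matrix.one_apply, Matrix.mul_apply]
  simp only [Matrix.mulVec, dotProduct, Pi.single_apply] at this
  exact this

end Bases

/-! ### Tubes of an arbitrary anisotropic basis, and the density. -/

section Tube

variable {p : ℕ} [hp : Fact p.Prime] {Δ : ℤ_[p]ˣ} [hp2 : Fact (p ≠ 2)]
  [hΔ : Fact (¬ IsSquare (Δ : ℤ_[p]))]
  {U : Type*} [AddCommGroup U] [Module (Qp2 p Δ) U]
  [Module ℚ_[p] U] [IsScalarTower ℚ_[p] (Qp2 p Δ) U]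
  {B : LinearMap.BilinForm (Qp2 p Δ) U} [Nontrivial U]

theorem stable_changeBasis_iff (g : GL (Fin 3) ℤ_[p]) (β : Fin 3 → SpecialEnd B)
    (b : Building Δ U) : (∀ i, b.Stable (changeBasis g β i)) ↔ ∀ i, b.Stable (β i) := by
  have h1 : ∀ (g : GL (Fin 3) ℤ_[p]) (β : Fin 3 → SpecialEnd B), (∀ i, b.Stable (β i)) →
      ∀ i, b.Stable (changeBasis g β i) := fun g β h i => Building.Stable.intComb h _
  refine ⟨fun h => ?_, h1 g β⟩
  have h2 := h1 g⁻¹ _ h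
  have h3 : changeBasis g⁻¹ (changeBasis g β) = β := by
    funext i
    have h4 : ((g⁻¹ : GL (Fin 3) ℤ_[p]) : Matrix (Fin 3) (Fin 3) ℤ_[p]) *
        (g : Matrix (Fin 3) (Fin 3) ℤ_[p]) = 1 := by
      rw [← Units.val_mul, inv_mul_cancel, Units.val_one]
    simp only [changeBasis, Finset.smul_sum, smul_smul]
    rw [Finset.sum_comm]
    have h5 : ∀ j, (∑ l, (((((g⁻¹ : GL (Fin 3) ℤ_[p]) : Matrix (Fin 3) (Fin 3) ℤ_[p]) i l :
        ℤ_[p]) : ℚ_[p]) * (((g : Matrix (Fin 3) (Fin 3) ℤ_[p]) l j : ℤ_[p]) : ℚ_[p]))) =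
        (((1 : Matrix (Fin 3) (Fin 3) ℤ_[p]) i j : ℤ_[p]) : ℚ_[p]) := fun j => by
      rw [← h4, Matrix.mul_apply]; simp
    simp only [← Finset.sum_smul, h5]
    rw [Finset.sum_eq_single i]
    · simp
    · intro j _ hj; simp [hj.symm]
    · intro h; exact absurd (Finset.mem_univ i) h
  rwa [h3] at h2

/-- Membership in the tubes means stability, which depends only on the `ℤ_p`-span of the tuple. -/
theorem tubeVertices_changeBasis (hU : Module.finrank (Qp2 p Δ) U = 2) (hsq : SqSpec B)
    (g : GL (Fin 3) ℤ_[p]) (β : Fin 3 → SpecialEnd B) (hg : ∀ i, Qpp (changeBasis g β i) ≠ 0) :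
    tubeVertices (changeBasis g β) = stableVertices β := by
  have := finite_padic hU
  ext b
  change _ ∧ _ ↔ _ ∧ _
  refine and_congr_right fun _ => ?_
  rw [← stable_changeBasis_iff g]
  refine forall_congr' fun i => ?_
  induction b using Quotient.inductionOn
  exact mem_tube_iff' (hsq _) (hg i) _

/-- A diagonalizing basis works: its values `t_i` of `Q''` multiply to `det T` times a unit square.
-/
theorem exists_changeBasis_ne_zero (hsq : SqSpec B) {β : Fin 3 → SpecialEnd B}
    {T : Matrix (Fin 3) (Fin 3) ℤ_[p]} (hT : T.IsSymm) (hdet : T.det ≠ 0)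
    (hβ : gram β = T.map (fun z : ℤ_[p] => (z : ℚ_[p]))) :
    ∃ g : GL (Fin 3) ℤ_[p], ∀ i, Qpp (changeBasis g β i) ≠ 0 := by
  obtain ⟨k, k', t, hkk, hkk', hk, -⟩ := exists_diagonalization hp2.out hT
  refine ⟨⟨kᵀ, k'ᵀ, by rw [← Matrix.transpose_mul, hkk', Matrix.transpose_one],
    by rw [← Matrix.transpose_mul, hkk, Matrix.transpose_one]⟩, fun i => ?_⟩
  have h1 := gram_scaledTuple (k := k) (a := fun _ => 0) hsq T hβ i i
  rw [hk, Matrix.diagonal_apply_eq, gram_apply hsq, specialBil_self] at h1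
  simp only [add_zero, pow_zero, one_mul, scaledTuple, inv_one, one_smul] at h1
  change Qpp (intComb (fun j => k j i) β) ≠ 0
  rw [h1]
  have h2 := congrArg Matrix.det hk
  rw [Matrix.det_diagonal, Matrix.det_mul, Matrix.det_mul, Matrix.det_transpose] at h2
  have h3 : k.det ≠ 0 := by
    have := congrArg Matrix.det hkk
    rw [Matrix.det_mul, Matrix.det_one] at this
    exact left_ne_zero_of_mul_eq_one this
  have h4 : ∏ i, t i ≠ 0 := by
    rw [← h2]; exact mul_ne_zero (mul_ne_zero h3 hdet) h3
  have h5 := Finset.prod_ne_zero_iff.1 h4 i (Finset.mem_univ i)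
  intro h
  exact h5 (PadicInt.ext h)

/-- The sequence is constant for `t > 2n`, because `p^{-6t} · p^{6(t-1)} · p²(p⁴ - 1) = 1 - p⁻⁴`. -/
theorem hasRepresentationDensity (hU : Module.finrank (Qp2 p Δ) U = 2) (hsq : SqSpec B)
    (hB : B.IsAlt) (hnd : B.Nondegenerate) {β : Fin 3 → SpecialEnd B}
    {T : Matrix (Fin 3) (Fin 3) ℤ_[p]} (hT : T.IsSymm) (hdet : T.det ≠ 0)
    (hβ : gram β = T.map (fun z : ℤ_[p] => (z : ℚ_[p])))
    {M C : Matrix (Fin 4) (Fin 4) ℤ_[p]} (hM : M * C = 1) :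
    (stableVertices β).Finite ∧
    HasRepresentationDensity (Mᵀ * modelMatrix (Δ : ℤ_[p]) * M) T
      ((1 - (p : ℝ) ^ (-4 : ℤ)) * ((stableVertices β).ncard : ℝ)) := by
  obtain ⟨n, hn⟩ : ∃ n : ℕ, ¬ (p : ℤ_[p]) ^ n ∣ T.det := by
    have h := FiniteMultiplicity.of_not_isUnit (PadicInt.prime_p (p := p)).not_isUnit hdet
    exact ⟨_, h.not_pow_dvd_of_multiplicity_lt (Nat.lt_succ_self _)⟩
  refine ⟨(card_representations hU hsq hB hnd hT hβ hn (Nat.lt_succ_self _)).1, ?_⟩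
  refine tendsto_const_nhds.congr' ?_
  filter_upwards [Filter.eventually_gt_atTop (2 * n)] with t ht
  have h1 := (card_representations hU hsq hB hnd hT hβ hn ht).2
  have h2 := card_representations_congr t (S := modelMatrix (Δ : ℤ_[p])) hM T
  change _ = _ * (Nat.card {X : Matrix (Fin 4) (Fin 3) (ZMod (p ^ t)) //
        Xᵀ * modPow t (Mᵀ * modelMatrix (Δ : ℤ_[p]) * M) * X = modPow t T} : ℝ)
  rw [h2, h1]
  have hp0 : (p : ℝ) ≠ 0 := (p_pos (p := p)).ne'
  obtain ⟨s, rfl⟩ := Nat.exists_eq_add_of_le' (by omega : 1 ≤ t)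
  rw [show ((3 * (3 + 1) / 2 : ℕ) : ℤ) - ((4 : ℕ) : ℤ) * ((3 : ℕ) : ℤ) = -6 by norm_num,
    Nat.add_sub_cancel, show (((s + 1 : ℕ) : ℤ) * (-6)) = -((6 * s + 6 : ℕ) : ℤ) by push_cast; ring,
    zpow_neg _ (4 : ℤ), zpow_neg, zpow_natCast, ← pow_mul, pow_add,
    show (p : ℝ) ^ (4 : ℤ) = (p : ℝ) ^ 4 from zpow_natCast _ 4]
  field_simp

end Tube

end SpecialTree

end

/-! ### The main theorem. -/

theorem theorem8p15 (p : ℕ) [Fact p.Prime] (hp : p ≠ 2)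
    (Δ : ℤ_[p]ˣ) (hΔ : ¬ IsSquare (Δ : ℤ_[p]))
    (U : Type*) [AddCommGroup U] [Module (SpecialTree.Qp2 p Δ) U] [Module ℚ_[p] U]
    [IsScalarTower ℚ_[p] (SpecialTree.Qp2 p Δ) U]
    (hU : Module.finrank (SpecialTree.Qp2 p Δ) U = 2)
    (B : LinearMap.BilinForm (SpecialTree.Qp2 p Δ) U) (hB : B.IsAlt) (hnd : B.Nondegenerate)
    (T T' : Matrix (Fin 3) (Fin 3) ℤ_[p]) (hT' : T'.IsSymm) (hT : T = (p : ℤ_[p]) • T')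
    (hdet : T.det ≠ 0)
    (β : Fin 3 → SpecialTree.SpecialEnd B)
    (hβ : T.map (fun z : ℤ_[p] => (z : ℚ_[p])) = (p : ℚ_[p]) • SpecialTree.gram β) :
    ∃ α : ℝ,
      -- `α` is the density `α_p(S, p⁻¹T)`, where `S` is the matrix of `Q''` on `N₀` in any
      -- `ℤ_p`-basis, for any `Λ₀`, and `S = diag(1, 1, 1, Δ)` for a suitable basis
      (∀ Λ₀ : Submodule (SpecialTree.Zp2 p Δ) U, Λ₀.IsLattice (SpecialTree.Qp2 p Δ) →
        (∃ e : Fin 4 → SpecialTree.SpecialEnd B, SpecialTree.IsBasisOfN₀ Λ₀ e ∧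
          SpecialTree.gram e = Matrix.diagonal ![1, 1, 1, ((Δ : ℤ_[p]) : ℚ_[p])]) ∧
        (∀ e : Fin 4 → SpecialTree.SpecialEnd B, SpecialTree.IsBasisOfN₀ Λ₀ e →
          ∃ S : Matrix (Fin 4) (Fin 4) ℤ_[p],
            SpecialTree.gram e = S.map (fun z : ℤ_[p] => (z : ℚ_[p])) ∧
            SpecialTree.HasRepresentationDensity S T' α)) ∧
      -- the `ℤ_p`-span of `β` has a basis `gβ` of anisotropic vectors, and any such basis
      -- (for instance `β` itself, if its components are anisotropic) gives the same count
      (∃ g : GL (Fin 3) ℤ_[p], ∀ i, SpecialTree.Qpp (SpecialTree.changeBasis g β i) ≠ 0) ∧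
      (∀ g : GL (Fin 3) ℤ_[p], (∀ i, SpecialTree.Qpp (SpecialTree.changeBasis g β i) ≠ 0) →
        (SpecialTree.tubeVertices (SpecialTree.changeBasis g β)).Finite ∧
        ((SpecialTree.tubeVertices (SpecialTree.changeBasis g β)).ncard : ℝ) =
          (1 - (p : ℝ) ^ (-4 : ℤ))⁻¹ * α) := by
  have : Fact (p ≠ 2) := ⟨hp⟩
  have : Fact (¬ IsSquare (Δ : ℤ_[p])) := ⟨hΔ⟩
  have : Nontrivial U :=
    Module.nontrivial_of_finrank_pos (R := SpecialTree.Qp2 p Δ) (by omega)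
  have hsq : SpecialTree.SqSpec B := SpecialTree.sqSpec hΔ hU hB hnd
  have hp0 : (p : ℚ_[p]) ≠ 0 := SpecialTree.padic_p_ne_zero
  -- The factor `p` cancels: the Gram matrix of the tuple is `T' = p⁻¹T`.
  have hg : SpecialTree.gram β = T'.map (fun z : ℤ_[p] => (z : ℚ_[p])) := by
    ext i j
    have h1 := congrFun (congrFun hβ i) j
    rw [hT] at h1
    simp only [Matrix.map_apply, Matrix.smul_apply, smul_eq_mul, PadicInt.coe_mul,
      PadicInt.coe_natCast] at h1
    exact (mul_left_cancel₀ hp0 h1).symm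
  have hdet' : T'.det ≠ 0 := by
    intro h
    exact hdet (by rw [hT, Matrix.det_smul, h, mul_zero])
  have hfin := (SpecialTree.hasRepresentationDensity hU hsq hB hnd hT' hdet' hg (mul_one 1)).1
  -- The value is written in terms of the stable vertices, so it visibly involves neither `Λ₀` nor a
  -- basis of `N₀`.
  refine ⟨(1 - (p : ℝ) ^ (-4 : ℤ)) * ((SpecialTree.stableVertices β).ncard : ℝ),
    fun Λ hΛ => ?_, SpecialTree.exists_changeBasis_ne_zero hsq hT' hdet' hg, fun g hgQ => ?_⟩
  · obtain ⟨b, hb⟩ := SpecialTree.exists_basis_of_isLattice hU hΛ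
    obtain ⟨E, hE, hES⟩ := SpecialTree.exists_modelEquiv hsq hB hnd b
    have hEΛ : ∀ v, (∀ x ∈ Λ, (E v).1 x ∈ Λ) ↔ ∀ i, ‖v i‖ ≤ 1 := fun v => by
      rw [SpecialTree.forall_mem_lattice_iff hb, hES]
    constructor
    · obtain ⟨M, C, hC, hM⟩ := SpecialTree.exists_modelMatrix_equiv Δ
      refine ⟨_, SpecialTree.isBasisOfN₀_columns hEΛ hC, ?_⟩
      rw [SpecialTree.gram_columns hsq hE, hM]
      ext i j
      fin_cases i <;> fin_cases j <;> simp
    · intro e he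
      obtain ⟨M, C, hC, rfl⟩ := SpecialTree.exists_columns hEΛ he
      exact ⟨_, SpecialTree.gram_columns hsq hE M,
        (SpecialTree.hasRepresentationDensity hU hsq hB hnd hT' hdet' hg hC).2⟩
  · rw [SpecialTree.tubeVertices_changeBasis hU hsq g β hgQ]
    refine ⟨hfin, ?_⟩
    rw [inv_mul_cancel_left₀]
    have h1 : (1 : ℝ) < (p : ℝ) ^ 4 :=
      one_lt_pow₀ SpecialTree.one_lt_p (by norm_num)
    rw [zpow_neg, sub_ne_zero]
    exact (inv_lt_one_of_one_lt₀ (by exact_mod_cast h1)).ne'
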